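/- Setting. Let $D\subset\mathbb C$ be a simply connected domain and $\varphi:D\to\mathbb U$ a conformal map onto the open unit disc. It induces the metric $d_*(z,w)=|\varphi(z)-\varphi(w)|$ on $D$; the resulting completion of $D$ is identified with $\overline{\mathbb U}$. (For the upper half-plane with $\varphi(z)=\frac{z-i}{z+i}$ it is $\overline{\mathbb H}\cup\{\infty\}$.) Let $\Gamma$ be the space of nonempty closed subsets of this completion, with the Borel $\sigma$-algebra of the Hausdorff metric. For $A\in\Gamma$ and $B\subset D$, expressions such as $A\cap B$ and $D\setminus A$ are understood inside this completion. Let $H_s(D)=C_c^\infty(D)$, let $H(D)$ be its Hilbert space completion under $(f,g)_\nabla=\int_D\nabla f\cdot\nabla g$, and give the space of distributions on $D$ the $\sigma$-algebra generated by the maps $T\mapsto (T,\rho)$, $\rho\in H_s(D)$. For open $B\subset D$ let $\mathrm{Supp}_B$ be the closure in $H(D)$ of $C_c^\infty(B)$ and $\mathrm{Harm}_B$ its orthogonal complement in $H(D)$; write $-\Delta_B^{-1}\rho$ for the $f\in \mathrm{Supp}_B$ with $(f,g)_\nabla=\int\rho g$ for all $g\in C_c^\infty(B)$. A distribution $T$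 on $D$ is harmonic on $B$ if $(T,\Delta g)=0$ for all $g\in C_c^\infty(B)$. The zero boundary GFF on $B$ is the random distribution on $D$ for which each $(h,\rho)$, $\rho\in H_s(D)$, is a centered Gaussian of variance $\|-\Delta_B^{-1}\rho\|_\nabla^2$. A GFF on $D$ is a zero boundary GFF on $D$ plus a deterministic function $u$ harmonic on $D$ ($u=0$ for zero boundary conditions). For such $h$ and $f\in H(D)$, $(h,f)_\nabla$ is the $L^2$-limit of $(h,-\Delta g_n)$ for $g_n\in H_s(D)$ with $g_n\to f$ in $H(D)$; the $\sigma$-algebra generated by the projection of $h$ onto a closed subspace $K\subset H(D)$ is the one generated by the variables $(h,f)_\nabla$, $f\in K$, and the null events. Let $(h,A)$ be a coupling, on some probability space, of a GFF $h$ on $D$ with a random element $A$ of $\Gamma$. For $\delta>0$ let $A_\delta$ be the set of points of $D$ at $d_*$-distance at most $\delta$ from $A$, let $\mathcal A_\delta$ be the $\sigma$-algebra generated by $A$ and the restriction of $h$ to the interior of $A_\delta$ (that is, by $A$ and the variables $(h,\rho)\mathbf 1\{\operatorname{supp}\rho\subset \operatorname{int}A_\delta\}$, $\rho\in H_s(D)$),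 and let $\mathcal A=\bigcap_{\delta\in\mathbb Q,\,\delta>0}\mathcal A_\delta$. Consider the following conditions. 1. For each deterministic open $B\subset D$, given the projection of $h$ onto $\mathrm{Harm}_B$, the event $\{A\cap B=\emptyset\}$ is independent of the projection of $h$ onto $\mathrm{Supp}_B$. 2. For each deterministic open $B\subset D$, given the projection of $h$ onto $\mathrm{Harm}_B$, the pair $(S,\tilde A)$ is independent of the projection of $h$ onto $\mathrm{Supp}_B$, where $S=\{A\cap B\neq\emptyset\}$, and $\tilde A=A$ off $S$, $\tilde A=\emptyset$ on $S$. 3. There are an $\mathcal A$-measurable random distribution $h_1$ which is a.s. harmonic on $D\setminus A$ and a regular version of the conditional law of $h$ given $\mathcal A$ which is a.s. the law of $h_1+h_2$, where (given $\mathcal A$) $h_2$ is a zero boundary GFF on $D\setminus A$. 4. A sample with the law of $(h,A)$ can be produced as follows: choose $(h_1,A)$ according to some law under which $h_1$ is a random distribution that is a.s. harmonic on $D\setminus A$; then, given $(h_1,A)$, sample a zero boundary GFF $h_2$ on $D\setminus A$, and set $h=h_1+h_2$. Lemma. Conditions 2, 3 and 4 are equivalent, and they imply 1. If moreover $A$ is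 a.s. determined by $A\cap D$ (up to null events, every event $\{A\in E\}$, $E\subset\Gamma$ Borel, belongs to the $\sigma$-algebra generated by the events $\{A\cap B=\emptyset\}$, $B\subset D$ open), then all four conditions are equivalent. Finally, condition 1 is always equivalent to the following: for each deterministic open $B\subset D$, the conditional probability of $\{A\cap B=\emptyset\}$ given $h$ is a.s. equal to a measurable function of the projection of $h$ onto $\mathrm{Harm}_B$. (When these equivalent conditions hold, $A$ is called a local set.) -/

import Mathlib

open MeasureTheory ProbabilityTheory Filter Set TopologicalSpace
open scoped Topology Distributions LineDeriv ENNReal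

noncomputable section

namespace LocalSetGFF

/-! ### Test functions and distributions on a planar domain -/

/-- `H_s(D)`: smooth real functions with compact support in `D`. -/
abbrev TestFn (D : Opens ℂ) : Type := 𝓓(D, ℝ)

/-- The space of distributions on `D`. -/
abbrev Distr (D : Opens ℂ) : Type := 𝓓'(D, ℝ)

/-- The smallest σ-algebra on distributions making all evaluations `T ↦ (T, ρ)` measurable. -/
instance instMeasurableSpaceDistr (D : Opens ℂ) : MeasurableSpace (Distr D) :=
  ⨆ ρ : TestFn D, MeasurableSpace.comap (fun T : Distr D => T ρ) (borel ℝ)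

/-- The Laplacian of a test function. -/
def lap {D : Opens ℂ} (g : TestFn D) : TestFn D :=
  ∂_{(1 : ℂ)} (∂_{(1 : ℂ)} g) + ∂_{Complex.I} (∂_{Complex.I} g)

/-- A distribution on `D` is harmonic on `B`: its distributional Laplacian vanishes against every
test function supported in `B`. -/
def IsHarmonicOn {D : Opens ℂ} (B : Set ℂ) (T : Distr D) : Prop :=
  ∀ g : TestFn D, tsupport g ⊆ B → T (lap g) = 0

/-! ### The Dirichlet space

An element `f` of the Hilbert space completion of `H_s(D)` under the Dirichlet inner product
`(f, g)_∇ = ∫ ∇f ⋅ ∇g` is represented by its gradient, a square integrable vector field; the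
completion is then the closure of the gradients of test functions, with the inner product of `L²`. -/

/-- Square integrable vector fields on the plane (a real Hilbert space). -/
abbrev VectorL2 : Type := Lp ℂ 2 (volume : Measure ℂ)

theorem memLp_gradient {D : Opens ℂ} (g : TestFn D) :
    MemLp (gradient (g : ℂ → ℝ)) 2 (volume : Measure ℂ) := by
  have hd : ContDiff ℝ 1 (g : ℂ → ℝ) := g.contDiff.of_le (by exact_mod_cast le_top)
  have hc : Continuous (fderiv ℝ (g : ℂ → ℝ)) := hd.continuous_fderiv (by simp)
  refine Continuous.memLp_of_hasCompactSupport (p := 2) ?_ ?_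
  · exact (InnerProductSpace.toDual ℝ ℂ).symm.continuous.comp hc
  · exact (g.hasCompactSupport.fderiv ℝ).comp_left
      (g := (InnerProductSpace.toDual ℝ ℂ).symm) (map_zero _)

/-- The class in `L²` of the gradient of a test function. -/
def gradL2 {D : Opens ℂ} (g : TestFn D) : VectorL2 := (memLp_gradient g).toLp _

/-- `Supp_B`, for `B ⊆ D`: the closure in `H(D)` of the smooth functions compactly supported
in `B`. -/
def suppSpace (D : Opens ℂ) (B : Set ℂ) : Submodule ℝ VectorL2 :=
  (Submodule.span ℝ {v | ∃ g : TestFn D, tsupport g ⊆ B ∧ v = gradL2 g}).topologicalClosure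

/-- `H(D)`. -/
def dirichletSpace (D : Opens ℂ) : Submodule ℝ VectorL2 := suppSpace D D

/-- `Harm_B`: the orthogonal complement of `Supp_B` in `H(D)`. -/
def harmSpace (D : Opens ℂ) (B : Set ℂ) : Submodule ℝ VectorL2 :=
  dirichletSpace D ⊓ (suppSpace D B)ᗮ

/-- `f = -Δ_B⁻¹ ρ`: the element of `Supp_B` with `-Δ f = ρ` weakly on `B` (zero boundary values on
`∂B`). Then `‖f‖² = ∬_{B × B} ρ(x) ρ(y) G_B(x, y) dx dy`, with `G_B` the Green function of `B`. -/
def IsPotential (D : Opens ℂ) (B : Set ℂ) (ρ : TestFn D) (f : VectorL2) : Prop :=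
  f ∈ suppSpace D B ∧
    ∀ g : TestFn D, tsupport g ⊆ B → inner ℝ f (gradL2 g) = ∫ z, ρ z * g z

/-! ### Gaussian free fields -/

/-- `μ` is the law of the zero boundary GFF on the open set `B ⊆ D`, as a random distribution
on `D`: each `(h, ρ)` is a centered Gaussian of variance `‖-Δ_B⁻¹ ρ‖²_∇`. -/
def IsZeroGFFLaw (D : Opens ℂ) (B : Set ℂ) (μ : Measure (Distr D)) : Prop :=
  ∀ ρ : TestFn D, ∃ f : VectorL2, IsPotential D B ρ f ∧
    μ.map (fun T => T ρ) = gaussianReal 0 (‖f‖₊ ^ 2)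

section Probability

variable {Ω : Type*} [MeasurableSpace Ω]

/-- `h` is an instance of the GFF on `D` with mean the harmonic function `u` (`u = 0` for zero
boundary conditions; `u` the harmonic extension of the boundary values otherwise). -/
structure IsGFF (D : Opens ℂ) (u : ℂ → ℝ) (P : Measure Ω) (h : Ω → Distr D) : Prop where
  measurable : Measurable h
  law : ∀ ρ : TestFn D, ∃ f : VectorL2, IsPotential D D ρ f ∧
    P.map (fun ω => h ω ρ) = gaussianReal (∫ z, u z * ρ z) (‖f‖₊ ^ 2)

/-- `X` is a version of the random variable `(h, f)_∇`, for `f ∈ H(D)`: the `L²(P)`-limit of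
`(h, g_n)_∇ = (h, -Δ g_n)` along test functions `g_n` converging to `f` in `H(D)`. -/
def IsDirichletPairing {D : Opens ℂ} (P : Measure Ω) (h : Ω → Distr D) (f : VectorL2)
    (X : Ω → ℝ) : Prop :=
  ∃ g : ℕ → TestFn D, Tendsto (fun n => gradL2 (g n)) atTop (𝓝 f) ∧
    Tendsto (fun n => eLpNorm (fun ω => X ω - h ω (-lap (g n))) 2 P) atTop (𝓝 0)

/-- The σ-algebra generated by the projection of `h` onto the closed subspace `K` of `H(D)`, i.e.
by the (almost surely defined) random variables `(h, f)_∇`, `f ∈ K`. All measurable versions are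
included, so that the σ-algebra contains the null events. -/
@[reducible]
def projSigma {D : Opens ℂ} (P : Measure Ω) (h : Ω → Distr D) (K : Submodule ℝ VectorL2) :
    MeasurableSpace Ω :=
  ⨆ X : {X : Ω → ℝ // Measurable X ∧ ∃ f ∈ K, IsDirichletPairing P h f X},
    MeasurableSpace.comap X.1 (borel ℝ)

/-- Conditional independence of `m₁` and `m₂` given `m`. (On standard Borel spaces this is
`ProbabilityTheory.CondIndep`.) -/
def CondIndepGiven (P : Measure Ω) (m m₁ m₂ : MeasurableSpace Ω) : Prop :=
  ∀ s t : Set Ω, MeasurableSet[m₁] s → MeasurableSet[m₂] t →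
    P⟦s ∩ t | m⟧ =ᵐ[P] P⟦s | m⟧ * P⟦t | m⟧

end Probability

/-! ### Random closed sets

A conformal map `φ` of `D` onto the unit disc is fixed, and the compactification of `D` which it
induces is identified with the closed unit disc, with the metric `d_*(z, w) = |φ z - φ w|`. For the
upper half-plane and `φ z = (z - i) / (z + i)` this is the closed half-plane together with `∞`. -/

/-- Nonempty closed subsets of the closed unit disc, with the Hausdorff metric. -/
abbrev ClosedSets : Type :=
  {K : NonemptyCompacts ℂ // (K : Set ℂ) ⊆ Metric.closedBall (0 : ℂ) 1}

/-- The Borel σ-algebra of the Hausdorff metric. -/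
instance instMeasurableSpaceClosedSets : MeasurableSpace ClosedSets := borel ClosedSets

/-- `D ∖ A`. -/
def offSet (D : Opens ℂ) (φ : ℂ → ℂ) (K : ClosedSets) : Set ℂ :=
  {z | z ∈ D ∧ φ z ∉ (K.1 : Set ℂ)}

/-- `A_δ`: the points of `D` at `d_*`-distance at most `δ` from `A`. -/
def thickening (D : Opens ℂ) (φ : ℂ → ℂ) (K : ClosedSets) (δ : ℝ) : Set ℂ :=
  {z | z ∈ D ∧ Metric.infDist (φ z) (K.1 : Set ℂ) ≤ δ}

section RandomSets

variable {Ω : Type*} [MeasurableSpace Ω]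

/-- The event `A ∩ B = ∅`, for `B ⊆ D`. -/
def avoids (φ : ℂ → ℂ) (A : Ω → ClosedSets) (B : Set ℂ) : Set Ω :=
  {ω | ∀ z ∈ B, φ z ∉ ((A ω).1 : Set ℂ)}

open Classical in
/-- The pair `(S, Ã)`: `S` is the event that `A` intersects `B`, and `Ã` is `A` off the event `S`
and the empty set on `S`. -/
def hitPair (φ : ℂ → ℂ) (A : Ω → ClosedSets) (B : Set ℂ) (ω : Ω) : Prop × Compacts ℂ :=
  (ω ∉ avoids φ A B, if ω ∈ avoids φ A B then (A ω).1.toCompacts else ⊥)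

/-- The σ-algebra generated by the pair `(S, Ã)`. -/
@[reducible]
def hitSigma (φ : ℂ → ℂ) (A : Ω → ClosedSets) (B : Set ℂ) : MeasurableSpace Ω :=
  MeasurableSpace.comap (hitPair φ A B)
    (MeasurableSpace.prod ⊤ (borel (Compacts ℂ)))

open Classical in
/-- `𝒜_δ`: the σ-algebra generated by `A` and the restriction of `h` to the interior of `A_δ`,
i.e. by `A` and the values `(h, ρ)` for those `ρ` that are supported in this random open set. -/
@[reducible]
def nbhdSigma {D : Opens ℂ} (φ : ℂ → ℂ) (h : Ω → Distr D) (A : Ω → ClosedSets) (δ : ℝ) :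
    MeasurableSpace Ω :=
  MeasurableSpace.comap A inferInstance ⊔
    ⨆ ρ : TestFn D, MeasurableSpace.comap
      (fun ω => if tsupport ρ ⊆ interior (thickening D φ (A ω) δ) then h ω ρ else 0) (borel ℝ)

/-- `𝒜`: the intersection of the `𝒜_δ` over rational `δ > 0`. -/
@[reducible]
def germSigma {D : Opens ℂ} (φ : ℂ → ℂ) (h : Ω → Distr D) (A : Ω → ClosedSets) :
    MeasurableSpace Ω :=
  ⨅ δ : {q : ℚ // 0 < q}, nbhdSigma φ h A (δ.1 : ℝ)

/-- `A` is almost surely determined by its trace `A ∩ D`: up to null events, every event about `A`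
belongs to the σ-algebra generated by the events `A ∩ B = ∅`, `B ⊆ D` open. -/
def IsDeterminedInside (D : Opens ℂ) (φ : ℂ → ℂ) (P : Measure Ω) (A : Ω → ClosedSets) : Prop :=
  ∀ E : Set ClosedSets, MeasurableSet E → ∃ F : Set Ω,
    MeasurableSet[MeasurableSpace.generateFrom
      {G | ∃ B : Set ℂ, IsOpen B ∧ B ⊆ D ∧ G = avoids φ A B}] F ∧ A ⁻¹' E =ᵐ[P] F

/-! ### The conditions -/

/-- For open `B ⊆ D`, given the projection of `h` onto `Harm_B`, the event `A ∩ B = ∅` is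
independent of the projection of `h` onto `Supp_B`. -/
def EventCondIndep {D : Opens ℂ} (φ : ℂ → ℂ) (P : Measure Ω) (h : Ω → Distr D)
    (A : Ω → ClosedSets) : Prop :=
  ∀ B : Set ℂ, IsOpen B → B ⊆ D →
    CondIndepGiven P (projSigma P h (harmSpace D B))
      (MeasurableSpace.generateFrom {avoids φ A B}) (projSigma P h (suppSpace D B))

/-- For open `B ⊆ D`, the conditional probability of `A ∩ B = ∅` given `h` is a measurable
function of the projection of `h` onto `Harm_B`. -/
def EventCondProb {D : Opens ℂ} (φ : ℂ → ℂ) (P : Measure Ω) (h : Ω → Distr D)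
    (A : Ω → ClosedSets) : Prop :=
  ∀ B : Set ℂ, IsOpen B → B ⊆ D →
    AEStronglyMeasurable[projSigma P h (harmSpace D B)]
      (P⟦avoids φ A B | MeasurableSpace.comap h inferInstance⟧) P

/-- For open `B ⊆ D`, given the projection of `h` onto `Harm_B`, the pair `(S, Ã)` is
independent of the projection of `h` onto `Supp_B`. -/
def PairCondIndep {D : Opens ℂ} (φ : ℂ → ℂ) (P : Measure Ω) (h : Ω → Distr D)
    (A : Ω → ClosedSets) : Prop :=
  ∀ B : Set ℂ, IsOpen B → B ⊆ D →
    CondIndepGiven P (projSigma P h (harmSpace D B)) (hitSigma φ A B)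
      (projSigma P h (suppSpace D B))

/-- There are an `𝒜`-measurable random distribution `h₁`, almost surely harmonic on `D ∖ A`, and a
regular version `κ` of the conditional law of `h` given `𝒜`, such that almost surely `κ` is the law
of `h₁ + h₂` with `h₂` a zero boundary GFF on `D ∖ A`. -/
def CondLaw {D : Opens ℂ} (φ : ℂ → ℂ) (P : Measure Ω) (h : Ω → Distr D)
    (A : Ω → ClosedSets) : Prop :=
  ∃ h₁ : Ω → Distr D, Measurable[germSigma φ h A] h₁ ∧
    (∀ᵐ ω ∂P, IsHarmonicOn (offSet D φ (A ω)) (h₁ ω)) ∧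
    ∃ κ : Kernel[germSigma φ h A] Ω (Distr D), IsMarkovKernel κ ∧
      (∀ E : Set (Distr D), MeasurableSet E →
        (fun ω => (κ ω).real E) =ᵐ[P] P⟦h ⁻¹' E | germSigma φ h A⟧) ∧
      ∀ᵐ ω ∂P, IsZeroGFFLaw D (offSet D φ (A ω)) ((κ ω).map (fun T => T - h₁ ω))

/-- The law of `(h, A)` is that of `(h₁ + h₂, A)`, where `(h₁, A)` is sampled from some law `ν`
under which `h₁` is almost surely harmonic on `D ∖ A`, and then, given `(h₁, A)`, the field `h₂` is
sampled as a zero boundary GFF on `D ∖ A`. -/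
def TwoStepSampling {D : Opens ℂ} (φ : ℂ → ℂ) (P : Measure Ω) (h : Ω → Distr D)
    (A : Ω → ClosedSets) : Prop :=
  ∃ ν : Measure (Distr D × ClosedSets), IsProbabilityMeasure ν ∧
    (∀ᵐ p ∂ν, IsHarmonicOn (offSet D φ p.2) p.1) ∧
    ∃ η : Kernel (Distr D × ClosedSets) (Distr D), IsMarkovKernel η ∧
      (∀ᵐ p ∂ν, IsZeroGFFLaw D (offSet D φ p.2) (η p)) ∧
      (ν ⊗ₘ η).map (fun q => (q.1.1 + q.2, q.1.2)) = P.map (fun ω => (h ω, A ω))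

end RandomSets

end LocalSetGFF

end

open MeasureTheory ProbabilityTheory Filter Set TopologicalSpace
open scoped Topology Distributions LineDeriv ENNReal

noncomputable section

namespace LocalSetGFF

/-! The field is treated as an isonormal process: `GaussianRep` provides a map `X` from H(D) into
L²(P), isometric with Gaussian characteristic functions, such that (h, ρ) is its mean plus `X` of
the potential of ρ. For an open B, H(D) is the orthogonal sum of Supp_B and Harm_B, so the two
projections of h are independent Gaussian families. Everything is phrased through one property of an
event s, `SplitsOn`: on s, adding g ∈ Supp_B to F multiplies E[1_s exp(iX(F))] by the factor
exp(-(⟨F,g⟩ + ‖g‖²/2)) of an unconditioned Gaussian. By uniqueness of characteristic functions this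
says that 1_s and the Harm_B projection are jointly independent of the Supp_B projection
(`splitsOn_iff_decouples`). Condition 1 is splitting of {A ∩ B = ∅}, condition 2 is splitting of {A
∩ B = ∅, A ∈ E} for all Borel E, and the conditional probability form of 1 is the same splitting,
because up to null events σ(h) is generated by the two projections.

1 ⇒ 2 when A is determined inside D: avoiding B and B' is avoiding B ∪ B', so condition 1 for B ∪ B'
splits the intersection, and a π-λ argument reaches all events of A.

4 ⇒ 2: if A misses B, then h₁ does not see Laplacians of functions supported in B, and the variance
of h₂ on D ∖ A produces exactly the required factor.

2 ⇒ 3: A is discretized at scale rₙ = 4⁻ⁿ by the finite set of net points near it. Where this set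
equals I, A stays away from the deterministic open set B = `farSet D φ n I`; condition 2 then gives,
relative to A and the field near A, the conditional mean X(F - P_B F) and the variance ‖P_B F‖²,
where P_B is the projection onto Supp_B. As n grows the sets B increase to D ∖ A and the means
converge in L², their increments being controlled by increments of variance (`norm_approx_sub_sq`).
Vectors of Harm_B are limits of potentials of test functions supported near I
(`harmSpace_farSet_le`); the cutoffs used there are bounded in the Dirichlet norm by a Poincaré
inequality transported by φ. Hence the limit mean is 𝒜-measurable (`exists_condMean`). It is only a
family of random variables; to obtain a random distribution one uses that the space of distributions
is standard Borel, embedded by evaluation on a countable rational space, together with a regular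
conditional law: the mean of a Gaussian is bounded wherever the variable is bounded with probability
above 1/2, so continuity of the sampled distributions passes to the mean
(`isBounded_of_integral_cis`).

3 ⇒ 4: given 𝒜, the characteristic function of h - h₁ depends on A alone, so conditioning only on
(h₁, A) gives the same Gaussian law. -/

/-! ### The space of distributions is standard Borel -/

/-- There is a countable family of compact subsets of `D` that interpolates between any compact set
and any open neighbourhood of it in `D`. -/
theorem exists_interpolating_compacts (D : Opens ℂ) :
    ∃ L : ℕ → Compacts ℂ, (∀ n, (L n : Set ℂ) ⊆ D) ∧
      ∀ K U : Set ℂ, IsCompact K → IsOpen U → K ⊆ U → U ⊆ D →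
        ∃ n, K ⊆ L n ∧ (L n : Set ℂ) ⊆ U := by
  -- Candidates are closures of finite unions of basic open sets: countably many, and fine enough to
  -- cover K inside a compact neighbourhood of it contained in U.
  let S : Set (Compacts ℂ) := {C | (C : Set ℂ) ⊆ D ∧ ∃ F : Set (Set ℂ), F.Finite ∧
    F ⊆ countableBasis ℂ ∧ (C : Set ℂ) = closure (⋃₀ F)}
  have hcount : S.Countable := by
    have h0 : {F : Set (Set ℂ) | F.Finite ∧ F ⊆ countableBasis ℂ}.Countable :=
      Set.countable_ofPred_finite_subset (countable_countableBasis ℂ)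
    have h1 := h0.image (fun F => closure (⋃₀ F))
    refine MapsTo.countable_of_injOn (f := fun C : Compacts ℂ => (C : Set ℂ)) ?_ ?_ h1
    · rintro C ⟨-, F, hF, hFb, hC⟩
      exact ⟨F, ⟨hF, hFb⟩, hC.symm⟩
    · exact fun _ _ _ _ h => Compacts.ext h
  have hne : S.Nonempty := ⟨⊥, by simp, ∅, by simp, by simp, by simp⟩
  obtain ⟨L, hL⟩ := hcount.exists_eq_range hne
  refine ⟨L, fun n => (hL ▸ mem_range_self n : L n ∈ S).1, fun K U hK hU hKU hUD => ?_⟩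
  obtain ⟨K', hK', hKK', hK'U⟩ := exists_compact_between hK hU hKU
  have hcov : ∀ x ∈ K, ∃ b ∈ countableBasis ℂ, x ∈ b ∧ b ⊆ interior K' := fun x hx => by
    obtain ⟨b, hb, hxb, hbs⟩ := (isBasis_countableBasis ℂ).exists_subset_of_mem_open
      (hKK' hx) isOpen_interior
    exact ⟨b, hb, hxb, hbs⟩
  choose! b hb hxb hbs using hcov
  obtain ⟨t, ht, htK⟩ := hK.elim_nhds_subcover b
    (fun x hx => (isOpen_of_mem_countableBasis (hb x hx)).mem_nhds (hxb x hx))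
  have hsub : closure (⋃₀ (b '' (t : Set ℂ))) ⊆ K' := by
    refine closure_minimal ?_ hK'.isClosed
    rintro x ⟨_, ⟨y, hy, rfl⟩, hx⟩
    exact interior_subset (hbs y (ht y hy) hx)
  have hmem : (⟨closure (⋃₀ (b '' (t : Set ℂ))),
      hK'.of_isClosed_subset isClosed_closure hsub⟩ : Compacts ℂ) ∈ S := by
    refine ⟨(hsub.trans hK'U).trans hUD, b '' (t : Set ℂ), t.finite_toSet.image _, ?_, rfl⟩
    rintro _ ⟨y, hy, rfl⟩
    exact hb y (ht y hy)
  rw [hL] at hmem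
  obtain ⟨n, hn⟩ := hmem
  refine ⟨n, ?_, ?_⟩
  · rw [hn]
    refine fun x hx => subset_closure ?_
    obtain ⟨y, hy, hxy⟩ := mem_iUnion₂.1 (htK hx)
    exact ⟨b y, ⟨y, hy, rfl⟩, hxy⟩
  · rw [hn]
    exact hsub.trans hK'U

instance instSecondCountableContinuousMultilinearMap (i : ℕ) :
    SecondCountableTopology (ContinuousMultilinearMap ℝ (fun _ : Fin i => ℂ) ℝ) := by
  have hinj : Function.Injective (ContinuousMultilinearMap.toMultilinearMapLinear :
      ContinuousMultilinearMap ℝ (fun _ : Fin i => ℂ) ℝ →ₗ[ℝ] _) :=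
    ContinuousMultilinearMap.toMultilinearMap_injective
  have : FiniteDimensional ℝ (ContinuousMultilinearMap ℝ (fun _ : Fin i => ℂ) ℝ) :=
    FiniteDimensional.of_injective _ hinj
  have := FiniteDimensional.proper ℝ (ContinuousMultilinearMap ℝ (fun _ : Fin i => ℂ) ℝ)
  infer_instance

/-- Bounded continuous functions vanishing outside a compact set form a second countable space. -/
theorem secondCountable_boundedContinuous_supported {F : Type*} [NormedAddCommGroup F]
    [SecondCountableTopology F] (K : Compacts ℂ) :
    SecondCountableTopology {f : BoundedContinuousFunction ℂ F // ∀ x ∉ K, f x = 0} := by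
  let R : {f : BoundedContinuousFunction ℂ F // ∀ x ∉ K, f x = 0} → C(K, F) :=
    fun f => (f.1.toContinuousMap).restrict (K : Set ℂ)
  have hR : Isometry R := by
    refine Isometry.of_dist_eq fun f g => le_antisymm ?_ ?_
    · rw [ContinuousMap.dist_le dist_nonneg]
      exact fun x => BoundedContinuousFunction.dist_coe_le_dist (f := f.1) (g := g.1) x.1
    · refine (BoundedContinuousFunction.dist_le dist_nonneg).2 fun x => ?_
      by_cases hx : x ∈ K
      · exact ContinuousMap.dist_apply_le_dist (f := R f) (g := R g) ⟨x, hx⟩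
      · rw [f.2 x hx, g.2 x hx, dist_self]
        exact dist_nonneg
  exact hR.isEmbedding.secondCountableTopology

/-- The topology is induced by all iterated derivatives, and each of them lies in a separable space
because it vanishes off the fixed compact set; bounded continuous functions on the whole plane would
not be second countable. -/
instance instSecondCountableSupportedIn (K : Compacts ℂ) :
    SecondCountableTopology 𝓓_{K}(ℂ, ℝ) := by
  have := fun i : ℕ => secondCountable_boundedContinuous_supported
    (F := ContinuousMultilinearMap ℝ (fun _ : Fin i => ℂ) ℝ) K
  let J : 𝓓_{K}(ℂ, ℝ) → ∀ i : ℕ, {f : BoundedContinuousFunction ℂ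
      (ContinuousMultilinearMap ℝ (fun _ : Fin i => ℂ) ℝ) // ∀ x ∉ K, f x = 0} := fun f i =>
    ⟨ContDiffMapSupportedIn.structureMapCLM ℝ ⊤ i f, fun x hx => by
      have := ContDiffMapSupportedIn.structureMapCLM_top_apply ℝ (i := i) f
      rw [this]
      exact ContDiffMapSupportedIn.iteratedFDeriv_zero_on_compl f hx⟩
  have hemb := (ContDiffMapSupportedIn.isUniformEmbedding_pi_structureMapCLM ℝ
    (E := ℂ) (F := ℝ) (n := ⊤) (K := K)).isEmbedding
  have hJ : Continuous J := continuous_pi fun i =>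
    Continuous.subtype_mk (ContDiffMapSupportedIn.structureMapCLM ℝ ⊤ i).continuous _
  have hcomp : Topology.IsEmbedding ((fun g i => (g i).1) ∘ J) := hemb
  have : Topology.IsEmbedding J := .of_comp hJ
    (continuous_pi fun i => continuous_subtype_val.comp (continuous_apply i)) hcomp
  exact this.secondCountableTopology

/-- A test function, as an element of the Fréchet space of functions supported in `K`. -/
def restrictTo {D : Opens ℂ} (ρ : TestFn D) {K : Compacts ℂ} (h : tsupport ρ ⊆ K) :
    𝓓_{K}(ℂ, ℝ) :=
  .of_support_subset ρ.contDiff ((subset_tsupport _).trans h)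

/-- The Laplacian as a continuous linear map. -/
def lapCLM (D : Opens ℂ) : TestFn D →L[ℝ] TestFn D :=
  LineDeriv.lineDerivOpCLM ℝ (TestFn D) (1 : ℂ) ∘L LineDeriv.lineDerivOpCLM ℝ (TestFn D) (1 : ℂ) +
    LineDeriv.lineDerivOpCLM ℝ (TestFn D) Complex.I ∘L LineDeriv.lineDerivOpCLM ℝ (TestFn D) Complex.I

theorem lapCLM_apply {D : Opens ℂ} (g : TestFn D) : lapCLM D g = lap g := rfl

/-- A countable rational vector space of test functions, stable under the Laplacian, together with
an interpolating sequence of compact sets, such that the functions of the space supported in each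
of these compact sets are dense. -/
structure DenseTestSpace (D : Opens ℂ) where
  L : ℕ → Compacts ℂ
  subset (n : ℕ) : (L n : Set ℂ) ⊆ D
  interpolate (K U : Set ℂ) : IsCompact K → IsOpen U → K ⊆ U → U ⊆ D →
    ∃ n, K ⊆ L n ∧ (L n : Set ℂ) ⊆ U
  Q : Submodule ℚ (TestFn D)
  countable : (Q : Set (TestFn D)).Countable
  lap_mem {q : TestFn D} : q ∈ Q → lap q ∈ Q
  dense (n : ℕ) : Dense {f : 𝓓_{L n}(ℂ, ℝ) | TestFunction.ofSupportedIn (subset n) f ∈ Q}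

theorem countable_span_rat {V : Type*} [AddCommGroup V] [Module ℚ V] {s : Set V}
    (hs : s.Countable) : ((Submodule.span ℚ s : Submodule ℚ V) : Set V).Countable := by
  have := hs.to_subtype
  rw [← Subtype.range_coe (s := s), ← Finsupp.range_linearCombination]
  exact countable_range _

/-- Dense sequences on the levels are closed up under iterates of the Laplacian and then under
rational combinations; both operations keep countability. -/
theorem nonempty_denseTestSpace (D : Opens ℂ) : Nonempty (DenseTestSpace D) := by
  obtain ⟨L, hL, hint⟩ := exists_interpolating_compacts D
  let S : Set (TestFn D) := ⋃ n, TestFunction.ofSupportedIn (hL n) ''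
    (range (denseSeq 𝓓_{L n}(ℂ, ℝ)))
  have hS : S.Countable := countable_iUnion fun n => (countable_range _).image _
  let S' : Set (TestFn D) := ⋃ k : ℕ, (lapCLM D)^[k] '' S
  have hS' : S'.Countable := countable_iUnion fun k => hS.image _
  refine ⟨⟨L, hL, hint, Submodule.span ℚ S', countable_span_rat hS', ?_, fun n => ?_⟩⟩
  · intro q hq
    induction hq using Submodule.span_induction with
    | mem x hx =>
      obtain ⟨k, y, hy, rfl⟩ := mem_iUnion.1 hx
      refine Submodule.subset_span (mem_iUnion.2 ⟨k + 1, y, hy, ?_⟩)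
      rw [Function.iterate_succ_apply', lapCLM_apply]
    | zero => rw [← lapCLM_apply, map_zero]; exact zero_mem _
    | add x y _ _ hx hy => rw [← lapCLM_apply, map_add]; exact Submodule.add_mem _ hx hy
    | smul a x _ hx =>
      have : lap (a • x) = a • lap x := by
        simp only [← lapCLM_apply]
        exact map_rat_smul (lapCLM D) a x
      rw [this]
      exact Submodule.smul_mem _ a hx
  · refine (denseRange_denseSeq 𝓓_{L n}(ℂ, ℝ)).mono ?_
    rintro _ ⟨k, rfl⟩
    exact Submodule.subset_span (mem_iUnion.2 ⟨0, _, mem_iUnion.2 ⟨n, _, ⟨k, rfl⟩, rfl⟩, rfl⟩)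

namespace DenseTestSpace

variable {D : Opens ℂ} (𝒬 : DenseTestSpace D)

instance : Countable 𝒬.Q := 𝒬.countable.to_subtype

/-- Every test function is the limit of a sequence in the dense space with supports in any
prescribed compact set of the sequence containing the support. -/
theorem exists_seq_tendsto (n : ℕ) (ρ : TestFn D) (hρ : tsupport ρ ⊆ 𝒬.L n) :
    ∃ q : ℕ → 𝒬.Q, (∀ k, tsupport (q k : TestFn D) ⊆ 𝒬.L n) ∧
      Tendsto (fun k => (q k : TestFn D)) atTop (𝓝 ρ) := by
  obtain ⟨f, hf, hlim⟩ := mem_closure_iff_seq_limit.1 (𝒬.dense n (restrictTo ρ hρ))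
  refine ⟨fun k => ⟨_, hf k⟩, fun k => (f k).tsupport_subset, ?_⟩
  exact ((TestFunction.continuous_ofSupportedIn (𝒬.subset n)).tendsto (restrictTo ρ hρ)).comp hlim

theorem exists_subset (ρ : TestFn D) : ∃ n, tsupport ρ ⊆ 𝒬.L n := by
  obtain ⟨n, hn, -⟩ := 𝒬.interpolate _ D ρ.hasCompactSupport D.isOpen ρ.tsupport_subset Subset.rfl
  exact ⟨n, hn⟩

theorem exists_seq_tendsto' (ρ : TestFn D) :
    ∃ q : ℕ → 𝒬.Q, Tendsto (fun k => (q k : TestFn D)) atTop (𝓝 ρ) := by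
  obtain ⟨n, hn⟩ := 𝒬.exists_subset ρ
  obtain ⟨q, -, hq⟩ := 𝒬.exists_seq_tendsto n ρ hn
  exact ⟨q, hq⟩

/-- The elements of the dense space supported in one of the compact sets. -/
def level (n : ℕ) : Submodule ℚ 𝓓_{𝒬.L n}(ℂ, ℝ) where
  carrier := {f | TestFunction.ofSupportedIn (𝒬.subset n) f ∈ 𝒬.Q}
  add_mem' hf hg := 𝒬.Q.add_mem hf hg
  zero_mem' := 𝒬.Q.zero_mem
  smul_mem' c _ hf := 𝒬.Q.smul_mem c hf

/-- The inclusion of a level in the dense space. -/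
def incl (n : ℕ) (f : 𝒬.level n) : 𝒬.Q := ⟨TestFunction.ofSupportedIn (𝒬.subset n) f.1, f.2⟩

/-- A functional on the dense space is bounded if on each level it is bounded by a multiple of one
of the defining seminorms. -/
def IsBounded (a : 𝒬.Q → ℝ) : Prop :=
  ∀ n, ∃ k : ℕ, ∀ f : 𝒬.level n,
    |a (𝒬.incl n f)| ≤ k * ContDiffMapSupportedIn.supSeminorm ℝ ℂ ℝ ⊤ (𝒬.L n) k f.1

theorem isBounded_distr (T : Distr D) : 𝒬.IsBounded (fun q => T q) := by
  intro n
  let p := ContDiffMapSupportedIn.supSeminorm ℝ ℂ ℝ ⊤ (𝒬.L n)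
  have hp : WithSeminorms p := ContDiffMapSupportedIn.withSeminorms' ℝ ℂ ℝ ⊤ (𝒬.L n)
  have hmono : Monotone p := fun i j hij => Finset.sup_mono (Finset.Iic_subset_Iic.2 hij)
  let A : 𝓓_{𝒬.L n}(ℂ, ℝ) →L[ℝ] ℝ :=
    (show TestFn D →L[ℝ] ℝ from T) ∘L TestFunction.ofSupportedInCLM ℝ (𝒬.subset n)
  let r : Seminorm ℝ 𝓓_{𝒬.L n}(ℂ, ℝ) := (normSeminorm ℝ ℝ).comp A.toLinearMap
  have hr : Continuous r := continuous_norm.comp A.continuous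
  obtain ⟨s, C, -, hle⟩ := Seminorm.bound_of_continuous hp r hr
  -- The seminorms increase with the order, so a single integer can serve both as the constant and
  -- as the order of the bound.
  obtain ⟨k, hk⟩ : ∃ k : ℕ, (C : ℝ) ≤ k ∧ ∀ i ∈ s, i ≤ k := by
    obtain ⟨k, hk⟩ := exists_nat_ge (C : ℝ)
    refine ⟨max k (s.sup id), hk.trans (by exact_mod_cast le_max_left _ _), fun i hi => ?_⟩
    exact (Finset.le_sup (f := id) hi).trans (le_max_right _ _)
  refine ⟨k, fun f => ?_⟩
  have h1 : s.sup p ≤ p k := Finset.sup_le fun i hi => hmono (hk.2 i hi)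
  calc |T (𝒬.incl n f)| = r f.1 := rfl
    _ ≤ (C • s.sup p) f.1 := hle f.1
    _ = C * (s.sup p) f.1 := rfl
    _ ≤ k * p k f.1 := mul_le_mul hk.1 (h1 f.1) (apply_nonneg _ _) (Nat.cast_nonneg _)

theorem exists_extension_level {a : 𝒬.Q → ℝ} (hadd : ∀ q q', a (q + q') = a q + a q')
    (hb : 𝒬.IsBounded a) (n : ℕ) :
    ∃ T : 𝓓_{𝒬.L n}(ℂ, ℝ) →L[ℝ] ℝ, ∀ f : 𝒬.level n, T f.1 = a (𝒬.incl n f) := by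
  let a₀ : 𝒬.level n →+ ℝ := AddMonoidHom.mk' (fun f => a (𝒬.incl n f)) fun f g => hadd (𝒬.incl n f) (𝒬.incl n g)
  obtain ⟨k, hk⟩ := hb n
  have hcont : Continuous a₀ := by
    refine continuous_of_continuousAt_zero a₀ ?_
    have hp := (ContDiffMapSupportedIn.withSeminorms' ℝ ℂ ℝ ⊤ (𝒬.L n)).continuous_seminorm k
    have h0 : Tendsto (fun f : 𝒬.level n =>
        (k : ℝ) * ContDiffMapSupportedIn.supSeminorm ℝ ℂ ℝ ⊤ (𝒬.L n) k f.1) (𝓝 0) (𝓝 0) := by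
      have : Continuous (fun f : 𝒬.level n =>
        (k : ℝ) * ContDiffMapSupportedIn.supSeminorm ℝ ℂ ℝ ⊤ (𝒬.L n) k f.1) :=
        continuous_const.mul (hp.comp continuous_subtype_val)
      simpa using this.tendsto 0
    rw [ContinuousAt, map_zero]
    exact squeeze_zero_norm (fun f => hk f) h0
  have : IsUniformAddGroup (𝒬.level n) :=
    inferInstanceAs (IsUniformAddGroup (𝒬.level n).toAddSubgroup)
  let a₁ : 𝒬.level n →L[ℚ] ℝ := ⟨a₀.toRatLinearMap, hcont⟩
  have hu : IsUniformInducing (𝒬.level n).subtypeL := isUniformInducing_val _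
  have hd : DenseRange (𝒬.level n).subtypeL := by
    rw [DenseRange, Submodule.coe_subtypeL, Submodule.coe_subtype, Subtype.range_coe]
    exact 𝒬.dense n
  let T := a₁.extend (𝒬.level n).subtypeL
  -- The extension by density is only linear over ℚ; continuity upgrades it to ℝ.
  refine ⟨T.toLinearMap.toAddMonoidHom.toRealLinearMap T.continuous, fun f => ?_⟩
  exact a₁.extend_eq hd hu f

/-- The continuous extensions on the levels agree on nested levels, since they agree on a dense
subset of the smaller one; two arbitrary levels are compared inside a third that contains both. The
inductive limit then glues them. -/
theorem exists_extension {a : 𝒬.Q → ℝ} (hadd : ∀ q q', a (q + q') = a q + a q')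
    (hb : 𝒬.IsBounded a) : ∃ T : Distr D, ∀ q : 𝒬.Q, T q = a q := by
  choose T hT using 𝒬.exists_extension_level hadd hb
  have hmono : ∀ i j (hij : 𝒬.L i ≤ 𝒬.L j) (f : 𝓓_{𝒬.L i}(ℂ, ℝ)) (g : 𝓓_{𝒬.L j}(ℂ, ℝ)),
      (f : ℂ → ℝ) = g → T i f = T j g := by
    intro i j hij f g hfg
    let J := ContDiffMapSupportedIn.monoCLM ℝ (E := ℂ) (F := ℝ) (n₁ := ⊤) (n₂ := ⊤)
      (K₁ := 𝒬.L i) (K₂ := 𝒬.L j)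
    have hJ : ∀ f, (J f : ℂ → ℝ) = f := fun f => by
      rw [ContDiffMapSupportedIn.monoCLM_apply, if_pos ⟨le_rfl, hij⟩]
    have heq : (T i : 𝓓_{𝒬.L i}(ℂ, ℝ) → ℝ) = T j ∘ J := by
      refine Continuous.ext_on (𝒬.dense i) (T i).continuous
        ((T j).continuous.comp J.continuous) fun f hf => ?_
      have h1 : TestFunction.ofSupportedIn (𝒬.subset j) (J f) =
          TestFunction.ofSupportedIn (𝒬.subset i) f := by
        ext z
        exact congrFun (hJ f) z
      have h2 : J f ∈ 𝒬.level j := by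
        change TestFunction.ofSupportedIn (𝒬.subset j) (J f) ∈ 𝒬.Q
        rw [h1]; exact hf
      have h3 := hT i ⟨f, hf⟩
      have h4 := hT j ⟨J f, h2⟩
      simp only [incl, h1] at h3 h4
      rw [Function.comp_apply, h3, h4]
    have hg : J f = g := DFunLike.coe_injective ((hJ f).trans hfg)
    rw [heq, Function.comp_apply, hg]
  have hcompat : ∀ i j (f : 𝓓_{𝒬.L i}(ℂ, ℝ)) (g : 𝓓_{𝒬.L j}(ℂ, ℝ)),
      (f : ℂ → ℝ) = g → T i f = T j g := by
    intro i j f g hfg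
    obtain ⟨k, hk, -⟩ := 𝒬.interpolate (𝒬.L i ∪ 𝒬.L j) D ((𝒬.L i).isCompact.union
      (𝒬.L j).isCompact) D.isOpen (union_subset (𝒬.subset i) (𝒬.subset j)) Subset.rfl
    let f' : 𝓓_{𝒬.L k}(ℂ, ℝ) := .of_support_subset f.contDiff
      (f.support_subset.trans (subset_union_left.trans hk))
    rw [hmono i k (subset_union_left.trans hk) f f' rfl,
      hmono j k (subset_union_right.trans hk) g f' hfg.symm]
  choose N hN using 𝒬.exists_subset
  have hK : ∀ K : Compacts ℂ, (K : Set ℂ) ⊆ D → ∃ n, K ≤ 𝒬.L n := fun K hK => by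
    obtain ⟨n, hn, -⟩ := 𝒬.interpolate K D K.isCompact D.isOpen hK Subset.rfl
    exact ⟨n, hn⟩
  choose M hM using hK
  let T' : TestFn D →L[ℝ] ℝ := TestFunction.limitCLM ℝ
    (fun ρ => T (N ρ) (restrictTo ρ (hN ρ)))
    (fun K hK => T (M K hK) ∘L ContDiffMapSupportedIn.monoCLM ℝ) fun K hK f => by
      refine hcompat _ _ _ _ ?_
      refine Eq.trans ?_ (ContDiffMapSupportedIn.monoCLM_apply ℝ f).symm
      rw [if_pos ⟨le_rfl, hM K hK⟩]
      rfl
  refine ⟨T', fun q => ?_⟩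
  exact hT (N q) ⟨restrictTo (q : TestFn D) (hN q), q.2⟩

/-- Evaluation of distributions at the elements of the dense space. -/
def eval (T : Distr D) (q : 𝒬.Q) : ℝ := T q

theorem mem_range_eval {a : 𝒬.Q → ℝ} :
    a ∈ range 𝒬.eval ↔ (∀ q q', a (q + q') = a q + a q') ∧ 𝒬.IsBounded a := by
  constructor
  · rintro ⟨T, rfl⟩
    exact ⟨fun q q' => map_add T _ _, 𝒬.isBounded_distr T⟩
  · rintro ⟨h1, h2⟩
    obtain ⟨T, hT⟩ := 𝒬.exists_extension h1 h2
    exact ⟨T, funext hT⟩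

end DenseTestSpace

theorem tendsto_distr_apply {D : Opens ℂ} (T : Distr D) {q : ℕ → TestFn D} {ρ : TestFn D}
    (h : Tendsto q atTop (𝓝 ρ)) : Tendsto (fun n => T (q n)) atTop (𝓝 (T ρ)) :=
  ((show TestFn D →L[ℝ] ℝ from T).continuous.tendsto ρ).comp h

theorem measurable_distr_apply {D : Opens ℂ} (ρ : TestFn D) :
    Measurable (fun T : Distr D => T ρ) := by
  rw [measurable_iff_comap_le]
  exact (congrArg _ BorelSpace.measurable_eq).le.trans (le_iSup (fun ρ : TestFn D =>
    MeasurableSpace.comap (fun T : Distr D => T ρ) (borel ℝ)) ρ)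

theorem measurable_distr_iff {D : Opens ℂ} {Ω : Type*} {mΩ : MeasurableSpace Ω}
    {f : Ω → Distr D} : Measurable f ↔ ∀ ρ, Measurable (fun ω => f ω ρ) := by
  refine ⟨fun h ρ => (measurable_distr_apply ρ).comp h, fun h => ?_⟩
  rw [measurable_iff_comap_le, instMeasurableSpaceDistr, MeasurableSpace.comap_iSup]
  refine iSup_le fun ρ => ?_
  rw [MeasurableSpace.comap_comp]
  exact (h ρ).comap_le

/-- Injectivity and the equality of σ-algebras come from sequential density. The range is Borel
because additivity and boundedness, which characterize it, are countable conditions on coordinates.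
-/
theorem DenseTestSpace.measurableEmbedding_eval {D : Opens ℂ} (𝒬 : DenseTestSpace D) :
    MeasurableEmbedding 𝒬.eval := by
  refine MeasurableEmbedding.iff_comap_eq.2 ⟨fun S T h => ?_, le_antisymm ?_ ?_, ?_⟩
  · refine DFunLike.ext _ _ fun ρ => ?_
    obtain ⟨q, hq⟩ := 𝒬.exists_seq_tendsto' ρ
    refine tendsto_nhds_unique (tendsto_distr_apply S hq) ?_
    have : (fun n => S (q n : TestFn D)) = fun n => T (q n : TestFn D) :=
      funext fun n => congrFun h (q n)
    rw [this]
    exact tendsto_distr_apply T hq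
  · exact (measurable_pi_lambda _ fun q => measurable_distr_apply _).comap_le
  · refine iSup_le fun ρ => ?_
    obtain ⟨q, hq⟩ := 𝒬.exists_seq_tendsto' ρ
    have : @Measurable _ _ (MeasurableSpace.comap 𝒬.eval inferInstance) _
        (fun T : Distr D => T ρ) := by
      refine @measurable_of_tendsto_metrizable _ _ (_) _ _ _ _ (fun n T => T (q n)) _
        (fun n => ?_) (tendsto_pi_nhds.2 fun T => tendsto_distr_apply T hq)
      exact (measurable_pi_apply (q n)).comp (comap_measurable 𝒬.eval)
    exact this.comap_le
  -- Indexing by the countable set of `q` rather than by `f` matters: for fixed `q` the condition on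
  -- `a` is closed, however many `f` occur in it.
  · have : range 𝒬.eval = {a | ∀ q q', a (q + q') = a q + a q'} ∩ ⋂ n, ⋃ k : ℕ,
        ⋂ q : 𝒬.Q, {a | ∀ f : 𝒬.level n, 𝒬.incl n f = q →
          |a q| ≤ k * ContDiffMapSupportedIn.supSeminorm ℝ ℂ ℝ ⊤ (𝒬.L n) k f.1} := by
      ext a
      rw [𝒬.mem_range_eval]
      simp only [IsBounded, mem_inter_iff, mem_ofPred_eq, mem_iInter, mem_iUnion]
      refine and_congr_right fun _ => forall_congr' fun n => exists_congr fun k => ?_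
      exact ⟨fun h q f hf => hf ▸ h f, fun h f => h _ f rfl⟩
    rw [this]
    refine MeasurableSet.inter ?_ (MeasurableSet.iInter fun n => MeasurableSet.iUnion fun k =>
      MeasurableSet.iInter fun q => ?_)
    · simp only [ofPred_forall]
      refine MeasurableSet.iInter fun q => MeasurableSet.iInter fun q' => ?_
      exact measurableSet_eq_fun (measurable_pi_apply _)
        ((measurable_pi_apply q).add (measurable_pi_apply q'))
    · refine IsClosed.measurableSet ?_
      simp only [ofPred_forall]
      exact isClosed_iInter fun f => isClosed_iInter fun _ =>
        isClosed_le (continuous_apply q).abs continuous_const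

instance instStandardBorelSpaceDistr (D : Opens ℂ) : StandardBorelSpace (Distr D) := by
  obtain ⟨𝒬⟩ := nonempty_denseTestSpace D
  have h := 𝒬.measurableEmbedding_eval
  have := h.measurableSet_range.standardBorel
  obtain ⟨τ, hτ, hp⟩ := this.polish
  refine ⟨τ.induced h.equivRange, @BorelSpace.mk _ (_) _ ?_,
    h.equivRange.toEquiv.polishSpace_induced⟩
  refine h.equivRange.measurableEmbedding.comap_eq.symm.trans ?_
  rw [borel_comap, ← hτ.measurable_eq]

/-! ### Calculus with test functions -/

section Calculus

variable {D : Opens ℂ}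

/-- The product of a test function with a function that is smooth on `D`. -/
def smoothMul (χ : ℂ → ℝ) (hχ : ContDiffOn ℝ ((⊤ : ℕ∞) : WithTop ℕ∞) χ D) (ψ : TestFn D) :
    TestFn D where
  toFun z := χ z * ψ z
  contDiff' := by
    refine contDiff_iff_contDiffAt.2 fun x => ?_
    by_cases hx : x ∈ tsupport ψ
    · exact (hχ.contDiffAt (D.isOpen.mem_nhds (ψ.tsupport_subset hx))).mul ψ.contDiff.contDiffAt
    · refine (contDiffAt_const (c := (0 : ℝ))).congr_of_eventuallyEq ?_
      filter_upwards [notMem_tsupport_iff_eventuallyEq.1 hx] with y hy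
      rw [hy, Pi.zero_apply, mul_zero]
  hasCompactSupport' := ψ.hasCompactSupport.mul_left
  tsupport_subset' := tsupport_mul_subset_right.trans ψ.tsupport_subset

@[simp]
theorem smoothMul_apply (χ : ℂ → ℝ) (hχ) (ψ : TestFn D) (z : ℂ) :
    smoothMul χ hχ ψ z = χ z * ψ z := rfl

theorem integrable_mul_of_tsupport {f g : ℂ → ℝ} (hf : ContinuousOn f D) (hg : Continuous g)
    (hgc : HasCompactSupport g) (hgD : tsupport g ⊆ D) : Integrable (fun z => f z * g z) := by
  refine Continuous.integrable_of_hasCompactSupport ?_ hgc.mul_left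
  refine continuous_of_tsupport fun x hx => ?_
  have hxD : x ∈ (D : Set ℂ) := hgD (tsupport_mul_subset_right hx)
  exact (hf.continuousAt (D.isOpen.mem_nhds hxD)).mul hg.continuousAt

/-- The partial derivative of a test function, as a test function. -/
def pderiv (v : ℂ) (g : TestFn D) : TestFn D := ∂_{v} g

theorem pderiv_apply (v : ℂ) (g : TestFn D) (z : ℂ) :
    pderiv v g z = fderiv ℝ g z v := by
  have h : DifferentiableAt ℝ (g : ℂ → ℝ) z := g.contDiff.differentiable (by simp) z
  rw [← h.lineDeriv_eq_fderiv]
  exact TestFunction.lineDerivCLM_apply_of_le (𝕜 := ℝ) (f := g) le_rfl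

/-- Integration by parts against a test function. -/
theorem integral_mul_pderiv {f : ℂ → ℝ} (hf : ContDiffOn ℝ 1 f D) (v : ℂ) (g : TestFn D) :
    ∫ z, f z * pderiv v g z = - ∫ z, fderiv ℝ f z v * g z := by
  have hfc : ContinuousOn f D := hf.continuousOn
  have hf' : ContinuousOn (fun z => fderiv ℝ f z v) D :=
    (hf.continuousOn_fderiv_of_isOpen D.isOpen (by simp)).clm_apply continuousOn_const
  simp only [pderiv_apply]
  have hpd : (fun z => fderiv ℝ (g : ℂ → ℝ) z v) = pderiv v g :=
    funext fun z => (pderiv_apply v g z).symm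
  refine integral_mul_fderiv_eq_neg_fderiv_mul_of_integrable ?_ ?_ ?_ ?_ ?_
  · exact integrable_mul_of_tsupport hf' g.continuous g.hasCompactSupport g.tsupport_subset
  · have := integrable_mul_of_tsupport hfc (pderiv v g).continuous (pderiv v g).hasCompactSupport
      (pderiv v g).tsupport_subset
    simpa only [pderiv_apply] using this
  · exact integrable_mul_of_tsupport hfc g.continuous g.hasCompactSupport g.tsupport_subset
  · exact fun x hx => (hf.differentiableOn (by simp)).differentiableAt
      (D.isOpen.mem_nhds (g.tsupport_subset hx))
  · exact fun x _ => g.contDiff.differentiable (by simp) x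

theorem gradient_eq (g : ℂ → ℝ) (z : ℂ) :
    gradient g z = (fderiv ℝ g z 1 : ℂ) + (fderiv ℝ g z Complex.I : ℂ) * Complex.I := by
  have h : ∀ v, inner ℝ (gradient g z) v = fderiv ℝ g z v := fun v => by
    rw [gradient, InnerProductSpace.toDual_symm_apply]
  have h1 := h 1
  have h2 := h Complex.I
  rw [Complex.inner] at h1 h2
  apply Complex.ext <;> simp at h1 h2 ⊢ <;> linarith

theorem inner_gradL2 (f g : TestFn D) : inner ℝ (gradL2 f) (gradL2 g) =
    ∫ z, (pderiv 1 f z * pderiv 1 g z + pderiv Complex.I f z * pderiv Complex.I g z) := by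
  rw [MeasureTheory.L2.inner_def]
  refine integral_congr_ae ?_
  filter_upwards [(memLp_gradient f).coeFn_toLp, (memLp_gradient g).coeFn_toLp] with z h1 h2
  rw [gradL2, gradL2, h1, h2, gradient_eq, gradient_eq, Complex.inner]
  simp [pderiv_apply]
  ring

theorem contDiffOn_testFn (g : TestFn D) {n : ℕ∞} : ContDiffOn ℝ n g D :=
  (g.contDiff.of_le (by exact_mod_cast le_top)).contDiffOn

theorem integrable_testFn_mul (f g : TestFn D) : Integrable (fun z => f z * g z) :=
  integrable_mul_of_tsupport f.continuous.continuousOn g.continuous g.hasCompactSupport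
    g.tsupport_subset

theorem inner_gradL2_eq_lap (f g : TestFn D) :
    inner ℝ (gradL2 f) (gradL2 g) = ∫ z, (-lap f) z * g z := by
  have h (v : ℂ) : ∫ z, pderiv v f z * pderiv v g z = - ∫ z, pderiv v (pderiv v f) z * g z := by
    rw [integral_mul_pderiv (contDiffOn_testFn _)]
    simp only [pderiv_apply]
  rw [inner_gradL2, integral_add (integrable_testFn_mul _ _) (integrable_testFn_mul _ _), h, h,
    ← neg_add, ← integral_add (integrable_testFn_mul _ _) (integrable_testFn_mul _ _),
    ← integral_neg]
  refine integral_congr_ae (ae_of_all _ fun z => ?_)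
  change _ = -(pderiv 1 (pderiv 1 f) z + pderiv Complex.I (pderiv Complex.I f) z) * g z
  ring

/-- Harmonic functions are annihilated by the Laplacians of test functions. -/
theorem integral_harmonic_mul_lap {u : ℂ → ℝ}
    (hu : InnerProductSpace.HarmonicOnNhd u (D : Set ℂ)) (g : TestFn D) :
    ∫ z, u z * lap g z = 0 := by
  have hu2 : ContDiffOn ℝ 2 u D := hu.contDiffOn
  have hu1 : ContDiffOn ℝ 1 u D := hu2.of_le (by norm_num)
  have hu' (v : ℂ) : ContDiffOn ℝ 1 (fun z => fderiv ℝ u z v) D :=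
    (hu2.fderiv_of_isOpen D.isOpen (by norm_num)).clm_apply contDiffOn_const
  have hu'' (v : ℂ) : ContinuousOn (fun z => fderiv ℝ (fun w => fderiv ℝ u w v) z v) D :=
    ((hu' v).continuousOn_fderiv_of_isOpen D.isOpen (by simp)).clm_apply continuousOn_const
  have hint (f : ℂ → ℝ) (hf : ContinuousOn f D) (g : TestFn D) :
      Integrable (fun z => f z * g z) :=
    integrable_mul_of_tsupport hf g.continuous g.hasCompactSupport g.tsupport_subset
  have h (v : ℂ) : ∫ z, u z * pderiv v (pderiv v g) z =
      ∫ z, fderiv ℝ (fun w => fderiv ℝ u w v) z v * g z := by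
    rw [integral_mul_pderiv hu1, integral_mul_pderiv (hu' v), neg_neg]
  have hsplit : ∀ z, u z * lap g z = u z * pderiv 1 (pderiv 1 g) z +
      u z * pderiv Complex.I (pderiv Complex.I g) z := fun z => mul_add _ _ _
  simp only [hsplit]
  rw [integral_add (hint _ hu1.continuousOn _) (hint _ hu1.continuousOn _), h, h,
    ← integral_add (hint _ (hu'' 1) _) (hint _ (hu'' Complex.I) _)]
  refine integral_eq_zero_of_ae (ae_of_all _ fun z => ?_)
  change _ * _ + _ * _ = (0 : ℝ)
  rw [← add_mul]
  by_cases hz : z ∈ (D : Set ℂ)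
  · have h0 := (hu z hz).2.self_of_nhds
    rw [InnerProductSpace.laplacian_eq_iteratedFDeriv_complexPlane] at h0
    simp only [iteratedFDeriv_two_apply, Pi.zero_apply] at h0
    have hd : DifferentiableAt ℝ (fderiv ℝ u) z :=
      ((hu2.fderiv_of_isOpen D.isOpen (m := 1) (by norm_num)).differentiableOn
        (by simp)).differentiableAt (D.isOpen.mem_nhds hz)
    have hv (v : ℂ) : fderiv ℝ (fun w => fderiv ℝ u w v) z v = fderiv ℝ (fderiv ℝ u) z v v := by
      rw [fderiv_clm_apply hd (differentiableAt_const v)]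
      simp
    rw [hv, hv]
    simp at h0 ⊢
    left
    exact h0
  · rw [image_eq_zero_of_notMem_tsupport (fun h => hz (g.tsupport_subset h)), mul_zero]

theorem norm_gradL2_sq (g : TestFn D) :
    ‖gradL2 g‖ ^ 2 = ∫ z, (pderiv 1 g z ^ 2 + pderiv Complex.I g z ^ 2) := by
  rw [← real_inner_self_eq_norm_sq, inner_gradL2]
  simp only [sq]

theorem integrable_pderiv_sq (g : TestFn D) :
    Integrable (fun z => pderiv 1 g z ^ 2 + pderiv Complex.I g z ^ 2) := by
  simp only [sq]
  exact (integrable_testFn_mul _ _).add (integrable_testFn_mul _ _)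

/-- Multiplication by a bounded multiplier of small gradient is bounded in the Dirichlet norm: a
form of the Poincaré inequality, transported by a bounded conformal map. -/
theorem integral_sq_mul_deriv_le {φ : ℂ → ℂ} (hφ : DifferentiableOn ℂ φ D)
    (hb : ∀ z ∈ D, ‖φ z‖ ≤ 1) (ψ : TestFn D) :
    Integrable (fun z => ‖deriv φ z‖ ^ 2 * ψ z ^ 2) ∧
      ∫ z, ‖deriv φ z‖ ^ 2 * ψ z ^ 2 ≤ 4 * ‖gradL2 ψ‖ ^ 2 := by
  have hφ' : DifferentiableOn ℂ (deriv φ) D := hφ.deriv D.isOpen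
  have hsm {f : ℂ → ℂ} (hf : DifferentiableOn ℂ f D) (n : WithTop ℕ∞) : ContDiffOn ℝ n f D :=
    (hf.contDiffOn D.isOpen).restrict_scalars ℝ
  have hre : ContDiffOn ℝ ((⊤ : ℕ∞) : WithTop ℕ∞) (fun z => (φ z).re) D :=
    Complex.reCLM.contDiff.comp_contDiffOn (hsm hφ _)
  -- The field (p, q) is the gradient of Re φ, which has divergence zero, and |φ'|² = p² + q².
  -- Integrating it against the gradient of w = Re φ · ψ² gives ∫|φ'|²ψ² = -2 ∫ Re φ · ψ ∇Re φ · ∇ψ;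
  -- since |Re φ| ≤ 1, half of the left side absorbs the right side up to 2‖∇ψ‖².
  let p : ℂ → ℝ := fun z => (deriv φ z).re
  let q : ℂ → ℝ := fun z => -(deriv φ z).im
  have hp : ContDiffOn ℝ 1 p D := Complex.reCLM.contDiff.comp_contDiffOn (hsm hφ' _)
  have hq : ContDiffOn ℝ 1 q D := (Complex.imCLM.contDiff.comp_contDiffOn (hsm hφ' _)).neg
  have hreal {f : ℂ → ℂ} (hf : DifferentiableOn ℂ f D) {z : ℂ} (hz : z ∈ D) :
      HasFDerivAt f (deriv f z • (1 : ℂ →L[ℝ] ℂ)) z :=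
    (hf.differentiableAt (D.isOpen.mem_nhds hz)).hasDerivAt.complexToReal_fderiv
  let ψ2 := smoothMul ψ (contDiffOn_testFn ψ) ψ
  let w := smoothMul _ hre ψ2
  have hcross : ∀ z ∈ D, (pderiv 1 w z = p z * ψ z ^ 2 + 2 * (φ z).re * ψ z * pderiv 1 ψ z) ∧
      pderiv Complex.I w z = q z * ψ z ^ 2 + 2 * (φ z).re * ψ z * pderiv Complex.I ψ z := by
    intro z hz
    have h1 : HasFDerivAt (fun z => (φ z).re) _ z :=
      Complex.reCLM.hasFDerivAt.comp z (hreal hφ hz)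
    have h2 : HasFDerivAt (ψ : ℂ → ℝ) (fderiv ℝ ψ z) z :=
      (ψ.contDiff.differentiable (by simp) z).hasFDerivAt
    have h3 : fderiv ℝ (w : ℂ → ℝ) z = _ := (h1.mul (h2.mul h2)).fderiv
    simp only [pderiv_apply, h3]
    constructor <;> simp [p, q] <;> ring
  have hdiv : ∀ z ∈ D, fderiv ℝ p z 1 + fderiv ℝ q z Complex.I = 0 := by
    intro z hz
    have h1 : HasFDerivAt p _ z := Complex.reCLM.hasFDerivAt.comp z (hreal hφ' hz)
    have h2 : HasFDerivAt q _ z := (Complex.imCLM.hasFDerivAt.comp z (hreal hφ' hz)).neg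
    rw [h1.fderiv, h2.fderiv]
    simp
  have hmul {f : ℂ → ℝ} (hf : ContDiffOn ℝ 1 f D) (g : TestFn D) :
      Integrable (fun z => f z * g z) :=
    integrable_mul_of_tsupport hf.continuousOn g.continuous g.hasCompactSupport g.tsupport_subset
  have hfd {f : ℂ → ℝ} (hf : ContDiffOn ℝ 1 f D) (v : ℂ) (g : TestFn D) :
      Integrable (fun z => fderiv ℝ f z v * g z) :=
    integrable_mul_of_tsupport ((hf.continuousOn_fderiv_of_isOpen D.isOpen (by simp)).clm_apply
      continuousOn_const) g.continuous g.hasCompactSupport g.tsupport_subset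
  have hzero : ∫ z, (p z * pderiv 1 w z + q z * pderiv Complex.I w z) = 0 := by
    rw [integral_add (hmul hp _) (hmul hq _), integral_mul_pderiv hp, integral_mul_pderiv hq,
      ← neg_add, ← integral_add (hfd hp _ _) (hfd hq _ _), neg_eq_zero]
    refine integral_eq_zero_of_ae (ae_of_all _ fun z => ?_)
    change _ * _ + _ * _ = (0 : ℝ)
    rw [← add_mul]
    by_cases hz : z ∈ D
    · rw [hdiv z hz, zero_mul]
    · rw [image_eq_zero_of_notMem_tsupport (fun h => hz (w.tsupport_subset h)), mul_zero]
  have hpq : ∀ z, ‖deriv φ z‖ ^ 2 = p z ^ 2 + q z ^ 2 := fun z => by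
    rw [Complex.sq_norm, Complex.normSq_apply]
    ring
  have hint : Integrable (fun z => ‖deriv φ z‖ ^ 2 * ψ z ^ 2) := by
    have h1 : ContinuousOn (fun z => ‖deriv φ z‖ ^ 2) D :=
      (continuous_norm.comp_continuousOn hφ'.continuousOn).pow 2
    have := integrable_mul_of_tsupport h1 ψ2.continuous ψ2.hasCompactSupport ψ2.tsupport_subset
    simpa only [ψ2, smoothMul_apply, ← sq] using this
  refine ⟨hint, ?_⟩
  have hle : ∀ z, ‖deriv φ z‖ ^ 2 * ψ z ^ 2 - (p z * pderiv 1 w z + q z * pderiv Complex.I w z) ≤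
      1 / 2 * (‖deriv φ z‖ ^ 2 * ψ z ^ 2) +
        2 * (pderiv 1 ψ z ^ 2 + pderiv Complex.I ψ z ^ 2) := by
    intro z
    by_cases hz : z ∈ D
    · obtain ⟨h1, h2⟩ := hcross z hz
      have ha : (φ z).re ^ 2 ≤ 1 := by
        have := (Complex.abs_re_le_norm (φ z)).trans (hb z hz)
        rw [← sq_abs]
        exact pow_le_one₀ (abs_nonneg _) this
      rw [h1, h2, hpq]
      set a := (φ z).re
      set x := pderiv 1 ψ z
      set y := pderiv Complex.I ψ z
      have key1 := sq_nonneg (ψ z * p z + 2 * a * x)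
      have key2 := sq_nonneg (ψ z * q z + 2 * a * y)
      have key3 : a ^ 2 * (x ^ 2 + y ^ 2) ≤ 1 * (x ^ 2 + y ^ 2) :=
        mul_le_mul_of_nonneg_right ha (by positivity)
      linarith [show p z * (p z * ψ z ^ 2 + 2 * a * ψ z * x) +
        q z * (q z * ψ z ^ 2 + 2 * a * ψ z * y) = (p z ^ 2 + q z ^ 2) * ψ z ^ 2 +
        2 * a * x * (ψ z * p z) + 2 * a * y * (ψ z * q z) by ring,
        show (ψ z * p z + 2 * a * x) ^ 2 + (ψ z * q z + 2 * a * y) ^ 2 =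
          (p z ^ 2 + q z ^ 2) * ψ z ^ 2 + 4 * (a * x * (ψ z * p z)) + 4 * (a * y * (ψ z * q z)) +
          4 * (a ^ 2 * (x ^ 2 + y ^ 2)) by ring]
    · have h0 (g : TestFn D) : g z = 0 :=
        image_eq_zero_of_notMem_tsupport fun h => hz (g.tsupport_subset h)
      simp [h0]
  have hsum : Integrable (fun z => p z * pderiv 1 w z + q z * pderiv Complex.I w z) :=
    (hmul hp _).add (hmul hq _)
  have hmono := integral_mono (hint.sub hsum)
    ((hint.const_mul _).add ((integrable_pderiv_sq ψ).const_mul _)) hle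
  simp only [Pi.sub_apply, Pi.add_apply] at hmono
  rw [integral_sub hint hsum, hzero, integral_add (hint.const_mul _)
    ((integrable_pderiv_sq ψ).const_mul _), integral_const_mul, integral_const_mul,
    ← norm_gradL2_sq] at hmono
  linarith

/-- Multiplication by a cutoff function of the form `χ ∘ φ` is bounded in the Dirichlet norm. -/
theorem norm_gradL2_smoothMul_le {φ : ℂ → ℂ} (hφ : DifferentiableOn ℂ φ D)
    (hb : ∀ z ∈ D, ‖φ z‖ ≤ 1) {χ : ℂ → ℝ} (hχ : ContDiffOn ℝ ((⊤ : ℕ∞) : WithTop ℕ∞) χ D)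
    (h1 : ∀ z ∈ D, |χ z| ≤ 1) {C : ℝ} (hC : ∀ z ∈ D, ∀ v, |fderiv ℝ χ z v| ≤ C * ‖deriv φ z‖ * ‖v‖)
    (ψ : TestFn D) : ‖gradL2 (smoothMul χ hχ ψ)‖ ^ 2 ≤ (2 + 16 * C ^ 2) * ‖gradL2 ψ‖ ^ 2 := by
  obtain ⟨hint, hle⟩ := integral_sq_mul_deriv_le hφ hb ψ
  -- The product rule and (a + b)² ≤ 2a² + 2b² in each of the two directions give the constants 2
  -- and 4C²; the factor 4 of the Poincaré inequality turns the latter into 16C².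
  have hpt : ∀ z, pderiv 1 (smoothMul χ hχ ψ) z ^ 2 + pderiv Complex.I (smoothMul χ hχ ψ) z ^ 2 ≤
      2 * (pderiv 1 ψ z ^ 2 + pderiv Complex.I ψ z ^ 2) +
        4 * C ^ 2 * (‖deriv φ z‖ ^ 2 * ψ z ^ 2) := by
    intro z
    by_cases hz : z ∈ D
    · have hd : HasFDerivAt χ (fderiv ℝ χ z) z :=
        ((hχ.differentiableOn (by simp)).differentiableAt (D.isOpen.mem_nhds hz)).hasFDerivAt
      have hd2 : HasFDerivAt (ψ : ℂ → ℝ) (fderiv ℝ ψ z) z :=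
        (ψ.contDiff.differentiable (by simp) z).hasFDerivAt
      have hd3 : fderiv ℝ (smoothMul χ hχ ψ : ℂ → ℝ) z = _ := (hd.mul hd2).fderiv
      have hv (v : ℂ) (hv : ‖v‖ = 1) : pderiv v (smoothMul χ hχ ψ) z ^ 2 ≤
          2 * pderiv v ψ z ^ 2 + 2 * C ^ 2 * (‖deriv φ z‖ ^ 2 * ψ z ^ 2) := by
        have e : pderiv v (smoothMul χ hχ ψ) z = χ z * pderiv v ψ z + ψ z * fderiv ℝ χ z v := by
          simp only [pderiv_apply, hd3]
          simp
        have b1 : χ z ^ 2 ≤ 1 := by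
          rw [← sq_abs]; exact pow_le_one₀ (abs_nonneg _) (h1 z hz)
        have b2 : (fderiv ℝ χ z v) ^ 2 ≤ C ^ 2 * ‖deriv φ z‖ ^ 2 := by
          have := hC z hz v
          rw [hv, mul_one] at this
          rw [← sq_abs, ← mul_pow]
          exact pow_le_pow_left₀ (abs_nonneg _) this 2
        rw [e]
        have k1 := mul_le_mul_of_nonneg_right b1 (sq_nonneg (pderiv v ψ z))
        have k2 := mul_le_mul_of_nonneg_right b2 (sq_nonneg (ψ z))
        nlinarith [sq_nonneg (χ z * pderiv v ψ z - ψ z * fderiv ℝ χ z v)]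
      have := add_le_add (hv 1 (by simp)) (hv Complex.I (by simp))
      linarith
    · have h0 (g : TestFn D) : g z = 0 :=
        image_eq_zero_of_notMem_tsupport fun h => hz (g.tsupport_subset h)
      simp [h0]
  have hmono := integral_mono (integrable_pderiv_sq _)
    (((integrable_pderiv_sq ψ).const_mul _).add (hint.const_mul _)) hpt
  simp only [Pi.add_apply] at hmono
  rw [integral_add ((integrable_pderiv_sq ψ).const_mul _) (hint.const_mul _), integral_const_mul,
    integral_const_mul, ← norm_gradL2_sq, ← norm_gradL2_sq] at hmono
  nlinarith [sq_nonneg C]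

end Calculus

/-! ### The Dirichlet space -/

section Dirichlet

variable {D : Opens ℂ}

/-- The gradient as a linear map from test functions to `L²`. -/
def gradL2LM (D : Opens ℂ) : TestFn D →ₗ[ℝ] VectorL2 where
  toFun := gradL2
  map_add' f g := by
    have h : gradient ((f + g : TestFn D) : ℂ → ℝ) = gradient f + gradient g := by
      ext1 z
      have hf : DifferentiableAt ℝ (f : ℂ → ℝ) z := f.contDiff.differentiable (by simp) z
      have hg : DifferentiableAt ℝ (g : ℂ → ℝ) z := g.contDiff.differentiable (by simp) z
      have : fderiv ℝ ((f + g : TestFn D) : ℂ → ℝ) z = fderiv ℝ f z + fderiv ℝ g z :=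
        fderiv_add hf hg
      simp only [gradient, this, map_add, Pi.add_apply]
    rw [gradL2, gradL2, gradL2, ← MemLp.toLp_add]
    exact MemLp.toLp_congr _ _ (by rw [h])
  map_smul' c f := by
    have h : gradient ((c • f : TestFn D) : ℂ → ℝ) = c • gradient f := by
      ext1 z
      have hf : DifferentiableAt ℝ (f : ℂ → ℝ) z := f.contDiff.differentiable (by simp) z
      have : fderiv ℝ ((c • f : TestFn D) : ℂ → ℝ) z = c • fderiv ℝ f z :=
        fderiv_const_smul hf c
      simp only [gradient, this, map_smul, Pi.smul_apply]
    rw [gradL2, gradL2, RingHom.id_apply, ← MemLp.toLp_const_smul]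
    exact MemLp.toLp_congr _ _ (by rw [h])

@[simp]
theorem gradL2LM_apply (g : TestFn D) : gradL2LM D g = gradL2 g := rfl

/-- The test functions supported in `B`. -/
def testFnOn (D : Opens ℂ) (B : Set ℂ) : Submodule ℝ (TestFn D) where
  carrier := {g | tsupport g ⊆ B}
  add_mem' {f g} hf hg := (tsupport_add f g).trans (union_subset hf hg)
  zero_mem' := by
    have : ((0 : TestFn D) : ℂ → ℝ) = 0 := rfl
    simp [this]
  smul_mem' c f hf := (tsupport_smul_subset_right (fun _ => c) f).trans hf

theorem suppSpace_eq (D : Opens ℂ) (B : Set ℂ) :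
    suppSpace D B = ((testFnOn D B).map (gradL2LM D)).topologicalClosure := by
  rw [suppSpace]
  congr 1
  have : {v | ∃ g : TestFn D, tsupport g ⊆ B ∧ v = gradL2 g} =
      ((testFnOn D B).map (gradL2LM D) : Set VectorL2) := by
    ext v
    exact exists_congr fun g => and_congr_right fun _ => eq_comm
  rw [this, Submodule.span_eq]

instance instCompleteSpaceSuppSpace (D : Opens ℂ) (B : Set ℂ) : CompleteSpace (suppSpace D B) :=
  Submodule.topologicalClosure.completeSpace _

instance instCompleteSpaceDirichletSpace (D : Opens ℂ) : CompleteSpace (dirichletSpace D) :=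
  instCompleteSpaceSuppSpace D D

theorem isClosed_suppSpace (D : Opens ℂ) (B : Set ℂ) : IsClosed (suppSpace D B : Set VectorL2) :=
  Submodule.isClosed_topologicalClosure _

theorem mem_suppSpace_iff {B : Set ℂ} {v : VectorL2} : v ∈ suppSpace D B ↔
    ∃ g : ℕ → TestFn D, (∀ n, tsupport (g n) ⊆ B) ∧
      Tendsto (fun n => gradL2 (g n)) atTop (𝓝 v) := by
  rw [suppSpace_eq, ← SetLike.mem_coe, Submodule.topologicalClosure_coe, mem_closure_iff_seq_limit]
  constructor
  · rintro ⟨x, hx, hlim⟩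
    choose g hg hgx using hx
    refine ⟨g, hg, ?_⟩
    rwa [show (fun n => gradL2 (g n)) = x from funext hgx]
  · rintro ⟨g, hg, hlim⟩
    exact ⟨_, fun n => ⟨g n, hg n, rfl⟩, hlim⟩

theorem gradL2_mem_suppSpace {B : Set ℂ} {g : TestFn D} (hg : tsupport g ⊆ B) :
    gradL2 g ∈ suppSpace D B :=
  mem_suppSpace_iff.2 ⟨fun _ => g, fun _ => hg, tendsto_const_nhds⟩

theorem gradL2_mem_dirichletSpace (g : TestFn D) : gradL2 g ∈ dirichletSpace D :=
  gradL2_mem_suppSpace g.tsupport_subset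

theorem suppSpace_mono {B B' : Set ℂ} (h : B ⊆ B') : suppSpace D B ≤ suppSpace D B' := by
  intro v hv
  obtain ⟨g, hg, hlim⟩ := mem_suppSpace_iff.1 hv
  exact mem_suppSpace_iff.2 ⟨g, fun n => (hg n).trans h, hlim⟩

theorem suppSpace_le_dirichletSpace (B : Set ℂ) : suppSpace D B ≤ dirichletSpace D := by
  intro v hv
  obtain ⟨g, -, hlim⟩ := mem_suppSpace_iff.1 hv
  exact mem_suppSpace_iff.2 ⟨g, fun n => (g n).tsupport_subset, hlim⟩

/-- The orthogonal projection onto `Supp_B`. -/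
def suppProj (D : Opens ℂ) (B : Set ℂ) : VectorL2 →L[ℝ] VectorL2 := (suppSpace D B).starProjection

theorem suppProj_mem (B : Set ℂ) (F : VectorL2) : suppProj D B F ∈ suppSpace D B :=
  Submodule.starProjection_apply_mem _ _

theorem suppProj_eq_self {B : Set ℂ} {F : VectorL2} (hF : F ∈ suppSpace D B) :
    suppProj D B F = F :=
  Submodule.starProjection_eq_self_iff.2 hF

theorem inner_suppProj {B : Set ℂ} {g : VectorL2} (hg : g ∈ suppSpace D B) (F : VectorL2) :
    inner ℝ (suppProj D B F) g = inner ℝ F g := by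
  have h := (Submodule.mem_orthogonal' _ _).1
    (Submodule.sub_starProjection_mem_orthogonal (K := suppSpace D B) F) g hg
  rw [inner_sub_left, sub_eq_zero] at h
  exact h.symm

theorem sub_suppProj_mem_harmSpace {B : Set ℂ} {F : VectorL2} (hF : F ∈ dirichletSpace D) :
    F - suppProj D B F ∈ harmSpace D B :=
  ⟨Submodule.sub_mem _ hF (suppSpace_le_dirichletSpace B (suppProj_mem B F)),
    Submodule.sub_starProjection_mem_orthogonal F⟩

theorem inner_eq_zero_of_mem_harmSpace {B : Set ℂ} {f g : VectorL2} (hf : f ∈ harmSpace D B)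
    (hg : g ∈ suppSpace D B) : inner ℝ f g = 0 :=
  (Submodule.mem_orthogonal' _ _).1 hf.2 g hg

theorem norm_suppProj_le (B : Set ℂ) (F : VectorL2) : ‖suppProj D B F‖ ≤ ‖F‖ :=
  Submodule.norm_starProjection_apply_le _ _

/-- Pythagoras for nested projections. -/
theorem norm_suppProj_sub_sq {B B' : Set ℂ} (h : B ⊆ B') (F : VectorL2) :
    ‖suppProj D B' F - suppProj D B F‖ ^ 2 = ‖suppProj D B' F‖ ^ 2 - ‖suppProj D B F‖ ^ 2 := by
  have h1 : inner ℝ (suppProj D B' F) (suppProj D B F) = ‖suppProj D B F‖ ^ 2 := by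
    rw [inner_suppProj (suppSpace_mono h (suppProj_mem B F)), ← inner_suppProj (suppProj_mem B F),
      real_inner_self_eq_norm_sq]
  rw [@norm_sub_sq_real, h1]
  ring

/-- An element of `H(D)` is determined by its inner products with gradients of test functions. -/
theorem eq_of_inner_gradL2 {f f' : VectorL2} (hf : f ∈ dirichletSpace D)
    (hf' : f' ∈ dirichletSpace D)
    (h : ∀ g : TestFn D, inner ℝ f (gradL2 g) = inner ℝ f' (gradL2 g)) : f = f' := by
  obtain ⟨g, -, hlim⟩ := mem_suppSpace_iff.1 (Submodule.sub_mem _ hf hf')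
  have h1 : Tendsto (fun n => inner ℝ (f - f') (gradL2 (g n))) atTop (𝓝 (inner ℝ (f - f') (f - f')))
    := tendsto_const_nhds.inner hlim
  have h2 : (fun n => inner ℝ (f - f') (gradL2 (g n))) = fun _ => (0 : ℝ) := by
    ext n
    rw [inner_sub_left, h, sub_self]
  rw [h2] at h1
  exact sub_eq_zero.1 (inner_self_eq_zero.1 (tendsto_nhds_unique h1 tendsto_const_nhds))

/-- The projections onto `Supp_B` are continuous along increasing sequences that exhaust compact
sets. -/
theorem tendsto_suppProj {B : ℕ → Set ℂ} {B' : Set ℂ} (hB : Monotone B) (hB' : ∀ n, B n ⊆ B')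
    (hK : ∀ K, IsCompact K → K ⊆ B' → ∃ n, K ⊆ B n) (F : VectorL2) :
    Tendsto (fun n => suppProj D (B n) F) atTop (𝓝 (suppProj D B' F)) := by
  have hmono : Monotone (fun n => suppSpace D (B n)) := fun i j h => suppSpace_mono (hB h)
  -- A test function has compact support, so each generator of Supp_{B'} already lies in some
  -- Supp_{B n}; the union of these subspaces is dense.
  have hcl : (⨆ n, suppSpace D (B n)).topologicalClosure = suppSpace D B' := by
    refine le_antisymm (Submodule.topologicalClosure_minimal _
      (iSup_le fun n => suppSpace_mono (hB' n)) (isClosed_suppSpace D B')) ?_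
    rw [suppSpace_eq D B']
    refine Submodule.topologicalClosure_mono ?_
    rintro _ ⟨g, hg, rfl⟩
    obtain ⟨n, hn⟩ := hK _ g.hasCompactSupport hg
    exact Submodule.mem_iSup_of_mem n (gradL2_mem_suppSpace hn)
  have h := Submodule.starProjection_tendsto_closure_iSup (fun n => suppSpace D (B n)) hmono F
  simp only [hcl] at h
  exact h

end Dirichlet

/-! ### Characteristic functions -/

/-- The function `x ↦ exp (i x)`. -/
def cis (x : ℝ) : ℂ := Complex.exp (x * Complex.I)

theorem continuous_cis : Continuous cis := by unfold cis; fun_prop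

@[fun_prop]
theorem measurable_cis : Measurable cis := continuous_cis.measurable

@[simp]
theorem norm_cis (x : ℝ) : ‖cis x‖ = 1 := Complex.norm_exp_ofReal_mul_I x

@[simp]
theorem cis_zero : cis 0 = 1 := by simp [cis]

theorem cis_add (x y : ℝ) : cis (x + y) = cis x * cis y := by
  rw [cis, cis, cis, ← Complex.exp_add]
  push_cast
  ring_nf

theorem norm_cis_sub_le (x y : ℝ) : ‖cis x - cis y‖ ≤ |x - y| := by
  have h : cis x - cis y = (Complex.exp (Complex.I * (x - y : ℝ)) - 1) * cis y := by
    rw [sub_mul, one_mul, mul_comm Complex.I]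
    change _ = cis (x - y) * cis y - _
    rw [← cis_add, sub_add_cancel]
  rw [h, norm_mul, norm_cis, mul_one]
  exact Real.norm_exp_I_mul_ofReal_sub_one_le

theorem integrable_cis {Ω : Type*} {mΩ : MeasurableSpace Ω} {μ : Measure Ω} [IsFiniteMeasure μ]
    {Y : Ω → ℝ} (hY : AEMeasurable Y μ) : Integrable (fun ω => cis (Y ω)) μ :=
  Integrable.of_bound (measurable_cis.comp_aemeasurable hY).aestronglyMeasurable 1
    (ae_of_all _ fun _ => (norm_cis _).le)

theorem charFun_map_eq {Ω : Type*} {mΩ : MeasurableSpace Ω} {μ : Measure Ω} {Y : Ω → ℝ}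
    (hY : AEMeasurable Y μ) (t : ℝ) : charFun (μ.map Y) t = ∫ ω, cis (t * Y ω) ∂μ := by
  rw [charFun_apply_real, integral_map hY (by fun_prop)]
  simp [cis]

/-- A real random variable is Gaussian if its characteristic function is. -/
theorem map_eq_gaussianReal_iff {Ω : Type*} {mΩ : MeasurableSpace Ω} {μ : Measure Ω}
    [IsProbabilityMeasure μ] {Y : Ω → ℝ} (hY : AEMeasurable Y μ) (m : ℝ) (v : NNReal) :
    μ.map Y = gaussianReal m v ↔
      ∀ t : ℝ, ∫ ω, cis (t * Y ω) ∂μ = cis (t * m) * Complex.exp (-(v * t ^ 2 / 2)) := by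
  have hg (t : ℝ) : charFun (gaussianReal m v) t = cis (t * m) * Complex.exp (-(v * t ^ 2 / 2)) := by
    rw [charFun_gaussianReal, cis, ← Complex.exp_add]
    push_cast
    ring_nf
  have := Measure.isProbabilityMeasure_map (μ := μ) hY
  constructor
  · intro h t
    rw [← charFun_map_eq hY, h, hg]
  · intro h
    refine Measure.ext_of_charFun (funext fun t => ?_)
    rw [charFun_map_eq hY, h, hg]

/-- This Lipschitz bound lets identities between characteristic functions, restricted to any event,
pass to L² limits. -/
theorem norm_setIntegral_cis_sub_le {Ω : Type*} {mΩ : MeasurableSpace Ω} {P : Measure Ω}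
    [IsProbabilityMeasure P] (s : Set Ω) (Y Z : Lp ℝ 2 P) :
    ‖(∫ ω in s, cis (Y ω) ∂P) - ∫ ω in s, cis (Z ω) ∂P‖ ≤ ‖Y - Z‖ := by
  have hm (Y : Lp ℝ 2 P) : Measurable (Y : Ω → ℝ) := (Lp.stronglyMeasurable Y).measurable
  have hi (Y : Lp ℝ 2 P) : Integrable (fun ω => cis (Y ω)) P := integrable_cis (hm Y).aemeasurable
  have hint : Integrable (fun ω => ‖(Y - Z : Lp ℝ 2 P) ω‖) P :=
    ((Lp.memLp (Y - Z)).integrable (by norm_num)).norm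
  rw [← integral_sub (hi Y).integrableOn (hi Z).integrableOn]
  calc ‖∫ ω in s, (cis (Y ω) - cis (Z ω)) ∂P‖
      ≤ ∫ ω in s, ‖cis (Y ω) - cis (Z ω)‖ ∂P := norm_integral_le_integral_norm _
    _ ≤ ∫ ω, ‖cis (Y ω) - cis (Z ω)‖ ∂P :=
        setIntegral_le_integral ((hi Y).sub (hi Z)).norm (ae_of_all _ fun _ => norm_nonneg _)
    _ ≤ ∫ ω, ‖(Y - Z : Lp ℝ 2 P) ω‖ ∂P := by
        refine integral_mono_ae ((hi Y).sub (hi Z)).norm hint ?_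
        filter_upwards [Lp.coeFn_sub Y Z] with ω hω
        rw [hω]
        exact norm_cis_sub_le _ _
    _ = (eLpNorm (Y - Z : Lp ℝ 2 P) 1 P).toReal := by
        rw [eLpNorm_one_eq_lintegral_enorm, integral_norm_eq_lintegral_enorm
          (Lp.aestronglyMeasurable _)]
    _ ≤ (eLpNorm (Y - Z : Lp ℝ 2 P) 2 P).toReal :=
        ENNReal.toReal_mono (Lp.eLpNorm_ne_top _)
          (eLpNorm_le_eLpNorm_of_exponent_le (by norm_num) (Lp.aestronglyMeasurable _))
    _ = ‖Y - Z‖ := (Lp.norm_def _).symm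

theorem continuous_setIntegral_cis {Ω : Type*} {mΩ : MeasurableSpace Ω} (P : Measure Ω)
    [IsProbabilityMeasure P] (s : Set Ω) :
    Continuous (fun Y : Lp ℝ 2 P => ∫ ω in s, cis (Y ω) ∂P) := by
  refine (LipschitzWith.of_dist_le_mul (K := 1) fun Y Z => ?_).continuous
  rw [dist_eq_norm, dist_eq_norm, NNReal.coe_one, one_mul]
  exact norm_setIntegral_cis_sub_le s Y Z

/-! ### The Gaussian Hilbert space of a Gaussian free field -/

section GaussianRep

variable {D : Opens ℂ} {Ω : Type*} [MeasurableSpace Ω]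

/-- The Gaussian field `h` as an isonormal process: `X F` is the variable `(h, F)_∇`, and `pot ρ`
is the potential of `ρ`, so that `(h, ρ) = mean ρ + X (pot ρ)`. -/
structure GaussianRep (P : Measure Ω) (h : Ω → Distr D) where
  measurable : Measurable h
  mean : TestFn D →ₗ[ℝ] ℝ
  mean_lap (g : TestFn D) : mean (lap g) = 0
  pot : TestFn D →ₗ[ℝ] VectorL2
  pot_mem (ρ : TestFn D) : pot ρ ∈ dirichletSpace D
  inner_pot (ρ g : TestFn D) : inner ℝ (pot ρ) (gradL2 g) = ∫ z, ρ z * g z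
  X : VectorL2 →L[ℝ] Lp ℝ 2 P
  norm_X {F : VectorL2} : F ∈ dirichletSpace D → ‖X F‖ = ‖F‖
  integral_cis_X {F : VectorL2} : F ∈ dirichletSpace D →
    ∫ ω, cis (X F ω) ∂P = Complex.exp (-(‖F‖ ^ 2 / 2 : ℝ))
  X_pot (ρ : TestFn D) : X (pot ρ) =ᵐ[P] fun ω => h ω ρ - mean ρ

/-- Every Gaussian free field is an isonormal process. -/
theorem nonempty_gaussianRep {u : ℂ → ℝ} (hu : InnerProductSpace.HarmonicOnNhd u (D : Set ℂ))
    {P : Measure Ω} [IsProbabilityMeasure P] {h : Ω → Distr D} (hh : IsGFF D u P h) :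
    Nonempty (GaussianRep P h) := by
  have hmul (ρ : TestFn D) : Integrable (fun z => u z * ρ z) :=
    integrable_mul_of_tsupport hu.contDiffOn.continuousOn ρ.continuous ρ.hasCompactSupport
      ρ.tsupport_subset
  let mean : TestFn D →ₗ[ℝ] ℝ :=
    { toFun := fun ρ => ∫ z, u z * ρ z
      map_add' := fun ρ ρ' => by
        rw [← integral_add (hmul ρ) (hmul ρ')]
        exact integral_congr_ae (ae_of_all _ fun z => mul_add _ _ _)
      map_smul' := fun c ρ => by
        rw [RingHom.id_apply, smul_eq_mul, ← integral_const_mul]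
        exact integral_congr_ae (ae_of_all _ fun z => mul_left_comm _ _ _) }
  choose f hf hlaw using hh.law
  have hfmem (ρ : TestFn D) : f ρ ∈ dirichletSpace D := (hf ρ).1
  have hfin (ρ g : TestFn D) : inner ℝ (f ρ) (gradL2 g) = ∫ z, ρ z * g z :=
    (hf ρ).2 g g.tsupport_subset
  let pot : TestFn D →ₗ[ℝ] VectorL2 :=
    { toFun := f
      map_add' := fun ρ ρ' => by
        refine eq_of_inner_gradL2 (hfmem _) (Submodule.add_mem _ (hfmem _) (hfmem _)) fun g => ?_
        rw [inner_add_left, hfin, hfin, hfin,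
          ← integral_add (integrable_testFn_mul _ _) (integrable_testFn_mul _ _)]
        exact integral_congr_ae (ae_of_all _ fun z => add_mul _ _ _)
      map_smul' := fun c ρ => by
        refine eq_of_inner_gradL2 (hfmem _) (Submodule.smul_mem _ _ (hfmem _)) fun g => ?_
        rw [RingHom.id_apply, real_inner_smul_left, hfin, hfin, ← integral_const_mul]
        exact integral_congr_ae (ae_of_all _ fun z => mul_assoc _ _ _) }
  have hmeas (ρ : TestFn D) : Measurable (fun ω => h ω ρ) :=
    (measurable_distr_apply ρ).comp hh.measurable
  have hlaw' (ρ : TestFn D) : P.map (fun ω => h ω ρ) = gaussianReal (mean ρ) (‖f ρ‖₊ ^ 2) := hlaw ρ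
  have hL2 (ρ : TestFn D) : MemLp (fun ω => h ω ρ - mean ρ) 2 P := by
    have h1 : MemLp id 2 (P.map (fun ω => h ω ρ)) := by
      rw [hlaw' ρ]
      exact memLp_id_gaussianReal 2
    exact (h1.comp_of_map (hmeas ρ).aemeasurable).sub (memLp_const _)
  have hnorm (ρ : TestFn D) : ‖(hL2 ρ).toLp‖ = ‖f ρ‖ := by
    have h1 : ‖(hL2 ρ).toLp‖ ^ 2 = ∫ ω, (h ω ρ - mean ρ) ^ 2 ∂P := by
      rw [← real_inner_self_eq_norm_sq, MeasureTheory.L2.inner_def]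
      refine integral_congr_ae ?_
      filter_upwards [(hL2 ρ).coeFn_toLp] with ω hω
      rw [hω, real_inner_self_eq_norm_sq, Real.norm_eq_abs, sq_abs]
    have h2 : ∫ ω, (h ω ρ - mean ρ) ^ 2 ∂P = ‖f ρ‖ ^ 2 := by
      have h3 := variance_id_gaussianReal (μ := mean ρ) (v := ‖f ρ‖₊ ^ 2)
      rw [variance_eq_integral aemeasurable_id] at h3
      simp only [id, integral_id_gaussianReal] at h3
      rw [← hlaw' ρ, integral_map (hmeas ρ).aemeasurable (by fun_prop)] at h3
      rw [h3]
      simp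
    rw [h2] at h1
    exact (sq_eq_sq₀ (norm_nonneg _) (norm_nonneg _)).1 h1
  let Z : TestFn D →ₗ[ℝ] Lp ℝ 2 P :=
    { toFun := fun ρ => (hL2 ρ).toLp
      map_add' := fun ρ ρ' => by
        rw [← MemLp.toLp_add]
        refine MemLp.toLp_congr _ _ (ae_of_all _ fun ω => ?_)
        simp only [map_add, Pi.add_apply]
        ring
      map_smul' := fun c ρ => by
        rw [RingHom.id_apply, ← MemLp.toLp_const_smul]
        refine MemLp.toLp_congr _ _ (ae_of_all _ fun ω => ?_)
        simp only [map_smul, Pi.smul_apply, smul_eq_mul]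
        ring }
  -- The potential of -Δg is g itself, so the potentials contain all gradients of test functions and
  -- are dense in H(D).
  have hpotlap (g : TestFn D) : pot (-lap g) = gradL2 g :=
    eq_of_inner_gradL2 (hfmem _) (gradL2_mem_dirichletSpace g) fun g' => by
      rw [inner_gradL2_eq_lap]
      exact hfin _ _
  let e : TestFn D →ₗ[ℝ] dirichletSpace D := pot.codRestrict _ hfmem
  have hdense : DenseRange e := by
    intro v
    obtain ⟨g, -, hlim⟩ := mem_suppSpace_iff.1 v.2
    refine mem_closure_of_tendsto (f := fun n => e (-lap (g n))) (b := atTop) ?_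
      (Eventually.of_forall fun n => mem_range_self _)
    rw [tendsto_subtype_rng]
    refine hlim.congr fun n => (hpotlap (g n)).symm
  have hbound : ∀ ρ, ‖Z ρ‖ ≤ 1 * ‖e ρ‖ := fun ρ => by
    rw [one_mul]
    exact (hnorm ρ).le
  -- On potentials the variance makes ρ ↦ (h, ρ) - mean ρ isometric, so it extends to H(D);
  -- composing with the orthogonal projection only serves to define `X` on all of L².
  let X : VectorL2 →L[ℝ] Lp ℝ 2 P :=
    (Z.extendOfNorm e) ∘L (dirichletSpace D).orthogonalProjectionOnto
  have hX (v : dirichletSpace D) : X v = Z.extendOfNorm e v :=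
     congrArg (Z.extendOfNorm e) (Submodule.orthogonalProjectionOnto_mem_subspace_eq_self v)
  have hXpot (ρ : TestFn D) : X (pot ρ) = (hL2 ρ).toLp :=
    (hX (e ρ)).trans (LinearMap.extendOfNorm_eq hdense ⟨1, hbound⟩ ρ)
  have hXe (ρ : TestFn D) : X (e ρ) = (hL2 ρ).toLp := hXpot ρ
  -- A closed property of vectors of H(D) need only be checked on potentials, where the law of h is
  -- given.
  have hind {p : VectorL2 → Prop} (hcl : IsClosed {v : dirichletSpace D | p v})
      (hp : ∀ ρ, p (pot ρ)) {F : VectorL2} (hF : F ∈ dirichletSpace D) : p F :=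
    DenseRange.induction_on (p := fun v : dirichletSpace D => p v) hdense ⟨F, hF⟩ hcl hp
  refine ⟨⟨hh.measurable, mean, ?_, pot, hfmem, hfin, X, ?_, ?_, ?_⟩⟩
  · exact fun g => integral_harmonic_mul_lap hu g
  · refine fun hF => hind (p := fun F => ‖X F‖ = ‖F‖) ?_ (fun ρ => ?_) hF
    · exact isClosed_eq (X.continuous.norm.comp continuous_subtype_val)
        (continuous_norm.comp continuous_subtype_val)
    · rw [hXpot]
      exact hnorm ρ
  · refine fun hF => hind (p := fun F => ∫ ω, cis (X F ω) ∂P = Complex.exp (-(‖F‖ ^ 2 / 2 : ℝ)))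
      ?_ (fun ρ => ?_) hF
    · refine isClosed_eq ?_ (by fun_prop)
      have := (continuous_setIntegral_cis P univ).comp (X.continuous.comp continuous_subtype_val :
        Continuous (fun v : dirichletSpace D => X v))
      simpa only [Measure.restrict_univ, Function.comp_def] using this
    · have h1 := (map_eq_gaussianReal_iff (hmeas ρ).aemeasurable _ _).1 (hlaw' ρ) 1
      have h2 : ∫ ω, cis (X (pot ρ) ω) ∂P = ∫ ω, cis (-mean ρ) * cis (h ω ρ) ∂P := by
        refine integral_congr_ae ?_
        rw [hXpot]
        filter_upwards [(hL2 ρ).coeFn_toLp] with ω hω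
        rw [hω, ← cis_add]
        ring_nf
      rw [h2, integral_const_mul]
      simp only [one_mul] at h1
      rw [h1, ← mul_assoc, ← cis_add, neg_add_cancel, cis_zero, one_mul]
      push_cast
      simp [pot]
  · intro ρ
    rw [hXpot]
    exact (hL2 ρ).coeFn_toLp

namespace GaussianRep

variable {P : Measure Ω} {h : Ω → Distr D} (R : GaussianRep P h)

theorem pot_neg_lap (g : TestFn D) : R.pot (-lap g) = gradL2 g :=
  eq_of_inner_gradL2 (R.pot_mem _) (gradL2_mem_dirichletSpace g) fun g' => by
    rw [inner_gradL2_eq_lap]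
    exact R.inner_pot _ _

theorem X_gradL2 (g : TestFn D) : R.X (gradL2 g) =ᵐ[P] fun ω => h ω (-lap g) := by
  rw [← R.pot_neg_lap]
  refine (R.X_pot _).trans (ae_of_all _ fun ω => ?_)
  simp only [map_neg, R.mean_lap, neg_zero, sub_zero]

theorem measurable_X (F : VectorL2) : Measurable (R.X F) := (Lp.stronglyMeasurable _).measurable

/-- Potentials on `B` are projections of potentials on `D`. -/
theorem isPotential_iff {B : Set ℂ} {ρ : TestFn D} {f : VectorL2} :
    IsPotential D B ρ f ↔ f = suppProj D B (R.pot ρ) := by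
  constructor
  · rintro ⟨hf, hin⟩
    symm
    refine Submodule.eq_starProjection_of_mem_of_inner_eq_zero hf fun w hw => ?_
    obtain ⟨g, hg, hlim⟩ := mem_suppSpace_iff.1 hw
    refine tendsto_nhds_unique (tendsto_const_nhds.inner hlim) ?_
    refine tendsto_const_nhds.congr fun n => ?_
    rw [inner_sub_left, hin _ (hg n), R.inner_pot, sub_self]
  · rintro rfl
    refine ⟨suppProj_mem _ _, fun g hg => ?_⟩
    rw [inner_suppProj (gradL2_mem_suppSpace hg), R.inner_pot]

/-- The law of a zero boundary GFF, in terms of characteristic functions. -/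
theorem isZeroGFFLaw_iff {B : Set ℂ} {μ : Measure (Distr D)} [IsProbabilityMeasure μ] :
    IsZeroGFFLaw D B μ ↔ ∀ ρ : TestFn D,
      ∫ T, cis (T ρ) ∂μ = Complex.exp (-(‖suppProj D B (R.pot ρ)‖ ^ 2 / 2 : ℝ)) := by
  have key (ρ : TestFn D) := map_eq_gaussianReal_iff (μ := μ)
    (measurable_distr_apply ρ).aemeasurable 0 (‖suppProj D B (R.pot ρ)‖₊ ^ 2)
  constructor
  · intro H ρ
    obtain ⟨f, hf, hlaw⟩ := H ρ
    rw [R.isPotential_iff.1 hf] at hlaw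
    have := (key ρ).1 hlaw 1
    simp only [one_mul] at this
    rw [this]
    simp
  · intro H ρ
    refine ⟨_, R.isPotential_iff.2 rfl, (key ρ).2 fun t => ?_⟩
    -- Replacing ρ by tρ recovers the whole characteristic function from its values at 1.
    have h1 := H (t • ρ)
    have h2 (T : Distr D) : T (t • ρ) = t * T ρ := by rw [map_smul, smul_eq_mul]
    simp only [h2] at h1
    rw [h1, map_smul, map_smul, norm_smul, mul_pow, Real.norm_eq_abs, sq_abs, mul_zero, cis_zero,
      one_mul]
    congr 1
    push_cast
    ring_nf

/-- Potentials depend continuously on test functions. -/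
theorem tendsto_pot [IsProbabilityMeasure P] {q : ℕ → TestFn D} {ρ : TestFn D}
    (hq : Tendsto q atTop (𝓝 ρ)) : Tendsto (fun n => R.pot (q n)) atTop (𝓝 (R.pot ρ)) := by
  have hmeas (ρ : TestFn D) : Measurable (fun ω => h ω ρ) :=
    (measurable_distr_apply ρ).comp R.measurable
  -- Continuity is read off the field itself. The modulus of the characteristic function of (h, r)
  -- does not involve the mean; each sampled distribution is continuous, so by dominated convergence
  -- this modulus tends to 1 along `q n - ρ`, which forces the variances to 0.
  have hE (r : TestFn D) : ‖∫ ω, cis (h ω r) ∂P‖ = Real.exp (-(‖R.pot r‖ ^ 2 / 2)) := by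
    have h1 : ∫ ω, cis (h ω r) ∂P = cis (R.mean r) * ∫ ω, cis (R.X (R.pot r) ω) ∂P := by
      rw [← integral_const_mul]
      refine integral_congr_ae ?_
      filter_upwards [R.X_pot r] with ω hω
      rw [hω, ← cis_add]
      ring_nf
    rw [h1, norm_mul, norm_cis, one_mul, R.integral_cis_X (R.pot_mem r), ← Complex.ofReal_neg,
      Complex.norm_exp_ofReal]
  have hlim : Tendsto (fun n => ∫ ω, cis (h ω (q n - ρ)) ∂P) atTop (𝓝 (∫ _, 1 ∂P)) := by
    refine tendsto_integral_of_dominated_convergence (fun _ => 1)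
      (fun n => (integrable_cis (hmeas _).aemeasurable).1) (integrable_const _)
      (fun n => ae_of_all _ fun ω => (norm_cis _).le) (ae_of_all _ fun ω => ?_)
    have h0 : Tendsto (fun n => q n - ρ) atTop (𝓝 0) := by
      simpa using hq.sub_const ρ
    have := (continuous_cis.tendsto _).comp (tendsto_distr_apply (h ω) h0)
    simpa [Function.comp_def] using this
  have h1 : Tendsto (fun n => Real.exp (-(‖R.pot (q n - ρ)‖ ^ 2 / 2))) atTop (𝓝 1) := by
    have := hlim.norm
    simp only [hE] at this
    simpa using this
  have h2 := (Real.continuousAt_log one_ne_zero).tendsto.comp h1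
  simp only [Function.comp_def, Real.log_exp, Real.log_one] at h2
  have h3 : Tendsto (fun n => ‖R.pot (q n) - R.pot ρ‖ ^ 2) atTop (𝓝 0) := by
    have := h2.const_mul (-2)
    simp only [mul_zero] at this
    refine this.congr fun n => ?_
    rw [map_sub]
    ring
  rw [tendsto_iff_norm_sub_tendsto_zero]
  have h4 := (Real.continuous_sqrt.tendsto 0).comp h3
  simp only [Function.comp_def, Real.sqrt_zero] at h4
  exact h4.congr fun n => Real.sqrt_sq (norm_nonneg _)

end GaussianRep

end GaussianRep

/-! ### Independence and conditional independence -/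

section Independence

variable {Ω : Type*} {m m₁ m₂ : MeasurableSpace Ω} {mΩ : MeasurableSpace Ω} {P : Measure Ω}
  [IsProbabilityMeasure P]

theorem exists_coeff_eq_sum {ι : Type*} [Fintype ι] (L : StrongDual ℝ (ι → ℝ)) :
    ∃ a : ι → ℝ, ∀ x, L x = ∑ i, a i * x i := by
  classical
  refine ⟨fun i => L (fun j => if i = j then 1 else 0), fun x => ?_⟩
  rw [← ContinuousLinearMap.coe_coe, LinearMap.pi_apply_eq_sum_univ]
  simp [mul_comm]

/-- Two families of random variables are independent if their joint characteristic functions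
factorize. -/
theorem indepFun_of_integral_cis {ι κ : Type*} {Y : ι → Ω → ℝ} {W : κ → Ω → ℝ}
    (hY : ∀ i, Measurable (Y i)) (hW : ∀ j, Measurable (W j))
    (H : ∀ (I : Finset ι) (J : Finset κ) (a : I → ℝ) (b : J → ℝ),
      ∫ ω, cis ((∑ i, a i * Y i ω) + ∑ j, b j * W j ω) ∂P =
        (∫ ω, cis (∑ i, a i * Y i ω) ∂P) * ∫ ω, cis (∑ j, b j * W j ω) ∂P) :
    IndepFun (fun ω i => Y i ω) (fun ω j => W j ω) P := by
  refine IndepFun.process_indepFun_process hY hW fun I J => ?_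
  have hYI : Measurable (fun ω (i : I) => Y i ω) := measurable_pi_lambda _ fun i => hY i
  have hWJ : Measurable (fun ω (j : J) => W j ω) := measurable_pi_lambda _ fun j => hW j
  rw [indepFun_iff_charFunDual_prod hYI.aemeasurable hWJ.aemeasurable]
  intro L
  rw [charFunDual_apply, charFunDual_apply, charFunDual_apply,
    integral_map (hYI.prodMk hWJ).aemeasurable (by fun_prop),
    integral_map hYI.aemeasurable (by fun_prop), integral_map hWJ.aemeasurable (by fun_prop)]
  have h1 (x : I → ℝ) (y : J → ℝ) : L (x, y) =
      L.comp (.inl ℝ (I → ℝ) (J → ℝ)) x + L.comp (.inr ℝ (I → ℝ) (J → ℝ)) y := by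
    simp [← map_add]
  obtain ⟨a, ha⟩ := exists_coeff_eq_sum (L.comp (.inl ℝ (I → ℝ) (J → ℝ)))
  obtain ⟨b, hb⟩ := exists_coeff_eq_sum (L.comp (.inr ℝ (I → ℝ) (J → ℝ)))
  simp only [h1, ha, hb]
  exact H I J a b

/-- `s ∩ G` is independent of `m₂` for all `G` in `m`. -/
def Decouples {Ω : Type*} (m m₂ : MeasurableSpace Ω) {mΩ : MeasurableSpace Ω} (P : Measure Ω)
    (s : Set Ω) : Prop :=
  ∀ G t : Set Ω, MeasurableSet[m] G → MeasurableSet[m₂] t →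
    P.real (s ∩ G ∩ t) = P.real (s ∩ G) * P.real t

theorem setIntegral_condExp_indicator (hm : m ≤ mΩ) {s G : Set Ω}
    (hs : MeasurableSet s) (hG : MeasurableSet[m] G) : ∫ ω in G, (P⟦s | m⟧) ω ∂P = P.real (s ∩ G) := by
  rw [setIntegral_condExp hm ((integrable_const (1 : ℝ)).indicator hs) hG,
    setIntegral_indicator hs, setIntegral_const, smul_eq_mul, mul_one, inter_comm]

theorem Decouples.condExp_inter (hm : m ≤ mΩ) (hm₂ : m₂ ≤ mΩ)
    {s t : Set Ω} (hs : MeasurableSet s) (ht : MeasurableSet[m₂] t) (H : Decouples m m₂ P s) :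
    P⟦s ∩ t | m⟧ =ᵐ[P] fun ω => (P⟦s | m⟧) ω * P.real t := by
  symm
  refine ae_eq_condExp_of_forall_setIntegral_eq hm
    ((integrable_const (1 : ℝ)).indicator (hs.inter (hm₂ _ ht)))
    (fun G _ _ => (integrable_condExp.mul_const _).integrableOn) (fun G hG _ => ?_)
    (stronglyMeasurable_condExp.aestronglyMeasurable.mul_const _)
  rw [integral_mul_const, setIntegral_condExp_indicator hm hs hG,
    setIntegral_indicator (hs.inter (hm₂ _ ht)), setIntegral_const, smul_eq_mul, mul_one,
    ← H G t hG ht]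
  congr 1
  ext ω
  simp only [mem_inter_iff]
  tauto

/-- The hypothesis `huniv` makes m and m₂ independent, so P(t | m) is the constant P(t) and the
defining identity can be integrated over sets of m. -/
theorem condIndepGiven_iff (hm : m ≤ mΩ) (hm₁ : m₁ ≤ mΩ)
    (hm₂ : m₂ ≤ mΩ) (huniv : Decouples m m₂ P univ) :
    CondIndepGiven P m m₁ m₂ ↔ ∀ s, MeasurableSet[m₁] s → Decouples m m₂ P s := by
  have hconst {t : Set Ω} (ht : MeasurableSet[m₂] t) : P⟦t | m⟧ =ᵐ[P] fun _ => P.real t := by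
    have h1 : P⟦(univ : Set Ω) | m⟧ = fun _ => 1 := by
      rw [indicator_univ]
      exact condExp_const hm 1
    have := huniv.condExp_inter hm hm₂ MeasurableSet.univ ht
    simpa only [univ_inter, h1, one_mul] using this
  constructor
  · intro H s hs G t hG ht
    have h1 := setIntegral_condExp_indicator (P := P) hm ((hm₁ _ hs).inter (hm₂ _ ht)) hG
    have h2 : ∫ ω in G, (P⟦s ∩ t | m⟧) ω ∂P = ∫ ω in G, (P⟦s | m⟧) ω * P.real t ∂P := by
      refine integral_congr_ae (ae_restrict_of_ae ?_)
      filter_upwards [H s t hs ht, hconst ht] with ω h1 h2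
      rw [h1, Pi.mul_apply, h2]
    rw [← setIntegral_condExp_indicator hm (hm₁ _ hs) hG, ← integral_mul_const, ← h2, h1]
    congr 1
    ext ω
    simp only [mem_inter_iff]
    tauto
  · intro H s t hs ht
    filter_upwards [(H s hs).condExp_inter hm hm₂ (hm₁ _ hs) ht, hconst ht] with ω h1 h2
    rw [h1, Pi.mul_apply, h2]

/-- The sets `G ∩ t`, `G` in `m₁` and `t` in `m₂`, generate `m₁ ⊔ m₂`. -/
theorem sup_eq_generateFrom_inter (m₁ m₂ : MeasurableSpace Ω) :
    m₁ ⊔ m₂ = MeasurableSpace.generateFrom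
      {E | ∃ G t, MeasurableSet[m₁] G ∧ MeasurableSet[m₂] t ∧ E = G ∩ t} := by
  refine le_antisymm (sup_le ?_ ?_) (MeasurableSpace.generateFrom_le ?_)
  · exact fun G hG => MeasurableSpace.measurableSet_generateFrom
      ⟨G, univ, hG, MeasurableSet.univ, (inter_univ G).symm⟩
  · exact fun t ht => MeasurableSpace.measurableSet_generateFrom
      ⟨univ, t, MeasurableSet.univ, ht, (univ_inter t).symm⟩
  · rintro _ ⟨G, t, hG, ht, rfl⟩
    exact MeasurableSet.inter ((le_sup_left : m₁ ≤ m₁ ⊔ m₂) _ hG) ((le_sup_right : m₂ ≤ m₁ ⊔ m₂) _ ht)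

theorem isPiSystem_inter (m₁ m₂ : MeasurableSpace Ω) :
    IsPiSystem {E | ∃ G t, MeasurableSet[m₁] G ∧ MeasurableSet[m₂] t ∧ E = G ∩ t} := by
  rintro _ ⟨G, t, hG, ht, rfl⟩ _ ⟨G', t', hG', ht', rfl⟩ -
  exact ⟨G ∩ G', t ∩ t', hG.inter hG', ht.inter ht', inter_inter_inter_comm _ _ _ _⟩

theorem setIntegral_inter_of_decouples (hm : m ≤ mΩ) (hm₂ : m₂ ≤ mΩ)
    (huniv : Decouples m m₂ P univ) {f : Ω → ℝ} (hf : StronglyMeasurable[m] f) {G t : Set Ω}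
    (hG : MeasurableSet[m] G) (ht : MeasurableSet[m₂] t) :
    ∫ ω in G ∩ t, f ω ∂P = (∫ ω in G, f ω ∂P) * P.real t := by
  have hsplit : ∫ ω in G ∩ t, f ω ∂P =
      ∫ ω, (G.indicator f ω) * (t.indicator (fun _ => (1 : ℝ)) ω) ∂P := by
    rw [← integral_indicator ((hm _ hG).inter (hm₂ _ ht))]
    refine integral_congr_ae (ae_of_all _ fun ω => ?_)
    by_cases h1 : ω ∈ G <;> by_cases h2 : ω ∈ t <;> simp [h1, h2]
  have hind : Indep m m₂ P := by
    rw [Indep_iff]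
    intro G t hG ht
    have := huniv G t hG ht
    rw [univ_inter, measureReal_def, measureReal_def, measureReal_def,
      ← ENNReal.toReal_mul] at this
    exact (ENNReal.toReal_eq_toReal_iff' (measure_ne_top _ _)
      (ENNReal.mul_ne_top (measure_ne_top _ _) (measure_ne_top _ _))).1 this
  have hf : Measurable[m] (G.indicator f) := hf.measurable.indicator hG
  have hg : Measurable[m₂] (t.indicator (fun _ => (1 : ℝ))) :=
    (@measurable_const _ _ _ m₂ (1 : ℝ)).indicator ht
  have hfg : IndepFun (G.indicator f) (t.indicator (fun _ => (1 : ℝ))) P := by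
    rw [IndepFun_iff_Indep]
    exact indep_of_indep_of_le_left (indep_of_indep_of_le_right hind hg.comap_le) hf.comap_le
  rw [hsplit, hfg.integral_fun_mul_eq_mul_integral (hf.mono hm le_rfl).aestronglyMeasurable
    (hg.mono hm₂ le_rfl).aestronglyMeasurable, integral_indicator (hm _ hG),
    integral_indicator (hm₂ _ ht), setIntegral_const, smul_eq_mul, mul_one]

/-- Adding to m an independent source that also carries no information about s beyond m does not
change the prediction of s. The identity of integrals is verified on the π-system of sets G ∩ t. -/
theorem Decouples.condExp_sup (hm : m ≤ mΩ) (hm₂ : m₂ ≤ mΩ)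
    {s : Set Ω} (hs : MeasurableSet s) (H : Decouples m m₂ P s) (huniv : Decouples m m₂ P univ) :
    P⟦s | m⟧ =ᵐ[P] P⟦s | m ⊔ m₂⟧ := by
  have hsup : m ⊔ m₂ ≤ mΩ := sup_le hm hm₂
  have hint : Integrable (s.indicator fun _ => (1 : ℝ)) P := (integrable_const (1 : ℝ)).indicator hs
  refine ae_eq_condExp_of_forall_setIntegral_eq hsup hint
    (fun _ _ _ => integrable_condExp.integrableOn) (fun E hE hE' => ?_)
    (stronglyMeasurable_condExp.aestronglyMeasurable.mono le_sup_left)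
  clear hE'
  induction E, hE using MeasurableSpace.induction_on_inter
      (sup_eq_generateFrom_inter m m₂) (isPiSystem_inter m m₂) with
  | empty => simp
  | basic E hE =>
    obtain ⟨G, t, hG, ht, rfl⟩ := hE
    have h1 := setIntegral_inter_of_decouples hm hm₂ huniv
      (stronglyMeasurable_condExp (m := m) (μ := P) (f := s.indicator fun _ => (1 : ℝ))) hG ht
    rw [h1, setIntegral_condExp_indicator hm hs hG, ← H G t hG ht, setIntegral_indicator hs,
      setIntegral_const, smul_eq_mul, mul_one]
    congr 1
    ext ω
    simp only [mem_inter_iff]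
    tauto
  | compl E hE ih =>
    have h1 := integral_add_compl (hsup _ hE) (integrable_condExp (m := m) (μ := P)
      (f := s.indicator fun _ => (1 : ℝ)))
    have h2 := integral_add_compl (hsup _ hE) hint
    have h3 : ∫ ω, (P⟦s | m⟧) ω ∂P = ∫ ω, s.indicator (fun _ => (1 : ℝ)) ω ∂P := integral_condExp hm
    linarith [ih]
  | iUnion E hd hE ih =>
    rw [integral_iUnion (fun i => hsup _ (hE i)) hd integrable_condExp.integrableOn,
      integral_iUnion (fun i => hsup _ (hE i)) hd hint.integrableOn]
    exact tsum_congr fun i => ih i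

/-- Conversely, an m-measurable version of P(s | m ⊔ m₂) factorizes over G ∩ t because m and m₂ are
independent. This is the bridge between conditions 1 and its conditional probability form. -/
theorem decouples_iff_aestronglyMeasurable (hm : m ≤ mΩ) (hm₂ : m₂ ≤ mΩ) {s : Set Ω}
    (hs : MeasurableSet s) (huniv : Decouples m m₂ P univ) :
    Decouples m m₂ P s ↔ AEStronglyMeasurable[m] (P⟦s | m ⊔ m₂⟧) P := by
  have hsup : m ⊔ m₂ ≤ mΩ := sup_le hm hm₂
  constructor
  · intro H
    exact stronglyMeasurable_condExp.aestronglyMeasurable.congr (H.condExp_sup hm hm₂ hs huniv)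
  · rintro ⟨f, hf, hsf⟩ G t hG ht
    have hG' : MeasurableSet[m ⊔ m₂] G := (le_sup_left : m ≤ m ⊔ m₂) _ hG
    have ht' : MeasurableSet[m ⊔ m₂] t := (le_sup_right : m₂ ≤ m ⊔ m₂) _ ht
    have h1 := setIntegral_inter_of_decouples hm hm₂ huniv hf hG ht
    rw [← integral_congr_ae (ae_restrict_of_ae hsf), ← integral_congr_ae (ae_restrict_of_ae hsf),
      setIntegral_condExp_indicator hsup hs (hG'.inter ht'),
      setIntegral_condExp_indicator hsup hs hG', ← inter_assoc] at h1
    exact h1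

end Independence

set_option linter.unusedSectionVars false

/-! ### Gaussian fields and events that do not see the projection onto `Supp_B` -/

namespace GaussianRep

variable {D : Opens ℂ} {Ω : Type*} {mΩ : MeasurableSpace Ω} {P : Measure Ω}
  [IsProbabilityMeasure P] {h : Ω → Distr D} (R : GaussianRep P h)

/-- On the event `s`, the projection of the field onto `Supp_B` has its unconditioned Gaussian law,
independently of the projection onto `Harm_B`. -/
def SplitsOn (B : Set ℂ) (s : Set Ω) : Prop :=
  ∀ F ∈ dirichletSpace D, ∀ g ∈ suppSpace D B,
    ∫ ω in s, cis (R.X (F + g) ω) ∂P =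
      (∫ ω in s, cis (R.X F ω) ∂P) * Complex.exp (-(inner ℝ F g + ‖g‖ ^ 2 / 2 : ℝ))

theorem integrable_cis_X (F : VectorL2) : Integrable (fun ω => cis (R.X F ω)) P :=
  integrable_cis (R.measurable_X F).aemeasurable

theorem continuous_setIntegral_cis_X (s : Set Ω) :
    Continuous (fun F => ∫ ω in s, cis (R.X F ω) ∂P) :=
  (continuous_setIntegral_cis P s).comp R.X.continuous

variable {R}

/-- Both sides are continuous in F and g for the Dirichlet norm, so gradients of test functions
suffice. -/
theorem splitsOn_of_testFn {B : Set ℂ} {s : Set Ω}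
    (H : ∀ f g : TestFn D, tsupport g ⊆ B →
      ∫ ω in s, cis (R.X (gradL2 f + gradL2 g) ω) ∂P = (∫ ω in s, cis (R.X (gradL2 f) ω) ∂P) *
        Complex.exp (-(inner ℝ (gradL2 f) (gradL2 g) + ‖gradL2 g‖ ^ 2 / 2 : ℝ))) :
    R.SplitsOn B s := by
  intro F hF g hg
  obtain ⟨f', -, hf'⟩ := mem_suppSpace_iff.1 hF
  obtain ⟨g', hg'B, hg'⟩ := mem_suppSpace_iff.1 hg
  refine tendsto_nhds_unique
    (((R.continuous_setIntegral_cis_X s).tendsto _).comp (hf'.add hg')) ?_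
  have h1 : Tendsto (fun n => (inner ℝ (gradL2 (f' n)) (gradL2 (g' n)) + ‖gradL2 (g' n)‖ ^ 2 / 2))
      atTop (𝓝 (inner ℝ F g + ‖g‖ ^ 2 / 2)) :=
    (hf'.inner hg').add ((hg'.norm.pow 2).div_const 2)
  have h2 := (Complex.continuous_exp.tendsto _).comp
    ((Complex.continuous_ofReal.tendsto _).comp h1).neg
  refine ((((R.continuous_setIntegral_cis_X s).tendsto _).comp hf').mul h2).congr fun n => ?_
  exact (H (f' n) (g' n) (hg'B n)).symm

theorem SplitsOn.mono {B B' : Set ℂ} {s : Set Ω} (H : R.SplitsOn B s) (hB : B' ⊆ B) :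
    R.SplitsOn B' s :=
  fun F hF g hg => H F hF g (suppSpace_mono hB hg)

variable (R) in
theorem splitsOn_univ (B : Set ℂ) : R.SplitsOn B univ := by
  intro F hF g hg
  have hg' := suppSpace_le_dirichletSpace B hg
  rw [Measure.restrict_univ, R.integral_cis_X hF, R.integral_cis_X (Submodule.add_mem _ hF hg'),
    ← Complex.exp_add, norm_add_sq_real]
  push_cast
  ring_nf

theorem SplitsOn.diff {B : Set ℂ} {s t : Set Ω} (hs : R.SplitsOn B s) (ht : R.SplitsOn B t)
    (hmt : MeasurableSet t) (hts : t ⊆ s) : R.SplitsOn B (s \ t) := by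
  intro F hF g hg
  rw [setIntegral_sdiff hmt (R.integrable_cis_X _).integrableOn hts,
    setIntegral_sdiff hmt (R.integrable_cis_X _).integrableOn hts, hs F hF g hg, ht F hF g hg, sub_mul]

theorem SplitsOn.iUnion {B : Set ℂ} {s : ℕ → Set Ω} (hs : ∀ n, R.SplitsOn B (s n))
    (hm : ∀ n, MeasurableSet (s n)) (hd : Pairwise (Function.onFun Disjoint s)) :
    R.SplitsOn B (⋃ n, s n) := by
  intro F hF g hg
  rw [integral_iUnion hm hd (R.integrable_cis_X _).integrableOn,
    integral_iUnion hm hd (R.integrable_cis_X _).integrableOn, ← tsum_mul_right]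
  exact tsum_congr fun n => hs n F hF g hg

theorem SplitsOn.congr {B : Set ℂ} {s t : Set Ω} (hs : R.SplitsOn B s) (hst : s =ᵐ[P] t) :
    R.SplitsOn B t := by
  intro F hF g hg
  rw [← setIntegral_congr_set hst, ← setIntegral_congr_set hst]
  exact hs F hF g hg

-- The approximations (h, -Δgₙ) are `X` of the gradients of gₙ, and `X` is continuous; hence the
-- limit exists for every F in H(D) and does not depend on the approximating sequence.
variable (R) in
theorem isDirichletPairing_iff {F : VectorL2} (hF : F ∈ dirichletSpace D) {Y : Ω → ℝ}
    (hY : Measurable Y) : IsDirichletPairing P h F Y ↔ Y =ᵐ[P] R.X F := by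
  have key {g : ℕ → TestFn D} (hg : Tendsto (fun n => gradL2 (g n)) atTop (𝓝 F)) :
      Tendsto (fun n => eLpNorm (fun ω => R.X F ω - h ω (-lap (g n))) 2 P) atTop (𝓝 0) := by
    have h1 := (Lp.tendsto_Lp_iff_tendsto_eLpNorm' _ _).1 ((R.X.continuous.tendsto F).comp hg)
    refine h1.congr fun n => ?_
    rw [eLpNorm_sub_comm]
    refine eLpNorm_congr_ae ?_
    filter_upwards [R.X_gradL2 (g n)] with ω hω
    simp only [Pi.sub_apply, Function.comp_apply, hω]
  have hmeas (ρ : TestFn D) : AEStronglyMeasurable (fun ω => h ω ρ) P :=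
    ((measurable_distr_apply ρ).comp R.measurable).aestronglyMeasurable
  have hX : AEStronglyMeasurable (R.X F) P := (R.measurable_X F).aestronglyMeasurable
  constructor
  · rintro ⟨g, hg, hlim⟩
    have h0 : eLpNorm (Y - ⇑(R.X F)) 2 P = 0 := by
      refine le_antisymm (ge_of_tendsto' (by simpa only [add_zero] using hlim.add (key hg)) fun n => ?_) zero_le
      have h3 := eLpNorm_sub_le (p := 2) (hY.aestronglyMeasurable.sub (hmeas (-lap (g n))))
        (hX.sub (hmeas (-lap (g n)))) (by norm_num)
      rw [sub_sub_sub_cancel_right] at h3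
      exact h3
    rw [eLpNorm_eq_zero_iff (hY.aestronglyMeasurable.sub hX) (by norm_num)] at h0
    filter_upwards [h0] with ω hω
    exact sub_eq_zero.1 hω
  · intro hYX
    obtain ⟨g, -, hg⟩ := mem_suppSpace_iff.1 hF
    refine ⟨g, hg, (key hg).congr fun n => eLpNorm_congr_ae ?_⟩
    filter_upwards [hYX] with ω hω
    rw [hω]

theorem projSigma_le (K : Submodule ℝ VectorL2) : projSigma P h K ≤ mΩ :=
  iSup_le fun Y => Measurable.comap_le Y.2.1

theorem measurable_projSigma {K : Submodule ℝ VectorL2} {F : VectorL2} (hF : F ∈ K) {Y : Ω → ℝ}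
    (hY : Measurable Y) (hFY : IsDirichletPairing P h F Y) : Measurable[projSigma P h K] Y := by
  have h1 : MeasurableSpace.comap Y (borel ℝ) ≤ projSigma P h K :=
    le_iSup (fun Y : {Y : Ω → ℝ // Measurable Y ∧ ∃ f ∈ K, IsDirichletPairing P h f Y} =>
      MeasurableSpace.comap Y.1 (borel ℝ)) ⟨Y, hY, F, hF, hFY⟩
  exact Measurable.mono (comap_measurable Y) h1 (BorelSpace.measurable_eq (α := ℝ)).le

end GaussianRep

/-! ### Splitting as independence of the two projections -/

namespace GaussianRep

variable {D : Opens ℂ} {Ω : Type*} {mΩ : MeasurableSpace Ω} {P : Measure Ω}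
  [IsProbabilityMeasure P] {h : Ω → Distr D} (R : GaussianRep P h)

/-- Linear combinations of variables c·1_s + X(F) keep this form. It lets the indicator of s be
treated as one more coordinate of the Harm_B family. -/
theorem exists_sum_eq {ι : Type*} [Fintype ι] {K : Submodule ℝ VectorL2} {s : Set Ω}
    {Z : ι → Ω → ℝ} (a : ι → ℝ)
    (hZ : ∀ i, ∃ c : ℝ, ∃ F ∈ K, Z i =ᵐ[P] fun ω => s.indicator (fun _ => c) ω + R.X F ω) :
    ∃ c : ℝ, ∃ F ∈ K, (fun ω => ∑ i, a i * Z i ω) =ᵐ[P]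
      fun ω => s.indicator (fun _ => c) ω + R.X F ω := by
  have h1 : (fun ω => ∑ i, a i * Z i ω) = ∑ i, a i • Z i := by
    ext ω
    simp [Finset.sum_apply]
  rw [h1]
  refine Finset.sum_induction (fun i => a i • Z i)
    (fun Y => ∃ c : ℝ, ∃ F ∈ K, Y =ᵐ[P] fun ω => s.indicator (fun _ => c) ω + R.X F ω)
    ?_ ?_ fun i _ => ?_
  · rintro Y Y' ⟨c, F, hF, hY⟩ ⟨c', F', hF', hY'⟩
    refine ⟨c + c', F + F', K.add_mem hF hF', ?_⟩
    rw [map_add]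
    filter_upwards [hY, hY', Lp.coeFn_add (R.X F) (R.X F')] with ω h1 h2 h3
    rw [Pi.add_apply, h1, h2, h3, Pi.add_apply]
    by_cases hω : ω ∈ s <;> simp [hω] <;> ring
  · refine ⟨0, 0, K.zero_mem, ?_⟩
    rw [map_zero]
    filter_upwards [Lp.coeFn_zero ℝ 2 P] with ω hω
    simp [hω]
  · obtain ⟨c, F, hF, hY⟩ := hZ i
    refine ⟨a i * c, a i • F, K.smul_mem _ hF, ?_⟩
    rw [map_smul]
    filter_upwards [hY, Lp.coeFn_smul (a i) (R.X F)] with ω h1 h2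
    rw [Pi.smul_apply, h1, h2, Pi.smul_apply]
    by_cases hω : ω ∈ s <;> simp [hω] <;> ring

/-- On s the extra term multiplies by exp(ic), elsewhere by 1; only integrals over Ω and over s
remain, and splitting controls both. -/
theorem integral_cis_indicator_add {s : Set Ω} (hs : MeasurableSet s) (c : ℝ) (F : VectorL2) :
    ∫ ω, cis (s.indicator (fun _ => c) ω + R.X F ω) ∂P =
      (∫ ω, cis (R.X F ω) ∂P) + (cis c - 1) * ∫ ω in s, cis (R.X F ω) ∂P := by
  rw [← integral_const_mul, ← integral_indicator hs, ← integral_add (R.integrable_cis_X F)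
    (((R.integrable_cis_X F).const_mul _).indicator hs)]
  refine integral_congr_ae (ae_of_all _ fun ω => ?_)
  by_cases hω : ω ∈ s
  · simp only [hω, indicator_of_mem, cis_add]
    ring
  · simp [hω]

variable {R}

/-- The indicator of s, at index `none`, is adjoined to the Harm_B variables. The joint
characteristic function with the Supp_B variables factorizes, since ⟨F, g⟩ = 0 for F ∈ Harm_B and g
∈ Supp_B. -/
theorem SplitsOn.decouples {B : Set ℂ} {s : Set Ω} (hs : MeasurableSet s) (H : R.SplitsOn B s) :
    Decouples (projSigma P h (harmSpace D B)) (projSigma P h (suppSpace D B)) P s := by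
  let ι := {Y : Ω → ℝ // Measurable Y ∧ ∃ f ∈ harmSpace D B, IsDirichletPairing P h f Y}
  let κ := {Y : Ω → ℝ // Measurable Y ∧ ∃ f ∈ suppSpace D B, IsDirichletPairing P h f Y}
  let Z : Option ι → Ω → ℝ := fun i => i.elim (s.indicator fun _ => 1) fun Y => Y.1
  let W : κ → Ω → ℝ := fun Y => Y.1
  have hZ (i : Option ι) : Measurable (Z i) := by
    cases i with
    | none => exact measurable_const.indicator hs
    | some Y => exact Y.2.1
  have hW (j : κ) : Measurable (W j) := j.2.1
  have hZ' (i : Option ι) : ∃ c : ℝ, ∃ F ∈ harmSpace D B,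
      Z i =ᵐ[P] fun ω => s.indicator (fun _ => c) ω + R.X F ω := by
    cases i with
    | none =>
      refine ⟨1, 0, Submodule.zero_mem _, ?_⟩
      rw [map_zero]
      filter_upwards [Lp.coeFn_zero ℝ 2 P] with ω hω
      simp [Z, hω]
    | some Y =>
      obtain ⟨F, hF, hY⟩ := Y.2.2
      refine ⟨0, F, hF, ?_⟩
      filter_upwards [(R.isDirichletPairing_iff hF.1 Y.2.1).1 hY] with ω hω
      simp [Z, hω]
  have hW' (j : κ) : ∃ c : ℝ, ∃ F ∈ suppSpace D B,
      W j =ᵐ[P] fun ω => (∅ : Set Ω).indicator (fun _ => c) ω + R.X F ω := by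
    obtain ⟨F, hF, hY⟩ := j.2.2
    refine ⟨0, F, hF, ?_⟩
    filter_upwards [(R.isDirichletPairing_iff (suppSpace_le_dirichletSpace B hF) j.2.1).1 hY]
      with ω hω
    simp [W, hω]
  have hind : IndepFun (fun ω i => Z i ω) (fun ω j => W j ω) P := by
    refine indepFun_of_integral_cis hZ hW fun I J a b => ?_
    obtain ⟨c, F, hF, hI⟩ := R.exists_sum_eq (Z := fun i : I => Z i) a fun i => hZ' i
    obtain ⟨c', g, hg, hJ⟩ := R.exists_sum_eq (Z := fun j : J => W j) b fun j => hW' j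
    have hg' := suppSpace_le_dirichletSpace B hg
    have h1 : ∫ ω, cis ((∑ i, a i * Z i ω) + ∑ j, b j * W j ω) ∂P =
        ∫ ω, cis (s.indicator (fun _ => c) ω + R.X (F + g) ω) ∂P := by
      refine integral_congr_ae ?_
      rw [map_add]
      filter_upwards [hI, hJ, Lp.coeFn_add (R.X F) (R.X g)] with ω h1 h2 h3
      rw [h1, h2, h3, Pi.add_apply, indicator_empty, zero_add, add_assoc]
    have h2 : ∫ ω, cis (∑ i, a i * Z i ω) ∂P =
        ∫ ω, cis (s.indicator (fun _ => c) ω + R.X F ω) ∂P := by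
      refine integral_congr_ae ?_
      filter_upwards [hI] with ω hω
      rw [hω]
    have h3 : ∫ ω, cis (∑ j, b j * W j ω) ∂P = Complex.exp (-(‖g‖ ^ 2 / 2 : ℝ)) := by
      rw [← R.integral_cis_X hg']
      refine integral_congr_ae ?_
      filter_upwards [hJ] with ω hω
      rw [hω, indicator_empty, zero_add]
    have h4 := H F hF.1 g hg
    have h5 := R.splitsOn_univ B F hF.1 g hg
    rw [Measure.restrict_univ] at h5
    rw [h1, h2, h3, R.integral_cis_indicator_add hs, R.integral_cis_indicator_add hs, h4, h5,
      inner_eq_zero_of_mem_harmSpace hF hg, zero_add]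
    ring
  intro G t hG ht
  have hG' : MeasurableSet[MeasurableSpace.comap (fun ω i => Z i ω) MeasurableSpace.pi] G := by
    refine (iSup_le fun Y : ι => ?_ : projSigma P h (harmSpace D B) ≤ _) G hG
    rintro _ ⟨E, hE, rfl⟩
    refine ⟨{x | x (some Y) ∈ E}, ?_, rfl⟩
    exact measurable_pi_apply (some Y) (by rwa [BorelSpace.measurable_eq (α := ℝ)])
  have ht' : MeasurableSet[MeasurableSpace.comap (fun ω j => W j ω) MeasurableSpace.pi] t := by
    refine (iSup_le fun Y : κ => ?_ : projSigma P h (suppSpace D B) ≤ _) t ht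
    rintro _ ⟨E, hE, rfl⟩
    refine ⟨{x | x Y ∈ E}, ?_, rfl⟩
    exact measurable_pi_apply Y (by rwa [BorelSpace.measurable_eq (α := ℝ)])
  have hs' : MeasurableSet[MeasurableSpace.comap (fun ω i => Z i ω) MeasurableSpace.pi] s := by
    refine ⟨{x | x none ∈ ({1} : Set ℝ)}, measurable_pi_apply none (measurableSet_singleton _), ?_⟩
    ext ω
    by_cases hω : ω ∈ s <;> simp [Z, hω]
  have := (IndepFun_iff _ _ _).1 hind (s ∩ G) t (hs'.inter hG') ht'
  rw [measureReal_def, measureReal_def, measureReal_def, this, ENNReal.toReal_mul]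

theorem splitsOn_iff_decouples {B : Set ℂ} {s : Set Ω} (hs : MeasurableSet s) : R.SplitsOn B s ↔
    Decouples (projSigma P h (harmSpace D B)) (projSigma P h (suppSpace D B)) P s := by
  refine ⟨fun H => H.decouples hs, fun H => ?_⟩
  have hmeas {K : Submodule ℝ VectorL2} {F : VectorL2} (hF : F ∈ K) (hK : K ≤ dirichletSpace D) :
      Measurable[projSigma P h K] (R.X F) :=
    measurable_projSigma hF (R.measurable_X F)
      ((R.isDirichletPairing_iff (hK hF) (R.measurable_X F)).2 (ae_eq_refl _))
  have key {F g : VectorL2} (hF : F ∈ harmSpace D B) (hg : g ∈ suppSpace D B) :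
      ∫ ω in s, cis (R.X (F + g) ω) ∂P =
        (∫ ω in s, cis (R.X F ω) ∂P) * Complex.exp (-(‖g‖ ^ 2 / 2 : ℝ)) := by
    have hF' := hmeas hF inf_le_left
    have hg' := hmeas hg (suppSpace_le_dirichletSpace B)
    -- Under P restricted to s, the joint law of the two variables is a product whose second factor
    -- is the unrestricted law of `X g`.
    have hprod : ((P.restrict s).map (R.X F)).prod (P.map (R.X g)) =
        (P.restrict s).map fun ω => (R.X F ω, R.X g ω) := by
      refine Measure.prod_eq fun U V hU hV => ?_
      rw [Measure.map_apply (R.measurable_X F) hU, Measure.map_apply (R.measurable_X g) hV,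
        Measure.map_apply ((R.measurable_X F).prodMk (R.measurable_X g)) (hU.prod hV),
        Measure.restrict_apply (R.measurable_X F hU), Measure.restrict_apply
          ((R.measurable_X F).prodMk (R.measurable_X g) (hU.prod hV))]
      have := H _ _ (hF' hU) (hg' hV)
      rw [measureReal_def, measureReal_def, measureReal_def, ← ENNReal.toReal_mul,
        ENNReal.toReal_eq_toReal_iff' (measure_ne_top _ _)
          (ENNReal.mul_ne_top (measure_ne_top _ _) (measure_ne_top _ _))] at this
      rw [inter_comm (R.X F ⁻¹' U) s, ← this]
      congr 1
      ext ω
      simp only [mem_inter_iff, mem_preimage, mem_prod]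
      tauto
    have h1 : ∫ ω in s, cis (R.X (F + g) ω) ∂P =
        ∫ ω in s, cis (R.X F ω) * cis (R.X g ω) ∂P := by
      refine integral_congr_ae (ae_restrict_of_ae ?_)
      rw [map_add]
      filter_upwards [Lp.coeFn_add (R.X F) (R.X g)] with ω hω
      rw [hω, Pi.add_apply, cis_add]
    have h2 : ∫ ω in s, cis (R.X F ω) * cis (R.X g ω) ∂P =
        ∫ p : ℝ × ℝ, cis p.1 * cis p.2 ∂((P.restrict s).map fun ω => (R.X F ω, R.X g ω)) :=
      (integral_map (f := fun p : ℝ × ℝ => cis p.1 * cis p.2)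
        ((R.measurable_X F).prodMk (R.measurable_X g)).aemeasurable (Measurable.aestronglyMeasurable (by fun_prop))).symm
    rw [h1, h2, ← hprod, integral_prod_mul, integral_map (R.measurable_X F).aemeasurable
      measurable_cis.aestronglyMeasurable, integral_map (R.measurable_X g).aemeasurable
      measurable_cis.aestronglyMeasurable, R.integral_cis_X (suppSpace_le_dirichletSpace B hg)]
  intro F hF g hg
  -- For general F the identity for Harm_B is used twice, with the Supp_B vectors P_B F and P_B F +
  -- g; the quotient of the two Gaussian factors contains the cross term ⟨F, g⟩.
  have hF0 := sub_suppProj_mem_harmSpace (B := B) hF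
  have hF1 := suppProj_mem (D := D) B F
  have h1 := key hF0 hF1
  have h2 := key hF0 (Submodule.add_mem _ hF1 hg)
  rw [sub_add_cancel] at h1
  rw [← add_assoc, sub_add_cancel] at h2
  rw [h1, h2, mul_assoc, ← Complex.exp_add, norm_add_sq_real, inner_suppProj hg]
  push_cast
  ring_nf

end GaussianRep

/-! ### Conditioning on the whole field -/

namespace GaussianRep

variable {D : Opens ℂ} {Ω : Type*} {mΩ : MeasurableSpace Ω} {P : Measure Ω}
  [IsProbabilityMeasure P] {h : Ω → Distr D}

theorem comap_le_sup (R : GaussianRep P h) (B : Set ℂ) : MeasurableSpace.comap h inferInstance ≤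
    projSigma P h (harmSpace D B) ⊔ projSigma P h (suppSpace D B) := by
  have key (ρ : TestFn D) :
      Measurable[projSigma P h (harmSpace D B) ⊔ projSigma P h (suppSpace D B)]
        (fun ω => h ω ρ) := by
    have hρ : Measurable (fun ω => h ω ρ) := (measurable_distr_apply ρ).comp R.measurable
    set f := suppProj D B (R.pot ρ) with hf
    have hf' : f ∈ suppSpace D B := suppProj_mem _ _
    have hF := sub_suppProj_mem_harmSpace (B := B) (R.pot_mem ρ)
    have h2 : Measurable[projSigma P h (suppSpace D B)] (R.X f) :=
      measurable_projSigma hf' (R.measurable_X f) ((R.isDirichletPairing_iff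
        (suppSpace_le_dirichletSpace B hf') (R.measurable_X f)).2 (ae_eq_refl _))
    -- This difference is a version of the Harm_B part, chosen so that (h, ρ) is a sum of measurable
    -- variables at every point; no null set has to be discarded.
    have hY : Measurable (fun ω => h ω ρ - R.mean ρ - R.X f ω) :=
      (hρ.sub_const _).sub (R.measurable_X f)
    have h1 : Measurable[projSigma P h (harmSpace D B)] (fun ω => h ω ρ - R.mean ρ - R.X f ω) := by
      refine measurable_projSigma hF hY ((R.isDirichletPairing_iff hF.1 hY).2 ?_)
      rw [← hf, map_sub]
      filter_upwards [R.X_pot ρ, Lp.coeFn_sub (R.X (R.pot ρ)) (R.X f)] with ω h3 h4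
      rw [h4, Pi.sub_apply, h3]
    have h3 := ((h1.mono le_sup_left le_rfl).add (h2.mono le_sup_right le_rfl)).add_const (R.mean ρ)
    refine Eq.mp (congrArg _ (funext fun ω => ?_)) h3
    simp
  exact ((measurable_distr_iff).2 key).comap_le

theorem aestronglyMeasurable_X (R : GaussianRep P h) {F : VectorL2} (hF : F ∈ dirichletSpace D) :
    AEStronglyMeasurable[MeasurableSpace.comap h inferInstance] (R.X F) P := by
  obtain ⟨g, -, hg⟩ := mem_suppSpace_iff.1 hF
  have hcl := isClosed_aestronglyMeasurable (F := ℝ) (p := 2) (μ := P) R.measurable.comap_le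
  refine hcl.mem_of_tendsto ((R.X.continuous.tendsto F).comp hg) (Eventually.of_forall fun n => ?_)
  refine AEStronglyMeasurable.congr (f := fun ω => h ω (-lap (g n))) ?_ (R.X_gradL2 (g n)).symm
  exact (((measurable_distr_apply _).comp (comap_measurable h)).stronglyMeasurable
    ).aestronglyMeasurable

/-- The inclusion holds only up to null events: `projSigma` contains every measurable version of a
pairing, while σ(h) need not. -/
theorem projSigma_le_eventuallyMeasurableSpace (R : GaussianRep P h) {K : Submodule ℝ VectorL2}
    (hK : K ≤ dirichletSpace D) : projSigma P h K ≤
      eventuallyMeasurableSpace (MeasurableSpace.comap h inferInstance) (ae P) := by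
  refine iSup_le fun ⟨Y, hY, F, hF, hYF⟩ => ?_
  rintro _ ⟨E, hE, rfl⟩
  obtain ⟨f, hf, hXf⟩ := R.aestronglyMeasurable_X (hK hF)
  refine ⟨f ⁻¹' E, hf.measurable (by rwa [BorelSpace.measurable_eq (α := ℝ)]), ?_⟩
  filter_upwards [(R.isDirichletPairing_iff (hK hF) hY).1 hYF, hXf] with ω h1 h2
  exact congrArg (· ∈ E) (h1.trans h2)

theorem condExp_comap_eq (R : GaussianRep P h) (B : Set ℂ) {s : Set Ω} (hs : MeasurableSet s) :
    P⟦s | MeasurableSpace.comap h inferInstance⟧ =ᵐ[P]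
      P⟦s | projSigma P h (harmSpace D B) ⊔ projSigma P h (suppSpace D B)⟧ := by
  have hσ : MeasurableSpace.comap h inferInstance ≤ mΩ := R.measurable.comap_le
  have hsup : projSigma P h (harmSpace D B) ⊔ projSigma P h (suppSpace D B) ≤ mΩ :=
    sup_le (projSigma_le _) (projSigma_le _)
  refine ae_eq_condExp_of_forall_setIntegral_eq hsup ((integrable_const (1 : ℝ)).indicator hs)
    (fun _ _ _ => integrable_condExp.integrableOn) (fun E hE _ => ?_)
    (stronglyMeasurable_condExp.aestronglyMeasurable.mono (R.comap_le_sup B))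
  obtain ⟨E', hE', hEE'⟩ := (sup_le (R.projSigma_le_eventuallyMeasurableSpace inf_le_left)
    (R.projSigma_le_eventuallyMeasurableSpace (suppSpace_le_dirichletSpace B))) E hE
  rw [setIntegral_congr_set hEE', setIntegral_congr_set hEE',
    setIntegral_condExp hσ ((integrable_const (1 : ℝ)).indicator hs) hE']

theorem splitsOn_iff_aestronglyMeasurable (R : GaussianRep P h) {B : Set ℂ} {s : Set Ω} (hs : MeasurableSet s) :
    R.SplitsOn B s ↔ AEStronglyMeasurable[projSigma P h (harmSpace D B)]
      (P⟦s | MeasurableSpace.comap h inferInstance⟧) P := by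
  have hae := R.condExp_comap_eq B hs
  rw [splitsOn_iff_decouples hs, decouples_iff_aestronglyMeasurable (projSigma_le _)
    (projSigma_le _) hs ((R.splitsOn_univ B).decouples MeasurableSet.univ)]
  exact ⟨fun H => H.congr hae.symm, fun H => H.congr hae⟩

theorem condIndepGiven_iff_splitsOn {Ω : Type*} {m₁ mΩ : MeasurableSpace Ω} {P : Measure Ω}
    [IsProbabilityMeasure P] {h : Ω → Distr D} (R : GaussianRep P h) {B : Set ℂ} (hm₁ : m₁ ≤ mΩ) :
    CondIndepGiven P (projSigma P h (harmSpace D B)) m₁ (projSigma P h (suppSpace D B)) ↔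
      ∀ s, MeasurableSet[m₁] s → R.SplitsOn B s := by
  rw [condIndepGiven_iff (projSigma_le _) hm₁ (projSigma_le _)
    ((R.splitsOn_univ B).decouples MeasurableSet.univ)]
  exact forall₂_congr fun s hs => (splitsOn_iff_decouples (hm₁ _ hs)).symm

end GaussianRep

/-! ### Random closed sets -/

section RandomClosedSets

variable {D : Opens ℂ} {φ : ℂ → ℂ}

instance instBorelSpaceClosedSets : BorelSpace ClosedSets := ⟨rfl⟩

theorem measurableSet_disjoint_compact {C : Set ℂ} (hC : IsCompact C) :
    MeasurableSet {K : ClosedSets | Disjoint (K.1 : Set ℂ) C} := by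
  have h1 : IsClosed {K : ClosedSets | ((K.1 : Set ℂ) ∩ C).Nonempty} :=
    (NonemptyCompacts.isClosed_inter_nonempty_of_isClosed hC.isClosed).preimage
      continuous_subtype_val
  convert h1.measurableSet.compl using 1
  ext K
  simp [Set.disjoint_iff_inter_eq_empty, Set.not_nonempty_iff_eq_empty]

/-- B is a countable union of compact sets, their images under φ are compact, and missing a compact
set is an open condition for the Hausdorff metric. -/
theorem measurableSet_avoids_id (hφ : ContinuousOn φ D) {B : Set ℂ} (hB : IsOpen B) (hBD : B ⊆ D) :
    MeasurableSet {K : ClosedSets | ∀ z ∈ B, φ z ∉ (K.1 : Set ℂ)} := by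
  have := hB.locallyCompactSpace
  obtain ⟨C, hC, hCB⟩ := isSigmaCompact_iff_sigmaCompactSpace.2 (inferInstance : SigmaCompactSpace B)
  have h1 : {K : ClosedSets | ∀ z ∈ B, φ z ∉ (K.1 : Set ℂ)} =
      ⋂ n, {K : ClosedSets | Disjoint (K.1 : Set ℂ) (φ '' C n)} := by
    ext K
    simp only [← hCB, mem_iUnion, mem_iInter, Set.disjoint_right, mem_ofPred_eq]
    aesop
  rw [h1]
  refine MeasurableSet.iInter fun n => measurableSet_disjoint_compact ((hC n).image_of_continuousOn
    (hφ.mono ((subset_iUnion C n).trans (hCB.le.trans hBD))))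

theorem avoids_union {Ω : Type*} (A : Ω → ClosedSets) (B B' : Set ℂ) :
    avoids φ A (B ∪ B') = avoids φ A B ∩ avoids φ A B' := by
  ext ω
  simp only [avoids, mem_union, mem_ofPred_eq, mem_inter_iff]
  exact ⟨fun H => ⟨fun z hz => H z (Or.inl hz), fun z hz => H z (Or.inr hz)⟩,
    fun H z hz => hz.elim (H.1 z) (H.2 z)⟩

theorem measurableSet_avoids {Ω : Type*} {mΩ : MeasurableSpace Ω} {A : Ω → ClosedSets}
    (hA : Measurable A) (hφ : ContinuousOn φ D) {B : Set ℂ} (hB : IsOpen B) (hBD : B ⊆ D) :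
    MeasurableSet (avoids φ A B) :=
  hA (measurableSet_avoids_id hφ hB hBD)

/-- A closed set, as a compact set. -/
def toCompacts (K : ClosedSets) : Compacts ℂ := K.1.toCompacts

theorem isClosedEmbedding_toCompacts : Topology.IsClosedEmbedding toCompacts :=
  NonemptyCompacts.isClosedEmbedding_toCompacts.comp
    (NonemptyCompacts.isClosed_subsets_of_isClosed Metric.isClosed_closedBall).isClosedEmbedding_subtypeVal

theorem toCompacts_ne_bot (K : ClosedSets) : toCompacts K ≠ ⊥ := fun hK =>
  K.1.nonempty.ne_empty (congrArg (fun C : Compacts ℂ => (C : Set ℂ)) hK)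

variable {Ω : Type*} {mΩ : MeasurableSpace Ω} {A : Ω → ClosedSets}

/-- The events in the σ-algebra generated by `(S, Ã)`. -/
theorem measurableSet_hitSigma_iff {B : Set ℂ} {s : Set Ω} : MeasurableSet[hitSigma φ A B] s ↔
    ∃ E : Set ClosedSets, MeasurableSet E ∧
      (s = avoids φ A B ∩ A ⁻¹' E ∨ sᶜ = avoids φ A B ∩ A ⁻¹' E) := by
  let _ : MeasurableSpace (Compacts ℂ) := borel _
  have : BorelSpace (Compacts ℂ) := ⟨rfl⟩
  have hemb : MeasurableEmbedding toCompacts := isClosedEmbedding_toCompacts.measurableEmbedding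
  constructor
  · have hmeas {V : Set (Prop × Compacts ℂ)} (hV : MeasurableSet V) :
        MeasurableSet {K | (False, toCompacts K) ∈ V} :=
      (measurable_const.prodMk hemb.measurable) hV
    rintro ⟨V, hV, rfl⟩
    -- On S the pair takes the single value (True, ∅), so an event of the σ-algebra contains S or
    -- misses it; in the first case its complement is described instead.
    by_cases hbot : (True, (⊥ : Compacts ℂ)) ∈ V
    · refine ⟨{K | (False, toCompacts K) ∈ V}ᶜ, (hmeas hV).compl, Or.inr ?_⟩
      ext ω
      by_cases hω : ω ∈ avoids φ A B
      · simp [hitPair, hω, toCompacts]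
      · simp [hitPair, hω, hbot]
    · refine ⟨{K | (False, toCompacts K) ∈ V}, hmeas hV, Or.inl ?_⟩
      ext ω
      by_cases hω : ω ∈ avoids φ A B
      · simp [hitPair, hω, toCompacts]
      · simp [hitPair, hω, hbot]
  · have key {E : Set ClosedSets} (hE : MeasurableSet E) :
        MeasurableSet[hitSigma φ A B] (avoids φ A B ∩ A ⁻¹' E) := by
      refine ⟨Prod.snd ⁻¹' (toCompacts '' E), measurable_snd (hemb.measurableSet_image.2 hE), ?_⟩
      ext ω
      by_cases hω : ω ∈ avoids φ A B
      · simp only [mem_preimage, hitPair, hω, if_true, mem_inter_iff, true_and]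
        exact hemb.injective.mem_set_image
      · simp only [mem_preimage, hitPair, hω, if_false, mem_inter_iff, false_and, iff_false]
        rintro ⟨K, -, hK⟩
        exact toCompacts_ne_bot K hK
    rintro ⟨E, hE, rfl | hs⟩
    · exact key hE
    · rw [← @MeasurableSet.compl_iff _ _ (hitSigma φ A B), hs]
      exact key hE

theorem hitSigma_le (hA : Measurable A) (hφ : ContinuousOn φ D) {B : Set ℂ} (hB : IsOpen B)
    (hBD : B ⊆ D) : hitSigma φ A B ≤ mΩ := by
  intro s hs
  obtain ⟨E, hE, rfl | hs⟩ := measurableSet_hitSigma_iff.1 hs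
  · exact (measurableSet_avoids hA hφ hB hBD).inter (hA hE)
  · rw [← MeasurableSet.compl_iff, hs]
    exact (measurableSet_avoids hA hφ hB hBD).inter (hA hE)

end RandomClosedSets

/-! ### Conditions on hitting events in terms of splitting -/

namespace GaussianRep

variable {D : Opens ℂ} {φ : ℂ → ℂ} {Ω : Type*} {mΩ : MeasurableSpace Ω} {P : Measure Ω}
  [IsProbabilityMeasure P] {h : Ω → Distr D} {A : Ω → ClosedSets}

/-- Splitting is stable under complements and countable disjoint unions, so the generating event
decides. -/
theorem eventCondIndep_iff (R : GaussianRep P h) (hA : Measurable A) (hφ : ContinuousOn φ D) :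
    EventCondIndep φ P h A ↔ ∀ B : Set ℂ, IsOpen B → B ⊆ D → R.SplitsOn B (avoids φ A B) := by
  refine forall₃_congr fun B hB hBD => ?_
  have hm := measurableSet_avoids hA hφ hB hBD
  rw [R.condIndepGiven_iff_splitsOn
    (MeasurableSpace.generateFrom_le (by rintro _ rfl; exact hm))]
  refine ⟨fun H => H _ (MeasurableSpace.measurableSet_generateFrom rfl), fun H s hs => ?_⟩
  have hle : MeasurableSpace.generateFrom {avoids φ A B} ≤ mΩ :=
    MeasurableSpace.generateFrom_le (by rintro _ rfl; exact hm)
  have hempty : R.SplitsOn B ∅ := by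
    rw [← Set.sdiff_self (s := univ)]
    exact (R.splitsOn_univ B).diff (R.splitsOn_univ B) MeasurableSet.univ subset_rfl
  induction s, hs using MeasurableSpace.induction_on_inter rfl (IsPiSystem.singleton _) with
  | empty => exact hempty
  | basic t ht =>
    rw [mem_singleton_iff.1 ht]
    exact H
  | compl t ht ih =>
    rw [compl_eq_univ_sdiff]
    exact (R.splitsOn_univ B).diff ih (hle _ ht) (subset_univ _)
  | iUnion f hd hf ih => exact SplitsOn.iUnion ih (fun n => hle _ (hf n)) hd

theorem eventCondProb_iff (R : GaussianRep P h) (hA : Measurable A) (hφ : ContinuousOn φ D) :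
    EventCondProb φ P h A ↔ ∀ B : Set ℂ, IsOpen B → B ⊆ D → R.SplitsOn B (avoids φ A B) :=
  forall₃_congr fun _ hB hBD =>
    (R.splitsOn_iff_aestronglyMeasurable (measurableSet_avoids hA hφ hB hBD)).symm

theorem pairCondIndep_iff (R : GaussianRep P h) (hA : Measurable A) (hφ : ContinuousOn φ D) :
    PairCondIndep φ P h A ↔ ∀ B : Set ℂ, IsOpen B → B ⊆ D → ∀ E : Set ClosedSets,
      MeasurableSet E → R.SplitsOn B (avoids φ A B ∩ A ⁻¹' E) := by
  refine forall₃_congr fun B hB hBD => ?_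
  rw [R.condIndepGiven_iff_splitsOn (hitSigma_le hA hφ hB hBD)]
  refine ⟨fun H E hE => H _ (measurableSet_hitSigma_iff.2 ⟨E, hE, Or.inl rfl⟩), fun H s hs => ?_⟩
  obtain ⟨E, hE, rfl | hs⟩ := measurableSet_hitSigma_iff.1 hs
  · exact H E hE
  · rw [← compl_compl s, compl_eq_univ_sdiff, hs]
    exact (R.splitsOn_univ B).diff (H E hE)
      ((measurableSet_avoids hA hφ hB hBD).inter (hA hE)) (subset_univ _)

theorem eventCondIndep_of_pairCondIndep (R : GaussianRep P h) (hA : Measurable A) (hφ : ContinuousOn φ D)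
    (H : PairCondIndep φ P h A) : EventCondIndep φ P h A := by
  rw [R.eventCondIndep_iff hA hφ]
  intro B hB hBD
  simpa using (R.pairCondIndep_iff hA hφ).1 H B hB hBD univ MeasurableSet.univ

/-- Avoidance events form a π-system, stable because avoiding B and B' means avoiding B ∪ B'.
Condition 1 for B ∪ B' splits over Supp_{B ∪ B'}, which contains Supp_B; the π-λ theorem and the
null-set invariance of splitting do the rest. -/
theorem pairCondIndep_of_eventCondIndep (R : GaussianRep P h) (hA : Measurable A) (hφ : ContinuousOn φ D)
    (hdet : IsDeterminedInside D φ P A) (H : EventCondIndep φ P h A) : PairCondIndep φ P h A := by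
  rw [R.eventCondIndep_iff hA hφ] at H
  rw [R.pairCondIndep_iff hA hφ]
  intro B hB hBD E hE
  obtain ⟨F, hF, hEF⟩ := hdet E hE
  have hmB := measurableSet_avoids hA hφ hB hBD
  have hpi : IsPiSystem {G | ∃ B : Set ℂ, IsOpen B ∧ B ⊆ D ∧ G = avoids φ A B} := by
    rintro _ ⟨B₁, h1, h1', rfl⟩ _ ⟨B₂, h2, h2', rfl⟩ -
    exact ⟨B₁ ∪ B₂, h1.union h2, union_subset h1' h2', (avoids_union _ _ _).symm⟩
  have hle : MeasurableSpace.generateFrom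
      {G | ∃ B : Set ℂ, IsOpen B ∧ B ⊆ D ∧ G = avoids φ A B} ≤ mΩ := by
    refine MeasurableSpace.generateFrom_le ?_
    rintro _ ⟨B', hB', hBD', rfl⟩
    exact measurableSet_avoids hA hφ hB' hBD'
  have key : R.SplitsOn B (avoids φ A B ∩ F) := by
    clear hEF
    induction F, hF using MeasurableSpace.induction_on_inter rfl hpi with
    | empty =>
      rw [inter_empty, ← Set.sdiff_self]
      exact (R.splitsOn_univ B).diff (R.splitsOn_univ B) MeasurableSet.univ subset_rfl
    | basic t ht =>
      obtain ⟨B', hB', hBD', rfl⟩ := ht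
      rw [← avoids_union]
      exact (H _ (hB.union hB') (union_subset hBD hBD')).mono subset_union_left
    | compl t ht ih =>
      rw [← sdiff_eq, ← sdiff_self_inter]
      exact (H B hB hBD).diff ih (hmB.inter (hle _ ht)) inter_subset_left
    | iUnion f hd hf ih =>
      rw [inter_iUnion]
      exact SplitsOn.iUnion ih (fun n => hmB.inter (hle _ (hf n)))
        fun i j hij => (hd hij).mono inter_subset_right inter_subset_right
  exact key.congr ((ae_eq_refl _).inter hEF.symm)

end GaussianRep

/-! ### Two step sampling -/

theorem measurable_distr_add {D : Opens ℂ} {Ω : Type*} {mΩ : MeasurableSpace Ω}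
    {S T : Ω → Distr D} (hS : Measurable S) (hT : Measurable T) :
    Measurable (fun ω => S ω + T ω) :=
  measurable_distr_iff.2 fun ρ =>
    ((measurable_distr_apply ρ).comp hS).add ((measurable_distr_apply ρ).comp hT)

theorem measurable_distr_sub {D : Opens ℂ} {Ω : Type*} {mΩ : MeasurableSpace Ω}
    {S T : Ω → Distr D} (hS : Measurable S) (hT : Measurable T) :
    Measurable (fun ω => S ω - T ω) :=
  measurable_distr_iff.2 fun ρ =>
    ((measurable_distr_apply ρ).comp hS).sub ((measurable_distr_apply ρ).comp hT)

theorem norm_suppProj_add_sq {D : Opens ℂ} {B : Set ℂ} {g : VectorL2} (hg : g ∈ suppSpace D B)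
    (F : VectorL2) :
    ‖suppProj D B (F + g)‖ ^ 2 = ‖suppProj D B F‖ ^ 2 + 2 * inner ℝ F g + ‖g‖ ^ 2 := by
  rw [map_add, suppProj_eq_self hg, norm_add_sq_real, inner_suppProj hg]

namespace GaussianRep

variable {D : Opens ℂ} {φ : ℂ → ℂ} {Ω : Type*} {mΩ : MeasurableSpace Ω} {P : Measure Ω}
  [IsProbabilityMeasure P] {h : Ω → Distr D} {A : Ω → ClosedSets}

/-- Integrating out h₂ leaves exp(i(h₁, -Δf)) times the Gaussian factor of the projection of f onto
the functions supported off A. For g supported in B and A missing B, adding g to f changes only the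
second factor, and in the prescribed way. -/
theorem pairCondIndep_of_twoStepSampling (R : GaussianRep P h) (hA : Measurable A)
    (hφ : ContinuousOn φ D) (H : TwoStepSampling φ P h A) : PairCondIndep φ P h A := by
  obtain ⟨ν, hν, hharm, η, hη, hzero, hlaw⟩ := H
  rw [R.pairCondIndep_iff hA hφ]
  intro B hB hBD E hE
  set E' : Set ClosedSets := {K | ∀ z ∈ B, φ z ∉ (K.1 : Set ℂ)} ∩ E with hE'
  have hE'm : MeasurableSet E' := (measurableSet_avoids_id hφ hB hBD).inter hE
  have hs : avoids φ A B ∩ A ⁻¹' E = A ⁻¹' E' := rfl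
  have key (f : TestFn D) : ∫ ω in A ⁻¹' E', cis (R.X (gradL2 f) ω) ∂P =
      ∫ p in Prod.snd ⁻¹' E', cis (p.1 (-lap f)) *
        Complex.exp (-(‖suppProj D (offSet D φ p.2) (gradL2 f)‖ ^ 2 / 2 : ℝ)) ∂ν := by
    have hmE : MeasurableSet (Prod.snd ⁻¹' E' : Set (Distr D × ClosedSets)) := measurable_snd hE'm
    have hcis : Measurable (fun p : Distr D × ClosedSets => cis (p.1 (-lap f))) :=
      measurable_cis.comp ((measurable_distr_apply _).comp measurable_fst)
    have hsum : Measurable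
        (fun q : (Distr D × ClosedSets) × Distr D => (q.1.1 + q.2, q.1.2)) :=
      (measurable_distr_add (measurable_fst.comp measurable_fst) measurable_snd).prodMk
        (measurable_snd.comp measurable_fst)
    have h1 : ∫ ω in A ⁻¹' E', cis (R.X (gradL2 f) ω) ∂P =
        ∫ ω, (Prod.snd ⁻¹' E' : Set (Distr D × ClosedSets)).indicator
          (fun p => cis (p.1 (-lap f))) (h ω, A ω) ∂P := by
      rw [← integral_indicator (hA hE'm)]
      refine integral_congr_ae ?_
      filter_upwards [R.X_gradL2 f] with ω hω
      by_cases hω' : A ω ∈ E' <;> simp [hω', hω]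
    have h2 : ∫ ω, (Prod.snd ⁻¹' E' : Set (Distr D × ClosedSets)).indicator
          (fun p => cis (p.1 (-lap f))) (h ω, A ω) ∂P =
        ∫ q, (Prod.snd ⁻¹' E' : Set (Distr D × ClosedSets)).indicator
          (fun p => cis (p.1 (-lap f))) (q.1.1 + q.2, q.1.2) ∂(ν ⊗ₘ η) := by
      rw [← integral_map (f := (Prod.snd ⁻¹' E' : Set (Distr D × ClosedSets)).indicator
          (fun p => cis (p.1 (-lap f)))) (R.measurable.prodMk hA).aemeasurable
          (hcis.indicator hmE).aestronglyMeasurable, ← hlaw,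
        integral_map hsum.aemeasurable (hcis.indicator hmE).aestronglyMeasurable]
    have hint : Integrable (fun q : (Distr D × ClosedSets) × Distr D =>
        (Prod.snd ⁻¹' E' : Set (Distr D × ClosedSets)).indicator
          (fun p => cis (p.1 (-lap f))) (q.1.1 + q.2, q.1.2)) (ν ⊗ₘ η) := by
      refine Integrable.of_bound ((hcis.indicator hmE).comp hsum).aestronglyMeasurable 1
        (ae_of_all _ fun q => ?_)
      refine (norm_indicator_le_norm_self _ _).trans (norm_cis _).le
    rw [h1, h2, Measure.integral_compProd hint, ← integral_indicator hmE]
    refine integral_congr_ae ?_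
    filter_upwards [hzero] with p hp
    by_cases hpE : p.2 ∈ E'
    · have h3 := R.isZeroGFFLaw_iff.1 hp (-lap f)
      rw [R.pot_neg_lap] at h3
      rw [indicator_of_mem (by exact hpE), ← h3, ← integral_const_mul]
      refine integral_congr_ae (ae_of_all _ fun T => ?_)
      beta_reduce
      rw [indicator_of_mem (by exact hpE), ← cis_add]
      rfl
    · rw [indicator_of_notMem (by exact hpE)]
      simp [hpE]
  rw [hs]
  refine splitsOn_of_testFn fun f g hg => ?_
  have hadd : gradL2 f + gradL2 g = gradL2 (f + g) := by
    simp only [← gradL2LM_apply, map_add]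
  rw [hadd, key, key, ← integral_mul_const]
  refine setIntegral_congr_ae (measurable_snd hE'm) ?_
  filter_upwards [hharm] with p hp hpE
  -- This inclusion is used twice: h₁ annihilates Δg, and g is fixed by the projection onto the
  -- functions supported off A.
  have hBoff : B ⊆ offSet D φ p.2 := fun z hz => ⟨hBD hz, hpE.1 z hz⟩
  have h1 : p.1 (-lap (f + g)) = p.1 (-lap f) := by
    have h2 := hp g (hg.trans hBoff)
    rw [← lapCLM_apply, map_add, lapCLM_apply, lapCLM_apply, neg_add, map_add, map_neg _ (lap g),
      h2, neg_zero, add_zero]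
  rw [h1, ← hadd, norm_suppProj_add_sq (gradL2_mem_suppSpace (hg.trans hBoff)), mul_assoc,
    ← Complex.exp_add]
  push_cast
  ring_nf

end GaussianRep

/-! ### Finite approximations of closed sets -/

section Nets

variable {D : Opens ℂ} {φ : ℂ → ℂ}

/-- The scales `4⁻ⁿ`. -/
def radius (n : ℕ) : ℝ := (1 / 4) ^ n

theorem radius_pos (n : ℕ) : 0 < radius n := by unfold radius; positivity

theorem radius_succ (n : ℕ) : radius n = 4 * radius (n + 1) := by
  rw [radius, radius, pow_succ]
  ring

theorem tendsto_radius : Tendsto radius atTop (𝓝 0) :=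
  tendsto_pow_atTop_nhds_zero_of_lt_one (by norm_num) (by norm_num)

theorem radius_anti : Antitone radius :=
  antitone_nat_of_succ_le fun n => by linarith [radius_succ n, radius_pos (n + 1)]

theorem exists_net {r : ℝ} (hr : 0 < r) :
    ∃ N : Finset ℂ, ∀ a ∈ Metric.closedBall (0 : ℂ) 1, ∃ c ∈ N, dist a c < r := by
  obtain ⟨t, -, ht, htc⟩ := (isCompact_closedBall (0 : ℂ) 1).finite_cover_balls hr
  refine ⟨ht.toFinset, fun a ha => ?_⟩
  obtain ⟨c, hc, hac⟩ := mem_iUnion₂.1 (htc ha)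
  exact ⟨c, ht.mem_toFinset.2 hc, hac⟩

/-- A finite net of the closed unit disc at scale `4⁻ⁿ`. -/
def net (n : ℕ) : Finset ℂ := (exists_net (radius_pos n)).choose

theorem exists_mem_net (n : ℕ) {a : ℂ} (ha : a ∈ Metric.closedBall (0 : ℂ) 1) :
    ∃ c ∈ net n, dist a c < radius n := (exists_net (radius_pos n)).choose_spec a ha

open Classical in
/-- The points of the net which are close to `K`. -/
def nearNet (n : ℕ) (K : ClosedSets) : Finset ℂ :=
  (net n).filter fun c => Metric.infDist c (K.1 : Set ℂ) ≤ radius n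

theorem nearNet_mem_powerset (n : ℕ) (K : ClosedSets) : nearNet n K ∈ (net n).powerset :=
  Finset.mem_powerset.2 (Finset.filter_subset _ _)

theorem measurableSet_nearNet_eq (n : ℕ) (I : Finset ℂ) :
    MeasurableSet {K | nearNet n K = I} := by
  classical
  have hm (c : ℂ) : Measurable (fun K : ClosedSets => Metric.infDist c (K.1 : Set ℂ)) :=
    ((Metric.lipschitz_infDist_set c).continuous.comp continuous_subtype_val).measurable
  have h1 : {K | nearNet n K = I} = {_K | I ⊆ net n} ∩ ⋂ c ∈ net n,
      {K | c ∈ I ↔ Metric.infDist c (K.1 : Set ℂ) ≤ radius n} := by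
    ext K
    simp only [mem_inter_iff, mem_iInter, mem_ofPred_eq]
    constructor
    · rintro rfl
      exact ⟨Finset.filter_subset _ _, fun c hc => by simp [nearNet, hc]⟩
    · rintro ⟨h1, h2⟩
      ext c
      rw [nearNet, Finset.mem_filter]
      exact ⟨fun hc => (h2 c hc.1).2 hc.2, fun hc => ⟨h1 hc, (h2 c (h1 hc)).1 hc⟩⟩
  rw [h1]
  refine (MeasurableSet.const _).inter (Finset.measurableSet_biInter _ fun c _ => ?_)
  have h2 : MeasurableSet {K : ClosedSets | Metric.infDist c (K.1 : Set ℂ) ≤ radius n} :=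
    measurableSet_le (hm c) measurable_const
  by_cases hc : c ∈ I
  · simpa [hc] using h2
  · simp only [hc, false_iff]
    exact h2.compl

/-- The points of `D` whose image is far from the points of `I`. -/
def farSet (D : Opens ℂ) (φ : ℂ → ℂ) (n : ℕ) (I : Finset ℂ) : Set ℂ :=
  {z | z ∈ D ∧ ∀ c ∈ I, 2 * radius n < dist (φ z) c}

/-- The points of `D` whose image is close to a point of `I`. -/
def closeSet (D : Opens ℂ) (φ : ℂ → ℂ) (n : ℕ) (I : Finset ℂ) : Set ℂ :=
  {z | z ∈ D ∧ ∃ c ∈ I, dist (φ z) c < 3 * radius n}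

theorem farSet_subset (n : ℕ) (I : Finset ℂ) : farSet D φ n I ⊆ D := fun _ hz => hz.1

theorem isOpen_farSet (hφ : ContinuousOn φ D) (n : ℕ) (I : Finset ℂ) :
    IsOpen (farSet D φ n I) := by
  have h1 : IsOpen (⋂ c ∈ I, {w : ℂ | 2 * radius n < dist w c}) :=
    isOpen_biInter_finset fun c _ => isOpen_lt continuous_const (continuous_id.dist continuous_const)
  convert hφ.isOpen_inter_preimage D.2 h1 using 1
  ext z
  simp [farSet]

theorem isOpen_closeSet (hφ : ContinuousOn φ D) (n : ℕ) (I : Finset ℂ) :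
    IsOpen (closeSet D φ n I) := by
  have h1 : IsOpen (⋃ c ∈ I, {w : ℂ | dist w c < 3 * radius n}) :=
    isOpen_biUnion fun c _ => isOpen_lt (continuous_id.dist continuous_const) continuous_const
  convert hφ.isOpen_inter_preimage D.2 h1 using 1
  ext z
  simp [closeSet]

theorem exists_dist_eq_infDist (K : ClosedSets) (w : ℂ) :
    ∃ a ∈ (K.1 : Set ℂ), Metric.infDist w (K.1 : Set ℂ) = dist w a :=
  K.1.isCompact.exists_infDist_eq_dist K.1.nonempty w

/-- The point of K nearest to φ(z) has a net point within rₙ, which belongs to `nearNet`; being at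
distance more than 2rₙ from that net point leaves more than rₙ. -/
theorem radius_lt_infDist {n : ℕ} {K : ClosedSets} {z : ℂ} (hz : z ∈ farSet D φ n (nearNet n K)) :
    radius n < Metric.infDist (φ z) (K.1 : Set ℂ) := by
  classical
  obtain ⟨a, ha, hza⟩ := exists_dist_eq_infDist K (φ z)
  obtain ⟨c, hc, hac⟩ := exists_mem_net n (K.2 ha)
  have hcI : c ∈ nearNet n K := by
    rw [nearNet, Finset.mem_filter]
    exact ⟨hc, (Metric.infDist_le_dist_of_mem ha).trans (by rw [dist_comm]; exact hac.le)⟩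
  have h1 := hz.2 c hcI
  have h2 := dist_triangle (φ z) a c
  linarith

theorem mem_farSet {n : ℕ} {K : ClosedSets} {z : ℂ} (hzD : z ∈ D)
    (hz : 3 * radius n < Metric.infDist (φ z) (K.1 : Set ℂ)) :
    z ∈ farSet D φ n (nearNet n K) := by
  classical
  refine ⟨hzD, fun c hc => ?_⟩
  have h1 := (Finset.mem_filter.1 hc).2
  have h2 := Metric.infDist_le_infDist_add_dist (s := (K.1 : Set ℂ)) (x := φ z) (y := c)
  linarith

theorem farSet_nearNet_subset (n : ℕ) (K : ClosedSets) :
    farSet D φ n (nearNet n K) ⊆ offSet D φ K := fun z hz =>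
  ⟨hz.1, fun hzK => by
    have h1 := radius_lt_infDist hz
    rw [Metric.infDist_zero_of_mem hzK] at h1
    exact (radius_pos n).not_gt h1⟩

/-- The reason for the ratio 4: a point of the far set is at distance more than rₙ = 4rₙ₊₁ from K,
beyond the 3rₙ₊₁ that ensures membership at the next scale. -/
theorem monotone_farSet (K : ClosedSets) : Monotone fun n => farSet D φ n (nearNet n K) := by
  refine monotone_nat_of_le_succ fun n z hz => mem_farSet hz.1 ?_
  have h1 := radius_lt_infDist hz
  rw [radius_succ] at h1
  linarith [radius_pos (n + 1)]

theorem closeSet_subset_interior (hφ : ContinuousOn φ D) {n : ℕ} (K : ClosedSets) {δ : ℝ}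
    (hδ : 4 * radius n ≤ δ) :
    closeSet D φ n (nearNet n K) ⊆ interior (thickening D φ K δ) := by
  classical
  refine interior_maximal (fun z hz => ⟨hz.1, ?_⟩) (isOpen_closeSet hφ n _)
  obtain ⟨c, hc, hzc⟩ := hz.2
  have h1 := (Finset.mem_filter.1 hc).2
  have h2 := Metric.infDist_le_infDist_add_dist (s := (K.1 : Set ℂ)) (x := φ z) (y := c)
  linarith

theorem isOpen_offSet (hφ : ContinuousOn φ D) (K : ClosedSets) : IsOpen (offSet D φ K) :=
  hφ.isOpen_inter_preimage D.2 K.1.isCompact.isClosed.isOpen_compl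

theorem eventually_subset_farSet (hφ : ContinuousOn φ D) {K : ClosedSets} {C : Set ℂ}
    (hC : IsCompact C) (hCK : C ⊆ offSet D φ K) :
    ∃ n, C ⊆ farSet D φ n (nearNet n K) := by
  obtain rfl | hne := C.eq_empty_or_nonempty
  · exact ⟨0, empty_subset _⟩
  have hcont : ContinuousOn (fun z => Metric.infDist (φ z) (K.1 : Set ℂ)) C :=
    (Metric.continuous_infDist_pt _).comp_continuousOn (hφ.mono fun z hz => (hCK hz).1)
  obtain ⟨z₀, hz₀, hmin⟩ := hC.exists_isMinOn hne hcont
  have hpos : 0 < Metric.infDist (φ z₀) (K.1 : Set ℂ) :=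
    (K.1.isCompact.isClosed.notMem_iff_infDist_pos K.1.nonempty).1 (hCK hz₀).2
  have hlim : Tendsto (fun n => 3 * radius n) atTop (𝓝 0) := by
    simpa using tendsto_radius.const_mul 3
  obtain ⟨n, hn⟩ := (hlim.eventually (gt_mem_nhds hpos)).exists
  exact ⟨n, fun z hz => mem_farSet (hCK hz).1 (hn.trans_le (hmin hz))⟩

theorem tendsto_suppProj_farSet (hφ : ContinuousOn φ D) (K : ClosedSets) (F : VectorL2) :
    Tendsto (fun n => suppProj D (farSet D φ n (nearNet n K)) F) atTop
      (𝓝 (suppProj D (offSet D φ K) F)) :=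
  tendsto_suppProj (monotone_farSet K) (fun n => farSet_nearNet_subset n K)
    (fun _ hC hCK => eventually_subset_farSet hφ hC hCK) F

end Nets

/-! ### Localization of harmonic vectors -/

section Localization

variable {D : Opens ℂ} {φ : ℂ → ℂ}

/-- A smooth function on the plane which vanishes near the points of `I` and is `1` away from
them. -/
theorem exists_cutoff (n : ℕ) (I : Finset ℂ) : ∃ θ : ℂ → ℝ,
    ContDiff ℝ ((⊤ : ℕ∞) : WithTop ℕ∞) θ ∧ (∀ w, |θ w| ≤ 1) ∧
    (∀ w, θ w ≠ 0 → ∀ c ∈ I, 5 / 2 * radius n ≤ dist w c) ∧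
    (∀ w, θ w ≠ 1 → ∃ c ∈ I, dist w c ≤ 11 / 4 * radius n) := by
  have hr := radius_pos n
  -- The radii lie strictly between 2rₙ and 3rₙ, so that the closed support conditions fall inside
  -- the strict inequalities defining `farSet` and `closeSet`, which overlap.
  let b (c : ℂ) : ContDiffBump c := ⟨5 / 2 * radius n, 11 / 4 * radius n, by positivity, by linarith⟩
  refine ⟨fun w => ∏ c ∈ I, (1 - b c w), ?_, fun w => ?_, fun w hw c hc => ?_, fun w hw => ?_⟩
  · exact contDiff_prod fun c _ => contDiff_const.sub (b c).contDiff
  · rw [Finset.abs_prod]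
    refine Finset.prod_le_one (fun _ _ => abs_nonneg _) fun c _ => ?_
    rw [abs_le]
    constructor <;> linarith [(b c).nonneg (x := w), (b c).le_one (x := w)]
  · by_contra! h
    refine hw (Finset.prod_eq_zero hc ?_)
    rw [(b c).one_of_mem_closedBall h.le, sub_self]
  · by_contra! h
    refine hw (Finset.prod_eq_one fun c hc => ?_)
    rw [(b c).zero_of_le_dist (h c hc).le, sub_zero]

theorem inner_smoothMul {P : Measure ℂ} (χ : ℂ → ℝ)
    (hχ : ContDiffOn ℝ ((⊤ : ℕ∞) : WithTop ℕ∞) χ D) (ρ ψ : TestFn D) :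
    ∫ z, ρ z * smoothMul χ hχ ψ z ∂P = ∫ z, smoothMul χ hχ ρ z * ψ z ∂P :=
  integral_congr_ae (ae_of_all _ fun z => by
    simp only [smoothMul_apply]
    ring)

namespace GaussianRep

variable {Ω : Type*} {mΩ : MeasurableSpace Ω} {P : Measure Ω} {h : Ω → Distr D}

/-- A vector which is orthogonal to the potentials of the test functions supported in a neighbourhood
of the complement of `B` is in `Supp_B`. -/
theorem mem_suppSpace_farSet (R : GaussianRep P h) (hφ : DifferentiableOn ℂ φ D)
    (hφD : MapsTo φ D (Metric.ball 0 1)) {n : ℕ} {I : Finset ℂ} {w : VectorL2}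
    (hw : w ∈ dirichletSpace D)
    (hort : ∀ ρ : TestFn D, tsupport ρ ⊆ closeSet D φ n I → inner ℝ (R.pot ρ) w = 0) :
    w ∈ suppSpace D (farSet D φ n I) := by
  obtain ⟨θ, hθ, hθ1, hθ0, hθne⟩ := exists_cutoff n I
  have hφc : ContinuousOn φ D := hφ.continuousOn
  have hφs : ContDiffOn ℝ ((⊤ : ℕ∞) : WithTop ℕ∞) φ D :=
    (hφ.contDiffOn D.2).restrict_scalars ℝ
  have hχ : ContDiffOn ℝ ((⊤ : ℕ∞) : WithTop ℕ∞) (θ ∘ φ) D := hθ.comp_contDiffOn hφs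
  have hr := radius_pos n
  obtain ⟨C, hC⟩ := (isCompact_closedBall (0 : ℂ) 1).exists_bound_of_continuousOn
    (hθ.continuous_fderiv (by simp)).continuousOn
  have hder (z) (hz : z ∈ D) (v : ℂ) :
      |fderiv ℝ (θ ∘ φ) z v| ≤ C * ‖deriv φ z‖ * ‖v‖ := by
    have hφz : HasDerivAt φ (deriv φ z) z := (hφ.differentiableAt (D.2.mem_nhds hz)).hasDerivAt
    have h1 := ((hθ.differentiable (by simp)).differentiableAt.hasFDerivAt (x := φ z)).comp z
      (hφz.hasFDerivAt.restrictScalars ℝ)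
    rw [h1.fderiv]
    have h2 := (fderiv ℝ θ (φ z)).le_opNorm (v * deriv φ z)
    rw [norm_mul] at h2
    have h3 := hC (φ z) (Metric.ball_subset_closedBall (hφD hz))
    have h4 : |fderiv ℝ θ (φ z) (v * deriv φ z)| ≤ C * (‖v‖ * ‖deriv φ z‖) :=
      h2.trans (by gcongr)
    calc _ = |fderiv ℝ θ (φ z) (v * deriv φ z)| := by simp
      _ ≤ _ := h4
      _ = _ := by ring
  have hC0 : 0 ≤ C := (norm_nonneg _).trans (hC 0 (by simp))
  have hbound (ψ : TestFn D) := norm_gradL2_smoothMul_le hφ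
    (fun z hz => (mem_ball_zero_iff.1 (hφD hz)).le) hχ (fun z _ => hθ1 (φ z)) hder ψ
  -- A closed condition on φ(z) that holds where ψ does not vanish extends to the closure of that
  -- set inside D; it locates the supports of θρ and of ρ - θρ.
  have hclosed (s : Set ℂ) (hs : IsClosed s) (ψ : TestFn D)
      (hψ : ∀ z ∈ D, ψ z ≠ 0 → φ z ∈ s) : ∀ z ∈ tsupport ψ, φ z ∈ s := by
    intro z hz
    have hzD := ψ.tsupport_subset hz
    by_contra hzs
    have h1 : (D : Set ℂ) ∩ φ ⁻¹' sᶜ ∈ 𝓝 z :=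
      (hφc.isOpen_inter_preimage D.2 hs.isOpen_compl).mem_nhds ⟨hzD, hzs⟩
    obtain ⟨y, hy, hyψ⟩ := mem_closure_iff_nhds.1 hz _ h1
    exact hy.2 (hψ y hy.1 hyψ)
  have hsupp (ψ : TestFn D) : tsupport (smoothMul (θ ∘ φ) hχ ψ) ⊆ farSet D φ n I := by
    intro z hz
    have h1 := hclosed (⋂ c ∈ I, {w | 5 / 2 * radius n ≤ dist w c})
      (isClosed_biInter fun c _ => isClosed_le continuous_const
        (continuous_id.dist continuous_const)) _ (fun y _ hy => ?_) z hz
    · refine ⟨(smoothMul (θ ∘ φ) hχ ψ).tsupport_subset hz, fun c hc => ?_⟩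
      have h2 : 5 / 2 * radius n ≤ dist (φ z) c := mem_iInter₂.1 h1 c hc
      linarith
    · rw [smoothMul_apply] at hy
      exact mem_iInter₂.2 fun c hc => hθ0 _ (left_ne_zero_of_mul hy) c hc
  have hsupp' (ρ : TestFn D) :
      tsupport (ρ - smoothMul (θ ∘ φ) hχ ρ : TestFn D) ⊆ closeSet D φ n I := by
    intro z hz
    have h1 := hclosed (⋃ c ∈ I, {w | dist w c ≤ 11 / 4 * radius n})
      (isClosed_biUnion_finset fun c _ => isClosed_le
        (continuous_id.dist continuous_const) continuous_const) _ (fun y _ hy => ?_) z hz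
    · obtain ⟨c, hc, h2⟩ := mem_iUnion₂.1 h1
      refine ⟨(ρ - smoothMul (θ ∘ φ) hχ ρ : TestFn D).tsupport_subset hz, c, hc, ?_⟩
      have h3 : dist (φ z) c ≤ 11 / 4 * radius n := h2
      linarith
    · obtain ⟨c, hc, h2⟩ := hθne (φ y) fun h1 => hy (by
        change ρ y - smoothMul (θ ∘ φ) hχ ρ y = 0
        rw [smoothMul_apply, Function.comp_apply, h1, one_mul, sub_self])
      exact mem_iUnion₂.2 ⟨c, hc, h2⟩
  obtain ⟨ψ, -, hψ⟩ := mem_suppSpace_iff.1 hw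
  have hsub (ψ ψ' : TestFn D) :
      gradL2 ψ - gradL2 ψ' = gradL2 (ψ - ψ') := by
    simp only [← gradL2LM_apply, map_sub]
  have hmulsub (ψ ψ' : TestFn D) : smoothMul (θ ∘ φ) hχ ψ - smoothMul (θ ∘ φ) hχ ψ' =
      smoothMul (θ ∘ φ) hχ (ψ - ψ') := by
    ext z
    change smoothMul (θ ∘ φ) hχ ψ z - smoothMul (θ ∘ φ) hχ ψ' z = _
    rw [smoothMul_apply, smoothMul_apply, smoothMul_apply, ← mul_sub]
    rfl
  -- The cutoff acts boundedly for the Dirichlet norm, so the truncated approximants of w converge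
  -- as well, to an element of Supp_B.
  have hcauchy : CauchySeq fun k => gradL2 (smoothMul (θ ∘ φ) hχ (ψ k)) := by
    have h1 := hψ.cauchySeq
    rw [Metric.cauchySeq_iff] at h1 ⊢
    intro ε hε
    have hK : 0 < Real.sqrt (2 + 16 * C ^ 2) := by positivity
    obtain ⟨N, hN⟩ := h1 (ε / Real.sqrt (2 + 16 * C ^ 2)) (by positivity)
    refine ⟨N, fun k hk l hl => ?_⟩
    have h2 := hN k hk l hl
    rw [dist_eq_norm, hsub, lt_div_iff₀ hK] at h2
    rw [dist_eq_norm, hsub, hmulsub]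
    refine lt_of_le_of_lt (Real.le_sqrt_of_sq_le (hbound (ψ k - ψ l))) ?_
    rwa [Real.sqrt_mul (by positivity), Real.sqrt_sq (norm_nonneg _), mul_comm]
  obtain ⟨w', hw'⟩ := cauchySeq_tendsto_of_complete hcauchy
  have hw'B : w' ∈ suppSpace D (farSet D φ n I) := mem_suppSpace_iff.2 ⟨_, fun k => hsupp (ψ k), hw'⟩
  -- Since ρ - θρ is supported near I, its potential is orthogonal to w. So ρ may be replaced by θρ,
  -- and the cutoff moved onto the approximants of w; thus w equals its own truncation.
  have hpot (ρ : TestFn D) : inner ℝ (R.pot ρ) w = inner ℝ (R.pot ρ) w' := by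
    have h1 := hort _ (hsupp' ρ)
    rw [map_sub, inner_sub_left, sub_eq_zero] at h1
    rw [h1]
    refine tendsto_nhds_unique (tendsto_const_nhds.inner hψ) ?_
    refine (tendsto_const_nhds.inner hw' : Tendsto (fun k => inner ℝ (R.pot ρ)
      (gradL2 (smoothMul (θ ∘ φ) hχ (ψ k)))) atTop _).congr fun k => ?_
    rw [R.inner_pot, R.inner_pot, inner_smoothMul]
  have : w = w' := eq_of_inner_gradL2 hw (suppSpace_le_dirichletSpace _ hw'B) fun g => by
    rw [real_inner_comm, real_inner_comm _ w', ← R.pot_neg_lap, hpot]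
  rwa [this]

/-- Vectors which are harmonic on `B` are approximated by potentials of test functions supported in
a neighbourhood of the complement of `B`. -/
theorem harmSpace_farSet_le (R : GaussianRep P h) (hφ : DifferentiableOn ℂ φ D)
    (hφD : MapsTo φ D (Metric.ball 0 1)) (n : ℕ) (I : Finset ℂ) :
    harmSpace D (farSet D φ n I) ≤
      (Submodule.map R.pot (testFnOn D (closeSet D φ n I))).topologicalClosure := by
  intro F hF
  set S := (Submodule.map R.pot (testFnOn D (closeSet D φ n I))).topologicalClosure with hS
  have hScl : IsClosed (S : Set VectorL2) := Submodule.isClosed_topologicalClosure _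
  have : CompleteSpace S := hScl.completeSpace_coe
  have hSD : S ≤ dirichletSpace D := by
    refine Submodule.topologicalClosure_minimal _ ?_ (isClosed_suppSpace D D)
    rintro _ ⟨ρ, -, rfl⟩
    exact R.pot_mem ρ
  have hPS := Submodule.starProjection_apply_mem S F
  set w := F - S.starProjection F with hwdef
  have hwS : ∀ v ∈ S, inner ℝ v w = 0 :=
    (Submodule.mem_orthogonal S w).1 (Submodule.sub_starProjection_mem_orthogonal F)
  -- The part of F orthogonal to the potentials lies in Supp_B; F itself is orthogonal to Supp_B, so
  -- this part is orthogonal to itself.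
  have hw : w ∈ suppSpace D (farSet D φ n I) :=
    R.mem_suppSpace_farSet hφ hφD (Submodule.sub_mem _ hF.1 (hSD hPS)) fun ρ hρ =>
      hwS _ (Submodule.le_topologicalClosure _ ⟨ρ, hρ, rfl⟩)
  have h0 : inner ℝ w w = 0 := by
    nth_rw 1 [hwdef]
    rw [inner_sub_left, inner_eq_zero_of_mem_harmSpace hF hw, hwS _ hPS, sub_zero]
  rw [inner_self_eq_zero, hwdef, sub_eq_zero] at h0
  rw [h0]
  exact hPS

end GaussianRep

end Localization

/-! ### The σ-algebras generated by a random set and the field near it -/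

section NbhdSigma

variable {D : Opens ℂ} {φ : ℂ → ℂ}

theorem thickening_mono {K : ClosedSets} {δ δ' : ℝ} (hδ : δ ≤ δ') :
    thickening D φ K δ ⊆ thickening D φ K δ' := fun _ hz => ⟨hz.1, hz.2.trans hδ⟩

/-- Compactness of C turns inclusion in the interior into a countable union over uniform margins
1/(n+1). Each such inclusion is closed in K, the distance to K being continuous for the Hausdorff
metric. -/
theorem measurableSet_subset_interior_thickening {C : Set ℂ} (hC : IsCompact C) (δ : ℝ) :
    MeasurableSet {K : ClosedSets | C ⊆ interior (thickening D φ K δ)} := by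
  have h1 : {K : ClosedSets | C ⊆ interior (thickening D φ K δ)} =
      ⋃ n : ℕ, {K | Metric.cthickening (1 / (n + 1)) C ⊆ thickening D φ K δ} := by
    ext K
    simp only [mem_ofPred_eq, mem_iUnion]
    constructor
    · intro hCK
      obtain ⟨ε, hε, hεC⟩ := hC.exists_cthickening_subset_open isOpen_interior hCK
      obtain ⟨n, hn⟩ := exists_nat_one_div_lt hε
      exact ⟨n, (Metric.cthickening_mono hn.le C).trans (hεC.trans interior_subset)⟩
    · rintro ⟨n, hn⟩
      have hpos : (0 : ℝ) < 1 / (n + 1) := by positivity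
      exact (Metric.self_subset_thickening hpos C).trans (interior_maximal
        ((Metric.thickening_subset_cthickening _ _).trans hn) Metric.isOpen_thickening)
  have h2 (S : Set ℂ) : IsClosed {K : ClosedSets | S ⊆ thickening D φ K δ} := by
    have h3 : {K : ClosedSets | S ⊆ thickening D φ K δ} = {_K : ClosedSets | S ⊆ D} ∩
        ⋂ z ∈ S, {K | Metric.infDist (φ z) (K.1 : Set ℂ) ≤ δ} := by
      ext K
      simp only [mem_ofPred_eq, mem_inter_iff, mem_iInter]
      exact ⟨fun H => ⟨fun z hz => (H hz).1, fun z hz => (H hz).2⟩, fun H z hz => ⟨H.1 hz, H.2 z hz⟩⟩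
    rw [h3]
    refine IsClosed.inter isClosed_const (isClosed_biInter fun z _ => ?_)
    exact isClosed_le ((Metric.lipschitz_infDist_set _).continuous.comp continuous_subtype_val)
      continuous_const
  rw [h1]
  exact MeasurableSet.iUnion fun n => (h2 _).measurableSet

variable {Ω : Type*} {mΩ : MeasurableSpace Ω} {h : Ω → Distr D} {A : Ω → ClosedSets}

theorem comap_le_nbhdSigma (φ : ℂ → ℂ) (h : Ω → Distr D) (A : Ω → ClosedSets) (δ : ℝ) :
    MeasurableSpace.comap A inferInstance ≤ nbhdSigma φ h A δ := le_sup_left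

theorem measurableSet_subset_interior (φ : ℂ → ℂ) (A : Ω → ClosedSets) (ρ : TestFn D) (δ : ℝ) :
    MeasurableSet[MeasurableSpace.comap A inferInstance]
      {ω | tsupport ρ ⊆ interior (thickening D φ (A ω) δ)} :=
  ⟨_, measurableSet_subset_interior_thickening ρ.hasCompactSupport δ, rfl⟩

open Classical in
theorem measurable_nbhdSigma_apply (φ : ℂ → ℂ) (h : Ω → Distr D) (A : Ω → ClosedSets) (δ : ℝ)
    (ρ : TestFn D) : Measurable[nbhdSigma φ h A δ]
      (fun ω => if tsupport ρ ⊆ interior (thickening D φ (A ω) δ) then h ω ρ else 0) := by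
  refine Measurable.mono (comap_measurable _) (le_sup_of_le_right ?_)
    (BorelSpace.measurable_eq (α := ℝ)).le
  exact le_iSup (fun ρ : TestFn D => MeasurableSpace.comap
      (fun ω => if tsupport ρ ⊆ interior (thickening D φ (A ω) δ) then h ω ρ else 0) (borel ℝ)) ρ

open Classical in
theorem nbhdSigma_le_of {m : MeasurableSpace Ω} {δ : ℝ}
    (hA : MeasurableSpace.comap A inferInstance ≤ m)
    (hρ : ∀ ρ : TestFn D, Measurable[m]
      (fun ω => if tsupport ρ ⊆ interior (thickening D φ (A ω) δ) then h ω ρ else 0)) :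
    nbhdSigma φ h A δ ≤ m := by
  refine sup_le hA (iSup_le fun ρ => ?_)
  have := (hρ ρ).comap_le
  rwa [BorelSpace.measurable_eq (α := ℝ)] at this

theorem nbhdSigma_le (hh : Measurable h) (hA : Measurable A) (δ : ℝ) : nbhdSigma φ h A δ ≤ mΩ := by
  classical
  refine nbhdSigma_le_of hA.comap_le fun ρ => Measurable.ite ?_
    ((measurable_distr_apply ρ).comp hh) measurable_const
  exact hA.comap_le _ (measurableSet_subset_interior φ A ρ δ)

theorem nbhdSigma_mono {δ δ' : ℝ} (hδ : δ ≤ δ') : nbhdSigma φ h A δ ≤ nbhdSigma φ h A δ' := by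
  classical
  refine nbhdSigma_le_of (comap_le_nbhdSigma φ h A δ') fun ρ => ?_
  have h1 := (measurable_nbhdSigma_apply φ h A δ' ρ)
  have h2 : Measurable[nbhdSigma φ h A δ'] (fun ω =>
      if tsupport ρ ⊆ interior (thickening D φ (A ω) δ) then
        if tsupport ρ ⊆ interior (thickening D φ (A ω) δ') then h ω ρ else 0 else 0) :=
    Measurable.ite (comap_le_nbhdSigma φ h A δ' _ (measurableSet_subset_interior φ A ρ δ))
      h1 measurable_const
  refine Eq.mp (congrArg _ (funext fun ω => ?_)) h2
  by_cases hω : tsupport ρ ⊆ interior (thickening D φ (A ω) δ)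
  · simp only [hω, if_true, hω.trans (interior_mono (thickening_mono hδ))]
  · simp only [hω, if_false]

end NbhdSigma

/-- The sets whose trace on `s` belongs to `m`. -/
@[reducible]
def traceSpace {Ω : Type*} (m : MeasurableSpace Ω) {s : Set Ω} (hs : MeasurableSet[m] s) :
    MeasurableSpace Ω where
  MeasurableSet' G := MeasurableSet[m] (G ∩ s)
  measurableSet_empty := by
    rw [empty_inter]
    exact MeasurableSet.empty
  measurableSet_compl G hG := by
    have h1 : Gᶜ ∩ s = s \ (G ∩ s) := by
      ext ω
      simp only [mem_inter_iff, mem_compl_iff, Set.mem_sdiff]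
      tauto
    rw [h1]
    exact hs.diff hG
  measurableSet_iUnion f hf := by
    rw [iUnion_inter]
    exact MeasurableSet.iUnion hf

theorem mem_harmSpace_of_inner_eq_zero {D : Opens ℂ} {B : Set ℂ} {f : VectorL2}
    (hf : f ∈ dirichletSpace D)
    (hfB : ∀ g : TestFn D, tsupport g ⊆ B → inner ℝ f (gradL2 g) = 0) : f ∈ harmSpace D B := by
  refine ⟨hf, (Submodule.mem_orthogonal' _ _).2 fun v hv => ?_⟩
  obtain ⟨g, hg, hlim⟩ := mem_suppSpace_iff.1 hv
  refine tendsto_nhds_unique (tendsto_const_nhds.inner hlim) ?_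
  exact tendsto_const_nhds.congr fun n => (hfB _ (hg n)).symm

theorem Decouples.inter {Ω : Type*} {m m₂ mΩ : MeasurableSpace Ω} {P : Measure Ω} {s G : Set Ω}
    (H : Decouples m m₂ P s) (hG : MeasurableSet[m] G) : Decouples m m₂ P (s ∩ G) := by
  intro G' t hG' ht
  rw [inter_assoc s]
  exact H _ t (hG.inter hG') ht

/-! ### Splitting of events generated near the set -/

namespace GaussianRep

variable {D : Opens ℂ} {φ : ℂ → ℂ} {Ω : Type*} {mΩ : MeasurableSpace Ω} {P : Measure Ω}
  [IsProbabilityMeasure P] {h : Ω → Distr D} {A : Ω → ClosedSets}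

/-- Against g supported in B the potential of ρ pairs to ∫ρg = 0, so this potential is in Harm_B. -/
theorem measurable_projSigma_harmSpace (R : GaussianRep P h) {B : Set ℂ} {ρ : TestFn D}
    (hρ : Disjoint (tsupport ρ) B) :
    Measurable[projSigma P h (harmSpace D B)] (fun ω => h ω ρ) := by
  have hpot : R.pot ρ ∈ harmSpace D B := by
    refine mem_harmSpace_of_inner_eq_zero (R.pot_mem ρ) fun g hg => ?_
    rw [R.inner_pot]
    refine integral_eq_zero_of_ae (ae_of_all _ fun z => ?_)
    beta_reduce
    by_cases hz : z ∈ tsupport ρ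
    · rw [image_eq_zero_of_notMem_tsupport (f := g)
        (fun hzg => Set.disjoint_left.1 hρ hz (hg hzg)), mul_zero, Pi.zero_apply]
    · rw [image_eq_zero_of_notMem_tsupport hz, zero_mul, Pi.zero_apply]
  have hmeas : Measurable (fun ω => h ω ρ - R.mean ρ) :=
    ((measurable_distr_apply ρ).comp R.measurable).sub_const _
  have h1 := measurable_projSigma hpot hmeas
    ((R.isDirichletPairing_iff (R.pot_mem ρ) hmeas).2 (R.X_pot ρ).symm)
  have h2 := h1.add_const (R.mean ρ)
  refine Eq.mp (congrArg _ (funext fun ω => ?_)) h2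
  simp

/-- The event that the points of the net which are close to `A` are those of `I`. -/
def nearEvent (A : Ω → ClosedSets) (n : ℕ) (I : Finset ℂ) : Set Ω := {ω | nearNet n (A ω) = I}

theorem measurableSet_nearEvent (A : Ω → ClosedSets) (n : ℕ) (I : Finset ℂ) :
    MeasurableSet[MeasurableSpace.comap A inferInstance] (nearEvent A n I) :=
  ⟨_, measurableSet_nearNet_eq n I, rfl⟩

theorem nearEvent_subset_avoids (A : Ω → ClosedSets) (n : ℕ) (I : Finset ℂ) :
    nearEvent A n I ⊆ avoids φ A (farSet D φ n I) := by
  rintro ω rfl z hz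
  exact (farSet_nearNet_subset n (A ω) hz).2

/-- On the event that the near net is I, the neighbourhood A_δ misses B, so the trace of `nbhdSigma`
lies in σ(A) ⊔ σ(Harm_B projection). For events of this join, condition 2 handles the A part and
decoupling absorbs the Harm_B part. -/
theorem SplitsOn.inter_nearEvent {R : GaussianRep P h} (hA : Measurable A)
    (hφ : ContinuousOn φ D) {n : ℕ} {I : Finset ℂ}
    (H : ∀ E : Set ClosedSets, MeasurableSet E →
      R.SplitsOn (farSet D φ n I) (avoids φ A (farSet D φ n I) ∩ A ⁻¹' E))
    {δ : ℝ} (hδ : δ ≤ radius n) {G : Set Ω} (hG : MeasurableSet[nbhdSigma φ h A δ] G) :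
    R.SplitsOn (farSet D φ n I) (G ∩ nearEvent A n I) := by
  classical
  set B := farSet D φ n I with hB
  set s := nearEvent A n I with hs
  have hmΩ : projSigma P h (harmSpace D B) ≤ mΩ := projSigma_le _
  have hsA : MeasurableSet[MeasurableSpace.comap A inferInstance] s := measurableSet_nearEvent A n I
  have hm' : MeasurableSpace.comap A inferInstance ⊔ projSigma P h (harmSpace D B) ≤ mΩ := sup_le hA.comap_le hmΩ
  have hsm : MeasurableSet[MeasurableSpace.comap A inferInstance ⊔
      projSigma P h (harmSpace D B)] s :=
    (le_sup_left : _ ≤ MeasurableSpace.comap A inferInstance ⊔ projSigma P h (harmSpace D B)) _ hsA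
  have htrace : MeasurableSet[MeasurableSpace.comap A inferInstance ⊔
      projSigma P h (harmSpace D B)] (G ∩ s) := by
    refine (?_ : nbhdSigma φ h A δ ≤ traceSpace _ hsm) G hG
    refine nbhdSigma_le_of (fun G hG => ?_) fun ρ => ?_
    · exact MeasurableSet.inter ((le_sup_left : _ ≤ MeasurableSpace.comap A inferInstance ⊔ projSigma P h (harmSpace D B)) _ hG)
        hsm
    intro V hV
    change MeasurableSet[MeasurableSpace.comap A inferInstance ⊔
      projSigma P h (harmSpace D B)] (_ ∩ s)
    by_cases hρ : Disjoint (tsupport ρ) B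
    · refine MeasurableSet.inter ?_ hsm
      have h1 := (R.measurable_projSigma_harmSpace hρ).mono (le_sup_right : _ ≤
        MeasurableSpace.comap A inferInstance ⊔ projSigma P h (harmSpace D B)) le_rfl
      refine Measurable.ite ?_ h1 measurable_const hV
      exact (le_sup_left : _ ≤ MeasurableSpace.comap A inferInstance ⊔ projSigma P h (harmSpace D B)) _
        (measurableSet_subset_interior φ A ρ δ)
    -- If the support of ρ meets B it is never contained in A_δ on this event, because points of B
    -- are farther than rₙ ≥ δ from A. The generator then takes its default value 0 there.
    · obtain ⟨z, hzρ, hzB⟩ := Set.not_disjoint_iff.1 hρ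
      have hzero : ∀ ω ∈ s, ¬ tsupport ρ ⊆ interior (thickening D φ (A ω) δ) := by
        rintro ω hω hsub
        have h1 := (interior_subset (hsub hzρ)).2
        have hz : z ∈ farSet D φ n (nearNet n (A ω)) := by
          rw [show nearNet n (A ω) = I from hω]
          exact hzB
        exact (radius_lt_infDist hz).not_ge (h1.trans hδ)
      by_cases h0 : (0 : ℝ) ∈ V
      · convert hsm using 1
        refine inter_eq_right.2 fun ω hω => ?_
        simp only [mem_preimage, hzero ω hω, if_false, h0]
      · convert @MeasurableSet.empty Ω (MeasurableSpace.comap A inferInstance ⊔ projSigma P h (harmSpace D B)) using 1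
        refine eq_empty_iff_forall_notMem.2 fun ω hω => h0 ?_
        have := hω.1
        simpa only [mem_preimage, hzero ω hω.2, if_false] using this
  have key : ∀ G', MeasurableSet[MeasurableSpace.comap A inferInstance ⊔
      projSigma P h (harmSpace D B)] G' →
      R.SplitsOn B (G' ∩ s) := by
    have hbasic {E : Set ClosedSets} (hE : MeasurableSet E) {G : Set Ω} (hG : MeasurableSet[projSigma P h (harmSpace D B)] G) :
        R.SplitsOn B (A ⁻¹' E ∩ G ∩ s) := by
      have h1 : A ⁻¹' E ∩ G ∩ s =
          (avoids φ A B ∩ A ⁻¹' (E ∩ {K | nearNet n K = I})) ∩ G := by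
        ext ω
        constructor
        · rintro ⟨⟨h1, h2⟩, h3⟩
          exact ⟨⟨nearEvent_subset_avoids A n I h3, h1, h3⟩, h2⟩
        · rintro ⟨⟨-, h1, h3⟩, h2⟩
          exact ⟨⟨h1, h2⟩, h3⟩
      have h2 := H _ (hE.inter (measurableSet_nearNet_eq n I))
      have h3 : MeasurableSet (avoids φ A B ∩ A ⁻¹' (E ∩ {K | nearNet n K = I})) :=
        (measurableSet_avoids hA hφ (isOpen_farSet hφ n I) (farSet_subset n I)).inter
          (hA (hE.inter (measurableSet_nearNet_eq n I)))
      rw [h1, splitsOn_iff_decouples (h3.inter (hmΩ _ hG))]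
      exact ((splitsOn_iff_decouples h3).1 h2).inter hG
    have hS : R.SplitsOn B s := by
      simpa using hbasic MeasurableSet.univ (@MeasurableSet.univ Ω (projSigma P h (harmSpace D B)))
    intro G' hG'
    induction G', hG' using MeasurableSpace.induction_on_inter
        (sup_eq_generateFrom_inter _ _) (isPiSystem_inter _ _) with
    | empty =>
      rw [empty_inter, ← Set.sdiff_self (s := univ)]
      exact (R.splitsOn_univ B).diff (R.splitsOn_univ B) MeasurableSet.univ subset_rfl
    | basic t ht =>
      obtain ⟨_, G, ⟨E, hE, rfl⟩, hG, rfl⟩ := ht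
      exact hbasic hE hG
    | compl t ht ih =>
      have h1 : tᶜ ∩ s = s \ (t ∩ s) := by
        ext ω
        simp only [mem_inter_iff, mem_compl_iff, Set.mem_sdiff]
        tauto
      rw [h1]
      exact hS.diff ih ((hm' _ ht).inter (hm' _ hsm)) inter_subset_right
    | iUnion f hd hf ih =>
      rw [iUnion_inter]
      exact SplitsOn.iUnion ih (fun k => (hm' _ (hf k)).inter (hm' _ hsm))
        fun i j hij => (hd hij).mono inter_subset_left inter_subset_left
  have := key _ htrace
  rwa [inter_assoc, inter_self] at this

end GaussianRep

/-! ### The conditional mean of the field given a neighbourhood of the random set -/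

theorem integral_eq_of_partition {Ω ι E : Type*} [NormedAddCommGroup E] [NormedSpace ℝ E]
    {mΩ : MeasurableSpace Ω} {P : Measure Ω} {N : Ω → ι} {S : Finset ι} (hN : ∀ ω, N ω ∈ S)
    (hm : ∀ i, MeasurableSet (N ⁻¹' {i})) {f g : Ω → E} (hf : Integrable f P) (hg : Integrable g P)
    (H : ∀ i, ∫ ω in N ⁻¹' {i}, f ω ∂P = ∫ ω in N ⁻¹' {i}, g ω ∂P) :
    ∫ ω, f ω ∂P = ∫ ω, g ω ∂P := by
  have hU : (⋃ i ∈ S, N ⁻¹' {i}) = univ := eq_univ_of_forall fun ω => mem_iUnion₂.2 ⟨N ω, hN ω, rfl⟩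
  have hd : (S : Set ι).Pairwise (Function.onFun Disjoint fun i => N ⁻¹' {i}) := fun i _ j _ hij =>
    Disjoint.preimage N (disjoint_singleton.2 hij)
  rw [← setIntegral_univ, ← setIntegral_univ (f := g), ← hU,
    integral_biUnion_finset S (fun i _ => hm i) hd fun i _ => hf.integrableOn,
    integral_biUnion_finset S (fun i _ => hm i) hd fun i _ => hg.integrableOn]
  exact Finset.sum_congr rfl fun i _ => H i

/-- Multiplication of a square integrable function by an indicator function. -/
def restrictLp {Ω : Type*} {mΩ : MeasurableSpace Ω} (P : Measure Ω) {s : Set Ω}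
    (hs : MeasurableSet s) : Lp ℝ 2 P →L[ℝ] Lp ℝ 2 P :=
  LinearMap.mkContinuous
    { toFun := fun Y => ((Lp.memLp Y).indicator hs).toLp (s.indicator Y)
      map_add' := fun Y Z => by
        rw [← MemLp.toLp_add]
        refine MemLp.toLp_congr _ _ ?_
        filter_upwards [Lp.coeFn_add Y Z] with ω hω
        by_cases h : ω ∈ s
        · rw [Pi.add_apply, indicator_of_mem h, indicator_of_mem h, indicator_of_mem h, hω, Pi.add_apply]
        · rw [Pi.add_apply, indicator_of_notMem h, indicator_of_notMem h, indicator_of_notMem h,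
            add_zero]
      map_smul' := fun c Y => by
        rw [RingHom.id_apply, ← MemLp.toLp_const_smul]
        refine MemLp.toLp_congr _ _ ?_
        filter_upwards [Lp.coeFn_smul c Y] with ω hω
        by_cases h : ω ∈ s
        · rw [Pi.smul_apply, indicator_of_mem h, indicator_of_mem h, hω, Pi.smul_apply]
        · rw [Pi.smul_apply, indicator_of_notMem h, indicator_of_notMem h, smul_zero] }
    1 fun Y => by
      rw [one_mul, LinearMap.coe_mk, AddHom.coe_mk, Lp.norm_toLp, Lp.norm_def]
      exact ENNReal.toReal_mono (Lp.eLpNorm_ne_top _) (eLpNorm_indicator_le _)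

theorem restrictLp_apply {Ω : Type*} {mΩ : MeasurableSpace Ω} {P : Measure Ω} {s : Set Ω}
    (hs : MeasurableSet s) (Y : Lp ℝ 2 P) :
    restrictLp P hs Y = ((Lp.memLp Y).indicator hs).toLp (s.indicator Y) := rfl

theorem coeFn_restrictLp {Ω : Type*} {mΩ : MeasurableSpace Ω} {P : Measure Ω} {s : Set Ω}
    (hs : MeasurableSet s) (Y : Lp ℝ 2 P) : restrictLp P hs Y =ᵐ[P] s.indicator Y := by
  rw [restrictLp_apply]
  exact MemLp.coeFn_toLp _

theorem measurable_comp_nearNet {β : Type*} [MeasurableSpace β] (n : ℕ) (c : Finset ℂ → β) :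
    Measurable fun K : ClosedSets => c (nearNet n K) := by
  classical
  intro V hV
  have h1 : (fun K : ClosedSets => c (nearNet n K)) ⁻¹' V =
      ⋃ I ∈ (net n).powerset.filter fun I => c I ∈ V, {K | nearNet n K = I} := by
    ext K
    simp only [mem_preimage, mem_iUnion, Finset.mem_filter, mem_ofPred_eq, exists_prop]
    exact ⟨fun hK => ⟨_, ⟨nearNet_mem_powerset n K, hK⟩, rfl⟩, fun ⟨I, hI, hIK⟩ => hIK ▸ hI.2⟩
  rw [h1]
  exact Finset.measurableSet_biUnion _ fun I _ => measurableSet_nearNet_eq n I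

/-- The variance that is left outside of a neighbourhood of `K`. -/
def farVar (D : Opens ℂ) (φ : ℂ → ℂ) (n : ℕ) (F : VectorL2) (K : ClosedSets) : ℝ :=
  ‖suppProj D (farSet D φ n (nearNet n K)) F‖ ^ 2

/-- The variance that is left outside of `K`. -/
def offVar (D : Opens ℂ) (φ : ℂ → ℂ) (F : VectorL2) (K : ClosedSets) : ℝ :=
  ‖suppProj D (offSet D φ K) F‖ ^ 2

section Variance

variable {D : Opens ℂ} {φ : ℂ → ℂ}

theorem measurable_farVar (n : ℕ) (F : VectorL2) : Measurable (farVar D φ n F) :=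
  measurable_comp_nearNet n fun I => ‖suppProj D (farSet D φ n I) F‖ ^ 2

theorem tendsto_farVar (hφ : ContinuousOn φ D) (F : VectorL2) (K : ClosedSets) :
    Tendsto (fun n => farVar D φ n F K) atTop (𝓝 (offVar D φ F K)) :=
  (tendsto_suppProj_farSet hφ K F).norm.pow 2

theorem measurable_offVar (hφ : ContinuousOn φ D) (F : VectorL2) : Measurable (offVar D φ F) :=
  measurable_of_tendsto_metrizable (fun n => measurable_farVar n F)
    (tendsto_pi_nhds.2 fun K => tendsto_farVar hφ F K)

theorem farVar_nonneg (n : ℕ) (F : VectorL2) (K : ClosedSets) : 0 ≤ farVar D φ n F K := by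
  unfold farVar
  positivity

theorem farVar_le (n : ℕ) (F : VectorL2) (K : ClosedSets) : farVar D φ n F K ≤ ‖F‖ ^ 2 :=
  pow_le_pow_left₀ (norm_nonneg _) (norm_suppProj_le _ F) 2

end Variance

namespace GaussianRep

variable {D : Opens ℂ} {φ : ℂ → ℂ} {Ω : Type*} {mΩ : MeasurableSpace Ω} {P : Measure Ω}
  [IsProbabilityMeasure P] {h : Ω → Distr D} {A : Ω → ClosedSets}

/-- For g ∈ Supp_B the variable `X g` is independent of s and keeps its variance on s. -/
theorem SplitsOn.setIntegral_sq {R : GaussianRep P h} {B : Set ℂ} {s : Set Ω}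
    (hs : MeasurableSet s) (H : R.SplitsOn B s) {g : VectorL2} (hg : g ∈ suppSpace D B) :
    ∫ ω in s, R.X g ω ^ 2 ∂P = P.real s * ‖g‖ ^ 2 := by
  have hgD := suppSpace_le_dirichletSpace B hg
  have hmeas : Measurable[projSigma P h (suppSpace D B)] (R.X g) :=
    measurable_projSigma hg (R.measurable_X g)
      ((R.isDirichletPairing_iff hgD (R.measurable_X g)).2 (ae_eq_refl _))
  have h1 : (P.restrict s).map (R.X g) = P s • P.map (R.X g) := by
    ext V hV
    rw [Measure.map_apply (R.measurable_X g) hV, Measure.restrict_apply (R.measurable_X g hV),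
      Measure.smul_apply, Measure.map_apply (R.measurable_X g) hV, smul_eq_mul, inter_comm]
    have h2 := H.decouples hs univ _ MeasurableSet.univ (hmeas hV)
    rw [inter_univ, measureReal_def, measureReal_def, measureReal_def, ← ENNReal.toReal_mul] at h2
    exact (ENNReal.toReal_eq_toReal_iff' (measure_ne_top _ _)
      (ENNReal.mul_ne_top (measure_ne_top _ _) (measure_ne_top _ _))).1 h2
  have h3 : ∫ ω, R.X g ω ^ 2 ∂P = ‖g‖ ^ 2 := by
    rw [← R.norm_X hgD, ← real_inner_self_eq_norm_sq, MeasureTheory.L2.inner_def]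
    refine integral_congr_ae (ae_of_all _ fun ω => ?_)
    simp
  have hsq : AEStronglyMeasurable (fun x : ℝ => x ^ 2) ((P.restrict s).map (R.X g)) := by fun_prop
  have hsq' : AEStronglyMeasurable (fun x : ℝ => x ^ 2) (P.map (R.X g)) := by fun_prop
  rw [← integral_map (f := fun x : ℝ => x ^ 2) (R.measurable_X g).aemeasurable hsq, h1,
    integral_smul_measure, integral_map (R.measurable_X g).aemeasurable hsq', h3, smul_eq_mul,
    measureReal_def]

theorem measurableSet_nearEvent' (hA : Measurable A) (n : ℕ) (I : Finset ℂ) :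
    MeasurableSet (nearEvent A n I) := hA.comap_le _ (measurableSet_nearEvent A n I)

/-- The conditional expectation of the field given its restriction to a neighbourhood of the
random set. -/
def approx (R : GaussianRep P h) (φ : ℂ → ℂ) (hA : Measurable A) (n : ℕ) :
    VectorL2 →L[ℝ] Lp ℝ 2 P :=
  (∑ I ∈ (net n).powerset, restrictLp P (measurableSet_nearEvent' hA n I) ∘L R.X ∘L
    (ContinuousLinearMap.id ℝ VectorL2 - suppProj D (farSet D φ n I))) ∘L suppProj D D

theorem approx_apply (R : GaussianRep P h) (hA : Measurable A) (n : ℕ) {F : VectorL2}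
    (hF : F ∈ dirichletSpace D) : R.approx φ hA n F = ∑ I ∈ (net n).powerset,
      restrictLp P (measurableSet_nearEvent' hA n I)
        (R.X (F - suppProj D (farSet D φ n I) F)) := by
  simp only [approx, ContinuousLinearMap.comp_apply, suppProj_eq_self hF,
    _root_.sum_apply, _root_.sub_apply, ContinuousLinearMap.id_apply]

theorem approx_ae_eq (R : GaussianRep P h) (hA : Measurable A) (n : ℕ) {F : VectorL2}
    (hF : F ∈ dirichletSpace D) : ∀ᵐ ω ∂P, R.approx φ hA n F ω =
      R.X (F - suppProj D (farSet D φ n (nearNet n (A ω))) F) ω := by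
  classical
  have h2 (S : Finset (Finset ℂ)) : ∀ᵐ ω ∂P, (∑ I ∈ S,
      restrictLp P (measurableSet_nearEvent' hA n I)
        (R.X (F - suppProj D (farSet D φ n I) F)) : Lp ℝ 2 P) ω =
      if nearNet n (A ω) ∈ S then R.X (F - suppProj D (farSet D φ n (nearNet n (A ω))) F) ω
      else 0 := by
    induction S using Finset.induction_on with
    | empty =>
      filter_upwards [Lp.coeFn_zero ℝ 2 P] with ω hω
      simp only [Finset.sum_empty, Finset.notMem_empty, if_false, hω, Pi.zero_apply]
    | insert I S hI ih =>
      rw [Finset.sum_insert hI]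
      filter_upwards [ih, Lp.coeFn_add (restrictLp P (measurableSet_nearEvent' hA n I)
        (R.X (F - suppProj D (farSet D φ n I) F))) (∑ I ∈ S,
        restrictLp P (measurableSet_nearEvent' hA n I)
        (R.X (F - suppProj D (farSet D φ n I) F))), coeFn_restrictLp
        (measurableSet_nearEvent' hA n I) (R.X (F - suppProj D (farSet D φ n I) F))] with ω e1 e2 e3
      rw [e2, Pi.add_apply, e1, e3]
      by_cases hω : nearNet n (A ω) = I
      · have hω' : ω ∈ nearEvent A n I := hω
        rw [indicator_of_mem hω', hω, if_neg hI, if_pos (Finset.mem_insert_self _ _), add_zero]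
      · have hω' : ω ∉ nearEvent A n I := hω
        rw [indicator_of_notMem hω', zero_add]
        exact (if_congr (Finset.mem_insert.trans (or_iff_right hω)) rfl rfl).symm
  rw [R.approx_apply hA n hF]
  filter_upwards [h2 (net n).powerset] with ω hω
  rw [hω, if_pos (nearNet_mem_powerset n (A ω))]

/-- The integral is cut according to the finitely many values I of the near net. On each piece F is
decomposed into its Harm_B and Supp_B parts; the former is `approx`, the latter contributes its full
Gaussian factor. -/
theorem setIntegral_cis_eq_approx (R : GaussianRep P h) (hA : Measurable A)
    (hφ : ContinuousOn φ D) (H : PairCondIndep φ P h A) {n : ℕ} {δ : ℝ} (hδ : δ ≤ radius n)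
    {G : Set Ω} (hG : MeasurableSet[nbhdSigma φ h A δ] G) {F : VectorL2}
    (hF : F ∈ dirichletSpace D) :
    ∫ ω in G, cis (R.X F ω) ∂P =
      ∫ ω in G, cis (R.approx φ hA n F ω) * Complex.exp (-(farVar D φ n F (A ω) / 2 : ℝ)) ∂P := by
  have hGm : MeasurableSet G := nbhdSigma_le R.measurable hA δ _ hG
  have hexp (v : ℝ) (hv : 0 ≤ v) : ‖Complex.exp (-(v / 2 : ℝ))‖ ≤ 1 := by
    rw [← Complex.ofReal_neg, Complex.norm_exp_ofReal, Real.exp_le_one_iff]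
    linarith
  have hm1 : Measurable fun ω => Complex.exp (-(farVar D φ n F (A ω) / 2 : ℝ)) := by
    have := (measurable_farVar (D := D) (φ := φ) n F).comp hA
    fun_prop
  have hint : Integrable (fun ω => cis (R.approx φ hA n F ω) *
      Complex.exp (-(farVar D φ n F (A ω) / 2 : ℝ))) P := by
    refine Integrable.of_bound (C := 1) ?_ (ae_of_all _ fun ω => ?_)
    · exact ((measurable_cis.comp (Lp.stronglyMeasurable _).measurable).mul
        hm1).aestronglyMeasurable
    · rw [norm_mul, norm_cis, one_mul]
      exact hexp _ (farVar_nonneg _ _ _)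
  refine integral_eq_of_partition (N := fun ω => nearNet n (A ω))
    (fun ω => nearNet_mem_powerset n (A ω)) (fun I => measurableSet_nearEvent' hA n I)
    (R.integrable_cis_X F).restrict hint.restrict fun I => ?_
  rw [show (fun ω => nearNet n (A ω)) ⁻¹' {I} = nearEvent A n I from rfl,
    Measure.restrict_restrict (measurableSet_nearEvent' hA n I)]
  set B := farSet D φ n I with hB
  have hS : R.SplitsOn B (G ∩ nearEvent A n I) :=
    SplitsOn.inter_nearEvent hA hφ ((R.pairCondIndep_iff hA hφ).1 H _ (isOpen_farSet hφ n I)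
      (farSet_subset n I)) hδ hG
  have h1 := hS _ (sub_suppProj_mem_harmSpace (B := B) hF).1 _ (suppProj_mem B F)
  rw [sub_add_cancel, inner_eq_zero_of_mem_harmSpace (sub_suppProj_mem_harmSpace hF)
    (suppProj_mem B F), zero_add, inter_comm] at h1
  rw [h1, ← integral_mul_const]
  refine setIntegral_congr_ae ((measurableSet_nearEvent' hA n I).inter hGm) ?_
  filter_upwards [R.approx_ae_eq (φ := φ) hA n hF] with ω hω hωI
  have hωI' : nearNet n (A ω) = I := hωI.1
  rw [hω, farVar, hωI']

/-- Where the near nets at the two scales are I and J, the difference is `X` of P_{B'}F - P_B F,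
with B ⊆ B' the corresponding far sets. This vector is in Supp_{B'}, so its second moment is not
affected by the event, and Pythagoras gives the difference of the variances. -/
theorem norm_approx_sub_sq (R : GaussianRep P h) (hA : Measurable A) (hφ : ContinuousOn φ D)
    (H : PairCondIndep φ P h A) {n m : ℕ} (hnm : n ≤ m) {F : VectorL2}
    (hF : F ∈ dirichletSpace D) : ‖R.approx φ hA n F - R.approx φ hA m F‖ ^ 2 =
      (∫ ω, farVar D φ m F (A ω) ∂P) - ∫ ω, farVar D φ n F (A ω) ∂P := by
  have hvar (n : ℕ) : Integrable (fun ω => farVar D φ n F (A ω)) P :=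
    Integrable.of_bound ((measurable_farVar n F).comp hA).aestronglyMeasurable (‖F‖ ^ 2)
      (ae_of_all _ fun ω => by
        rw [Real.norm_of_nonneg (farVar_nonneg _ _ _)]
        exact farVar_le _ _ _)
  set Y := R.approx φ hA n F - R.approx φ hA m F with hY
  have hYint : Integrable (fun ω => Y ω ^ 2) P := (Lp.memLp Y).integrable_sq
  have h1 : ‖Y‖ ^ 2 = ∫ ω, Y ω ^ 2 ∂P := by
    rw [← real_inner_self_eq_norm_sq, MeasureTheory.L2.inner_def]
    refine integral_congr_ae (ae_of_all _ fun ω => ?_)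
    simp
  rw [h1, ← integral_sub (hvar m) (hvar n)]
  have hpre (p : Finset ℂ × Finset ℂ) : (fun ω => (nearNet n (A ω), nearNet m (A ω))) ⁻¹' {p} =
      nearEvent A n p.1 ∩ nearEvent A m p.2 := by
    ext ω
    simp [nearEvent, Prod.ext_iff]
  have hpm (p : Finset ℂ × Finset ℂ) : MeasurableSet (nearEvent A n p.1 ∩ nearEvent A m p.2) :=
    (measurableSet_nearEvent' hA n p.1).inter (measurableSet_nearEvent' hA m p.2)
  refine integral_eq_of_partition (N := fun ω => (nearNet n (A ω), nearNet m (A ω)))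
    (S := (net n).powerset ×ˢ (net m).powerset)
    (fun ω => Finset.mk_mem_product (nearNet_mem_powerset n _) (nearNet_mem_powerset m _))
    (fun p => (hpre p).symm ▸ hpm p) hYint ((hvar m).sub (hvar n)) fun p => ?_
  rw [hpre]
  obtain ⟨I, J⟩ := p
  -- The inclusion of the far sets is known only for nets coming from the same closed set, so a
  -- point of the event is needed.
  obtain hemp | ⟨ω₀, hω₀I, hω₀J⟩ := (nearEvent A n I ∩ nearEvent A m J).eq_empty_or_nonempty
  · simp [hemp]
  have hω₀I' : nearNet n (A ω₀) = I := hω₀I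
  have hω₀J' : nearNet m (A ω₀) = J := hω₀J
  have hsub : farSet D φ n I ⊆ farSet D φ m J := by
    rw [← hω₀I', ← hω₀J']
    exact monotone_farSet (A ω₀) hnm
  have hS : R.SplitsOn (farSet D φ m J) (nearEvent A n I ∩ nearEvent A m J) :=
    SplitsOn.inter_nearEvent hA hφ ((R.pairCondIndep_iff hA hφ).1 H _ (isOpen_farSet hφ m J)
      (farSet_subset m J)) le_rfl (comap_le_nbhdSigma φ h A _ _ (measurableSet_nearEvent A n I))
  have hg : suppProj D (farSet D φ m J) F - suppProj D (farSet D φ n I) F ∈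
      suppSpace D (farSet D φ m J) :=
    Submodule.sub_mem _ (suppProj_mem _ _) (suppSpace_mono hsub (suppProj_mem _ _))
  have h2 := hS.setIntegral_sq (hpm (I, J)) hg
  rw [norm_suppProj_sub_sq hsub] at h2
  have h3 : ∫ ω in nearEvent A n I ∩ nearEvent A m J, Y ω ^ 2 ∂P =
      ∫ ω in nearEvent A n I ∩ nearEvent A m J,
        R.X (suppProj D (farSet D φ m J) F - suppProj D (farSet D φ n I) F) ω ^ 2 ∂P := by
    refine setIntegral_congr_ae (hpm (I, J)) ?_
    have e0 : suppProj D (farSet D φ m J) F - suppProj D (farSet D φ n I) F =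
        (F - suppProj D (farSet D φ n I) F) - (F - suppProj D (farSet D φ m J) F) := by abel
    rw [e0, map_sub]
    filter_upwards [R.approx_ae_eq (φ := φ) hA n hF, R.approx_ae_eq (φ := φ) hA m hF,
      Lp.coeFn_sub (R.approx φ hA n F) (R.approx φ hA m F),
      Lp.coeFn_sub (R.X (F - suppProj D (farSet D φ n I) F))
        (R.X (F - suppProj D (farSet D φ m J) F))] with ω e1 e2 e3 e4 hω
    have hωI : nearNet n (A ω) = I := hω.1
    have hωJ : nearNet m (A ω) = J := hω.2
    rw [hY, e3, e4, Pi.sub_apply, Pi.sub_apply, e1, e2, hωI, hωJ]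
  have h4 : ∫ ω in nearEvent A n I ∩ nearEvent A m J,
        (farVar D φ m F (A ω) - farVar D φ n F (A ω)) ∂P =
      ∫ ω in nearEvent A n I ∩ nearEvent A m J,
        (‖suppProj D (farSet D φ m J) F‖ ^ 2 - ‖suppProj D (farSet D φ n I) F‖ ^ 2) ∂P := by
    refine setIntegral_congr_fun (hpm (I, J)) fun ω hω => ?_
    have hωI : nearNet n (A ω) = I := hω.1
    have hωJ : nearNet m (A ω) = J := hω.2
    simp only [farVar, hωI, hωJ]
  refine h3.trans (h2.trans (Eq.trans ?_ h4.symm))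
  rw [setIntegral_const, smul_eq_mul]

theorem exists_tendsto_approx (R : GaussianRep P h) (hA : Measurable A) (hφ : ContinuousOn φ D)
    (H : PairCondIndep φ P h A) :
    ∃ M : VectorL2 →ₗ[ℝ] Lp ℝ 2 P, ∀ F, Tendsto (fun n => R.approx φ hA n F) atTop (𝓝 (M F)) := by
  have hD (F : VectorL2) : suppProj D D F ∈ dirichletSpace D := suppProj_mem _ F
  have hproj (n : ℕ) (F : VectorL2) : R.approx φ hA n F = R.approx φ hA n (suppProj D D F) := by
    simp only [approx, ContinuousLinearMap.comp_apply, suppProj_eq_self (hD F)]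
  have hlim (F : VectorL2) : ∃ Y, Tendsto (fun n => R.approx φ hA n F) atTop (𝓝 Y) := by
    simp only [hproj _ F]
    generalize hF' : suppProj D D F = F'
    have hF : F' ∈ dirichletSpace D := hF' ▸ hD F
    refine cauchySeq_tendsto_of_complete ?_
    -- The mean variances are bounded and converge; their Cauchy property is transferred to the
    -- approximations by `norm_approx_sub_sq`.
    have hv : Tendsto (fun n => ∫ ω, farVar D φ n F' (A ω) ∂P) atTop
        (𝓝 (∫ ω, offVar D φ F' (A ω) ∂P)) := by
      refine tendsto_integral_of_dominated_convergence (fun _ => ‖F'‖ ^ 2)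
        (fun n => ((measurable_farVar n F').comp hA).aestronglyMeasurable) (integrable_const _)
        (fun n => ae_of_all _ fun ω => ?_) (ae_of_all _ fun ω => tendsto_farVar hφ F' (A ω))
      rw [Real.norm_of_nonneg (farVar_nonneg _ _ _)]
      exact farVar_le _ _ _
    rw [Metric.cauchySeq_iff']
    intro ε hε
    obtain ⟨N, hN⟩ := Metric.cauchySeq_iff'.1 hv.cauchySeq (ε ^ 2) (by positivity)
    refine ⟨N, fun n hn => ?_⟩
    have h1 := R.norm_approx_sub_sq hA hφ H hn hF
    have h2 := hN n hn
    rw [Real.dist_eq] at h2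
    rw [dist_comm, dist_eq_norm]
    exact lt_of_pow_lt_pow_left₀ 2 hε.le (h1.trans_lt ((le_abs_self _).trans_lt h2))
  choose M hM using hlim
  exact ⟨linearMapOfTendsto M (fun n => (R.approx φ hA n).toLinearMap) (tendsto_pi_nhds.2 hM), hM⟩

end GaussianRep

/-! ### The conditional mean of the field given the germ of the random set -/

/-- Versions measurable at the different levels may differ on null sets. Their limsup does not
depend on any initial segment, hence is measurable at all levels at once. -/
theorem aestronglyMeasurable_iInf {Ω : Type*} {m : ℕ → MeasurableSpace Ω} {mΩ : MeasurableSpace Ω}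
    {P : Measure Ω} (hm : Antitone m) {f : Ω → ℝ} (hf : ∀ k, AEStronglyMeasurable[m k] f P) :
    AEStronglyMeasurable[⨅ k, m k] f P := by
  choose g hg hfg using hf
  have hmeas (k : ℕ) : Measurable[m k] fun ω => limsup (fun j => g j ω) atTop := by
    have h1 : (fun ω => limsup (fun j => g j ω) atTop) =
        fun ω => limsup (fun j => g (j + k) ω) atTop :=
      funext fun ω => (Filter.limsup_nat_add (fun j => g j ω) k).symm
    rw [h1]
    refine Measurable.limsup fun j => ?_
    exact
      (hg (j + k)).measurable.mono (hm (Nat.le_add_left k j)) le_rfl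
  have hmeas' : Measurable[⨅ k, m k] fun ω => limsup (fun j => g j ω) atTop := fun V hV =>
    MeasurableSpace.measurableSet_iInf.2 fun k => hmeas k hV
  refine ⟨_, hmeas'.stronglyMeasurable, ?_⟩
  filter_upwards [ae_all_iff.2 hfg] with ω hω
  simp only [← hω, limsup_const]

section GermSigma

variable {D : Opens ℂ} {φ : ℂ → ℂ} {Ω : Type*} {mΩ : MeasurableSpace Ω} {h : Ω → Distr D}
  {A : Ω → ClosedSets}

theorem germSigma_le_nbhdSigma {δ : ℝ} (hδ : 0 < δ) : germSigma φ h A ≤ nbhdSigma φ h A δ := by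
  obtain ⟨q, hq0, hqδ⟩ := exists_rat_btwn hδ
  exact (iInf_le _ (⟨q, by exact_mod_cast hq0⟩ : {q : ℚ // 0 < q})).trans (nbhdSigma_mono hqδ.le)

theorem iInf_radius_le_germSigma :
    ⨅ n, nbhdSigma φ h A (radius n) ≤ germSigma φ h A := by
  refine le_iInf fun q => ?_
  have hq : (0 : ℝ) < q.1 := by exact_mod_cast q.2
  obtain ⟨n, hn⟩ := (tendsto_radius.eventually (gt_mem_nhds hq)).exists
  exact (iInf_le _ n).trans (nbhdSigma_mono hn.le)

theorem comap_le_germSigma : MeasurableSpace.comap A inferInstance ≤ germSigma φ h A :=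
  le_iInf fun _ => comap_le_nbhdSigma φ h A _

theorem germSigma_le (hh : Measurable h) (hA : Measurable A) : germSigma φ h A ≤ mΩ :=
  (germSigma_le_nbhdSigma one_pos).trans (nbhdSigma_le hh hA 1)

end GermSigma

namespace GaussianRep

variable {D : Opens ℂ} {φ : ℂ → ℂ} {Ω : Type*} {mΩ : MeasurableSpace Ω} {P : Measure Ω}
  [IsProbabilityMeasure P] {h : Ω → Distr D} {A : Ω → ClosedSets}

/-- By `harmSpace_farSet_le` it suffices to treat potentials of ρ supported in `closeSet`. On the
event where the near net is I, this set lies in the interior of A_δ, so (h, ρ) is one of the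
generators of `nbhdSigma`. -/
theorem aestronglyMeasurable_approx (R : GaussianRep P h) (hA : Measurable A)
    (hφ : DifferentiableOn ℂ φ D) (hφD : MapsTo φ D (Metric.ball 0 1)) {n : ℕ} {δ : ℝ}
    (hδ : 4 * radius n ≤ δ) {F : VectorL2} (hF : F ∈ dirichletSpace D) :
    AEStronglyMeasurable[nbhdSigma φ h A δ] (R.approx φ hA n F) P := by
  classical
  have hle : nbhdSigma φ h A δ ≤ mΩ := nbhdSigma_le R.measurable hA δ
  have key (I : Finset ℂ) : AEStronglyMeasurable[nbhdSigma φ h A δ]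
      (restrictLp P (measurableSet_nearEvent' hA n I)
        (R.X (F - suppProj D (farSet D φ n I) F))) P := by
    have hcl : IsClosed {G : VectorL2 | AEStronglyMeasurable[nbhdSigma φ h A δ]
        (restrictLp P (measurableSet_nearEvent' hA n I) (R.X G)) P} :=
      (isClosed_aestronglyMeasurable (F := ℝ) (p := 2) (μ := P) hle).preimage
        ((restrictLp P (measurableSet_nearEvent' hA n I)).continuous.comp R.X.continuous)
    refine closure_minimal ?_ hcl
      (R.harmSpace_farSet_le hφ hφD n I (sub_suppProj_mem_harmSpace hF))
    rintro _ ⟨ρ, hρ, rfl⟩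
    have hs : MeasurableSet[nbhdSigma φ h A δ] (nearEvent A n I) :=
      comap_le_nbhdSigma φ h A δ _ (measurableSet_nearEvent A n I)
    have h1 := ((measurable_nbhdSigma_apply φ h A δ ρ).sub_const (R.mean ρ)).indicator hs
    refine AEStronglyMeasurable.congr h1.stronglyMeasurable.aestronglyMeasurable ?_
    filter_upwards [coeFn_restrictLp (measurableSet_nearEvent' hA n I) (R.X (R.pot ρ)),
      R.X_pot ρ] with ω e1 e2
    refine Eq.trans ?_ e1.symm
    by_cases hω : ω ∈ nearEvent A n I
    · have hsub : tsupport ρ ⊆ interior (thickening D φ (A ω) δ) := by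
        have hω' : nearNet n (A ω) = I := hω
        refine Subset.trans ?_ (closeSet_subset_interior hφ.continuousOn (A ω) hδ)
        rw [hω']
        exact hρ
      rw [indicator_of_mem hω, indicator_of_mem hω, e2, if_pos hsub]
    · rw [indicator_of_notMem hω, indicator_of_notMem hω]
  rw [R.approx_apply hA n hF]
  refine Finset.sum_induction _ (fun Y : Lp ℝ 2 P => AEStronglyMeasurable[nbhdSigma φ h A δ] Y P)
    (fun Y Z hY hZ => (hY.add hZ).congr (Lp.coeFn_add Y Z).symm) ?_ fun I _ => key I
  exact stronglyMeasurable_zero.aestronglyMeasurable.congr (Lp.coeFn_zero ℝ 2 P).symm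

/-- `M` is the L² limit of the approximations. The second clause identifies the characteristic
function given 𝒜; the third will make h₁ harmonic off A. -/
theorem exists_condMean (R : GaussianRep P h) (hA : Measurable A) (hφ : DifferentiableOn ℂ φ D)
    (hφD : MapsTo φ D (Metric.ball 0 1)) (H : PairCondIndep φ P h A) :
    ∃ M : VectorL2 →ₗ[ℝ] Lp ℝ 2 P,
      (∀ F ∈ dirichletSpace D, AEStronglyMeasurable[germSigma φ h A] (M F) P) ∧
      (∀ F ∈ dirichletSpace D, ∀ G, MeasurableSet[germSigma φ h A] G →
        ∫ ω in G, cis (R.X F ω) ∂P =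
          ∫ ω in G, cis (M F ω) * Complex.exp (-(offVar D φ F (A ω) / 2 : ℝ)) ∂P) ∧
      ∀ g : TestFn D, ∀ᵐ ω ∂P, tsupport g ⊆ offSet D φ (A ω) → M (gradL2 g) ω = 0 := by
  have hφc := hφ.continuousOn
  obtain ⟨M, hM⟩ := R.exists_tendsto_approx hA hφc H
  have hsub (F : VectorL2) : ∃ ns : ℕ → ℕ, StrictMono ns ∧
      ∀ᵐ ω ∂P, Tendsto (fun k => R.approx φ hA (ns k) F ω) atTop (𝓝 (M F ω)) :=
    (tendstoInMeasure_of_tendsto_Lp (hM F)).exists_seq_tendsto_ae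
  refine ⟨M, fun F hF => ?_, fun F hF G hG => ?_, fun g => ?_⟩
  · have h1 : AEStronglyMeasurable[⨅ n, nbhdSigma φ h A (radius n)] (M F) P := by
      refine aestronglyMeasurable_iInf (fun i j hij => nbhdSigma_mono (radius_anti hij)) fun k => ?_
      refine (isClosed_aestronglyMeasurable (F := ℝ) (p := 2) (μ := P)
        (nbhdSigma_le R.measurable hA (radius k))).mem_of_tendsto (hM F) ?_
      -- From scale k + 1 on, 4rₙ ≤ r_k, so the approximation is measurable for the neighbourhood of
      -- size r_k.
      filter_upwards [eventually_ge_atTop (k + 1)] with n hn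
      refine R.aestronglyMeasurable_approx hA hφ hφD ?_ hF
      rw [radius_succ k]
      linarith [radius_anti hn]
    exact h1.mono iInf_radius_le_germSigma
  · obtain ⟨ns, hns, hlim⟩ := hsub F
    have hc : Continuous fun v : ℝ => Complex.exp (-(v / 2 : ℝ)) := by fun_prop
    have h1 : Tendsto (fun k => ∫ ω in G, cis (R.approx φ hA (ns k) F ω) *
        Complex.exp (-(farVar D φ (ns k) F (A ω) / 2 : ℝ)) ∂P) atTop
        (𝓝 (∫ ω in G, cis (M F ω) * Complex.exp (-(offVar D φ F (A ω) / 2 : ℝ)) ∂P)) := by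
      refine tendsto_integral_of_dominated_convergence (fun _ => 1) (fun k => ?_)
        (integrable_const _) (fun k => ae_of_all _ fun ω => ?_) (ae_restrict_of_ae ?_)
      · exact ((measurable_cis.comp (Lp.stronglyMeasurable _).measurable).mul
          (hc.measurable.comp ((measurable_farVar _ F).comp hA))).aestronglyMeasurable
      · rw [norm_mul, norm_cis, one_mul, ← Complex.ofReal_neg, Complex.norm_exp_ofReal,
          Real.exp_le_one_iff]
        linarith [farVar_nonneg (D := D) (φ := φ) (ns k) F (A ω)]
      · filter_upwards [hlim] with ω hω
        refine ((continuous_cis.tendsto _).comp hω).mul ((hc.tendsto _).comp ?_)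
        exact (tendsto_farVar hφc F (A ω)).comp hns.tendsto_atTop
    -- An event of the germ belongs to the neighbourhood σ-algebra of every scale, so the identity
    -- holds for all n with the same left side.
    refine tendsto_nhds_unique (tendsto_const_nhds.congr fun k => ?_) h1
    exact R.setIntegral_cis_eq_approx hA hφc H le_rfl
      (germSigma_le_nbhdSigma (radius_pos (ns k)) _ hG) hF
  · obtain ⟨ns, hns, hlim⟩ := hsub (gradL2 g)
    filter_upwards [hlim, ae_all_iff.2 fun n => R.approx_ae_eq (φ := φ) hA n
      (gradL2_mem_dirichletSpace g), Lp.coeFn_zero ℝ 2 P] with ω h1 h2 h3 hω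
    obtain ⟨n₀, hn₀⟩ := eventually_subset_farSet hφc g.hasCompactSupport hω
    refine tendsto_nhds_unique h1 (tendsto_const_nhds.congr' ?_)
    filter_upwards [hns.tendsto_atTop.eventually_ge_atTop n₀] with k hk
    -- Once the far set contains the support of g, g is fixed by the projection and its approximate
    -- conditional mean is 0.
    rw [h2, suppProj_eq_self (gradL2_mem_suppSpace (hn₀.trans (monotone_farSet (A ω) hk))),
      sub_self, map_zero, h3, Pi.zero_apply]

end GaussianRep

/-! ### Regular conditional laws and Gaussian measures on distributions -/

/-- The conditional distribution given the identity map, viewed as taking values in Ω with the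
smaller σ-algebra m. -/
theorem exists_condKernel {Ω S : Type*} {m mΩ : MeasurableSpace Ω} [MeasurableSpace S]
    [StandardBorelSpace S] [Nonempty S] {P : Measure Ω} [IsFiniteMeasure P] (hm : m ≤ mΩ)
    {Y : Ω → S} (hY : Measurable Y) :
    ∃ κ : Kernel[m] Ω S, IsMarkovKernel κ ∧
      (∀ E : Set S, MeasurableSet E → (fun ω => (κ ω).real E) =ᵐ[P] P⟦Y ⁻¹' E | m⟧) ∧
      ∀ f : S → ℂ, StronglyMeasurable f → Integrable (fun ω => f (Y ω)) P →
        P[fun ω => f (Y ω) | m] =ᵐ[P] fun ω => ∫ y, f y ∂κ ω := by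
  have hX : Measurable[mΩ, m] (id : Ω → Ω) := measurable_id'' hm
  refine ⟨@condDistrib Ω Ω S _ _ _ mΩ m Y id P _, inferInstance, fun E hE => ?_,
    fun f hf hint => ?_⟩
  · have := @condDistrib_ae_eq_condExp Ω Ω S _ _ _ mΩ P _ id Y m E hX hY hE
    rwa [MeasurableSpace.comap_id] at this
  · have := @condExp_ae_eq_integral_condDistrib Ω Ω S ℂ _ _ _ _ mΩ P _ id Y m _ _ hX
      hY.aemeasurable f hf hint
    rwa [MeasurableSpace.comap_id] at this

/-- The mean of a Gaussian variable is bounded by any bound valid with probability more than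
one half. -/
theorem abs_mean_le_of_map_eq_gaussianReal {S : Type*} [MeasurableSpace S] {μ : Measure S}
    [IsProbabilityMeasure μ] {Y : S → ℝ} (hY : Measurable Y) {m c : ℝ} {v : NNReal}
    (hlaw : μ.map Y = gaussianReal m v) (hc : 1 / 2 < μ.real {x | |Y x| ≤ c}) : |m| ≤ c := by
  have hI : MeasurableSet {y : ℝ | |y| ≤ c} := measurableSet_le (by fun_prop) measurable_const
  have h1 : μ.real {x | |Y x| ≤ c} = (gaussianReal m v).real {y | |y| ≤ c} := by
    rw [← hlaw, map_measureReal_apply hY hI]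
    rfl
  -- The law is invariant under reflection at m. If |m| > c, the interval |y| ≤ c and its reflection
  -- are disjoint, and both would have mass above 1/2.
  have hrefl : (gaussianReal m v).map (fun y => 2 * m - y) = gaussianReal m v := by
    rw [gaussianReal_map_const_sub]
    congr 1
    ring
  have h2 : (gaussianReal m v).real {y | |y| ≤ c} =
      (gaussianReal m v).real {y | |2 * m - y| ≤ c} := by
    conv_lhs => rw [← hrefl, map_measureReal_apply (by fun_prop) hI]
    rfl
  by_contra! hcm
  have hdisj : Disjoint {y : ℝ | |y| ≤ c} {y | |2 * m - y| ≤ c} := by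
    refine Set.disjoint_left.2 fun y hy hy' => ?_
    simp only [mem_ofPred_eq, abs_le] at hy hy'
    rcases abs_cases m with h | h <;> linarith
  have h3 := measureReal_union (μ := gaussianReal m v) hdisj
    (measurableSet_le (by fun_prop) measurable_const)
  have h4 : (gaussianReal m v).real ({y : ℝ | |y| ≤ c} ∪ {y | |2 * m - y| ≤ c}) ≤ 1 :=
    measureReal_le_one
  linarith

namespace GaussianRep

variable {D : Opens ℂ} {Ω : Type*} [MeasurableSpace Ω] {P : Measure Ω} {h : Ω → Distr D}
  {B : Set ℂ} {μ : Measure (Distr D)} [IsProbabilityMeasure μ]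

theorem map_eq_gaussianReal (R : GaussianRep P h) (𝒬 : DenseTestSpace D) {a : 𝒬.Q → ℝ}
    (hadd : ∀ q q', a (q + q') = a q + a q')
    (hchar : ∀ q : 𝒬.Q, ∫ T, cis (T q) ∂μ =
      cis (a q) * Complex.exp (-(‖suppProj D B (R.pot q)‖ ^ 2 / 2 : ℝ))) (q : 𝒬.Q) :
    μ.map (fun T => T (q : TestFn D)) = gaussianReal (a q) (‖suppProj D B (R.pot q)‖₊ ^ 2) := by
  have hq : Measurable fun T : Distr D => T (q : TestFn D) := measurable_distr_apply _
  refine (map_eq_gaussianReal_iff hq.aemeasurable _ _).2 fun t => ?_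
  have h1 : Continuous fun t : ℝ => ∫ T : Distr D, cis (t * T (q : TestFn D)) ∂μ := by
    refine continuous_of_dominated (fun t => ?_) (fun t => ae_of_all _ fun T => (norm_cis _).le)
      (integrable_const _) (ae_of_all _ fun T => continuous_cis.comp (by fun_prop))
    exact (measurable_cis.comp (hq.const_mul t)).aestronglyMeasurable
  have h2 : Continuous fun t : ℝ => cis (t * a q) *
      Complex.exp (-(((‖suppProj D B (R.pot q)‖₊ ^ 2 : NNReal) : ℂ) * t ^ 2 / 2)) :=
    (continuous_cis.comp (by fun_prop)).mul (by fun_prop)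
  -- The characteristic function is known only on the rational space, hence at rational multiples;
  -- both sides are continuous in t.
  refine congrFun (Rat.isDenseEmbedding_coe_real.dense.equalizer h1 h2 (funext fun r => ?_)) t
  have h3 := hchar (r • q)
  have h4 : a (r • q) = r * a q := by
    have := map_rat_smul (AddMonoidHom.mk' a hadd) r q
    rwa [Rat.smul_def] at this
  have h5 : ((r • q : 𝒬.Q) : TestFn D) = (r : ℝ) • (q : TestFn D) :=
    (Rat.cast_smul_eq_qsmul ℝ r (q : TestFn D)).symm
  rw [h4, h5, map_smul, map_smul, norm_smul, mul_pow, Real.norm_eq_abs, sq_abs] at h3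
  simp only [map_smul, smul_eq_mul] at h3
  simp only [Function.comp_apply]
  rw [h3]
  congr 2
  push_cast
  ring

/-- Every distribution satisfies some bound k on the given level, and the sets of distributions with
bound k increase to everything, so one of them has mass above 1/2. On it all coordinates are bounded
simultaneously, hence so are all their means, with the same k. -/
theorem isBounded_of_integral_cis (R : GaussianRep P h) (𝒬 : DenseTestSpace D) {a : 𝒬.Q → ℝ}
    (hadd : ∀ q q', a (q + q') = a q + a q')
    (hchar : ∀ q : 𝒬.Q, ∫ T, cis (T q) ∂μ =
      cis (a q) * Complex.exp (-(‖suppProj D B (R.pot q)‖ ^ 2 / 2 : ℝ))) : 𝒬.IsBounded a := by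
  intro n
  let p := ContDiffMapSupportedIn.supSeminorm ℝ ℂ ℝ ⊤ (𝒬.L n)
  have hmono : Monotone p := fun i j hij => Finset.sup_mono (Finset.Iic_subset_Iic.2 hij)
  let S (k : ℕ) : Set (Distr D) := {T | ∀ f : 𝒬.level n, |T (𝒬.incl n f)| ≤ k * p k f.1}
  have hS : Monotone S := fun i j hij T hT f => (hT f).trans
    (mul_le_mul (by exact_mod_cast hij) (hmono hij _) (apply_nonneg _ _) (by positivity))
  have hU : ⋃ k, S k = univ := eq_univ_of_forall fun T => mem_iUnion.2 (𝒬.isBounded_distr T n)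
  have hlim := tendsto_measure_iUnion_atTop (μ := μ) hS
  rw [hU, measure_univ] at hlim
  obtain ⟨k, hk⟩ := (hlim.eventually (lt_mem_nhds (show (1 / 2 : ℝ≥0∞) < 1 from
    ENNReal.half_lt_self one_ne_zero ENNReal.one_ne_top))).exists
  refine ⟨k, fun f => ?_⟩
  refine abs_mean_le_of_map_eq_gaussianReal (measurable_distr_apply _)
    (R.map_eq_gaussianReal 𝒬 hadd hchar _) ?_
  have h1 := hk.trans_le (measure_mono (μ := μ) (fun T (hT : T ∈ S k) => hT f :
    S k ⊆ {T | |T (𝒬.incl n f : TestFn D)| ≤ k * p k f.1}))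
  have h2 := (ENNReal.toReal_lt_toReal (by simp) (measure_ne_top μ _)).2 h1
  rwa [ENNReal.toReal_div, ENNReal.toReal_one, ENNReal.toReal_ofNat] at h2

/-- The identity on the dense space extends to all ρ, because distributions and potentials are both
continuous along convergent test functions. -/
theorem isZeroGFFLaw_map_sub [IsProbabilityMeasure P] (R : GaussianRep P h)
    (𝒬 : DenseTestSpace D) {T₀ : Distr D}
    (hchar : ∀ q : 𝒬.Q, ∫ T, cis (T q) ∂μ =
      cis (T₀ q) * Complex.exp (-(‖suppProj D B (R.pot q)‖ ^ 2 / 2 : ℝ))) :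
    IsZeroGFFLaw D B (μ.map fun T => T - T₀) := by
  have hsub : Measurable fun T : Distr D => T - T₀ :=
    measurable_distr_sub measurable_id measurable_const
  have := Measure.isProbabilityMeasure_map (μ := μ) hsub.aemeasurable
  refine R.isZeroGFFLaw_iff.2 fun ρ => ?_
  have hρ : Measurable fun T : Distr D => cis (T ρ) :=
    measurable_cis.comp (measurable_distr_apply ρ)
  rw [integral_map hsub.aemeasurable hρ.aestronglyMeasurable]
  obtain ⟨q, hq⟩ := 𝒬.exists_seq_tendsto' ρ
  have h1 : Tendsto (fun k => ∫ T : Distr D, cis ((T - T₀) (q k : TestFn D)) ∂μ) atTop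
      (𝓝 (∫ T : Distr D, cis ((T - T₀) ρ) ∂μ)) := by
    refine tendsto_integral_of_dominated_convergence (fun _ => 1) (fun k => ?_)
      (integrable_const _) (fun k => ae_of_all _ fun T => (norm_cis _).le)
      (ae_of_all _ fun T => (continuous_cis.tendsto _).comp (tendsto_distr_apply _ hq))
    exact (measurable_cis.comp ((measurable_distr_apply _).comp hsub)).aestronglyMeasurable
  have h2 : Tendsto (fun k => Complex.exp (-(‖suppProj D B (R.pot (q k))‖ ^ 2 / 2 : ℝ))) atTop
      (𝓝 (Complex.exp (-(‖suppProj D B (R.pot ρ)‖ ^ 2 / 2 : ℝ)))) := by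
    have hc : Continuous fun F : VectorL2 => Complex.exp (-(‖suppProj D B F‖ ^ 2 / 2 : ℝ)) := by
      fun_prop
    exact (hc.tendsto _).comp (R.tendsto_pot hq)
  refine tendsto_nhds_unique h1 (h2.congr fun k => ?_)
  have h3 (T : Distr D) : cis ((T - T₀) (q k : TestFn D)) =
      cis (-T₀ (q k : TestFn D)) * cis (T (q k : TestFn D)) := by
    rw [← cis_add, neg_add_eq_sub]
    rfl
  simp only [h3]
  rw [integral_const_mul, hchar, ← mul_assoc, ← cis_add, neg_add_cancel, cis_zero, one_mul]

end GaussianRep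

/-- Harmonicity on an open set needs to be tested only against the dense test functions. -/
theorem DenseTestSpace.isHarmonicOn {D : Opens ℂ} (𝒬 : DenseTestSpace D) {B : Set ℂ}
    (hB : IsOpen B) (hBD : B ⊆ D) {T : Distr D}
    (hT : ∀ q : 𝒬.Q, tsupport (q : TestFn D) ⊆ B → T (lap q) = 0) : IsHarmonicOn B T := by
  intro g hg
  obtain ⟨n, hn, hnB⟩ := 𝒬.interpolate _ B g.hasCompactSupport hB hg hBD
  obtain ⟨q, hqs, hq⟩ := 𝒬.exists_seq_tendsto n g hn
  have h1 := tendsto_distr_apply T (((lapCLM D).continuous.tendsto g).comp hq)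
  refine tendsto_nhds_unique h1 (tendsto_const_nhds.congr fun k => ?_)
  exact (hT (q k) ((hqs k).trans hnB)).symm

/-! ### The conditional law of the field given the germ of a local set -/

namespace GaussianRep

variable {D : Opens ℂ} {φ : ℂ → ℂ} {Ω : Type*} {m mΩ : MeasurableSpace Ω} {P : Measure Ω}
  [IsProbabilityMeasure P] {h : Ω → Distr D} {A : Ω → ClosedSets}

theorem condExp_cis_eq_of_setIntegral (R : GaussianRep P h)
    (hφ : ContinuousOn φ D) (hm : m ≤ mΩ)
    (hAm : MeasurableSpace.comap A inferInstance ≤ m) (ρ : TestFn D) {Y : Ω → ℝ}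
    (hY : Measurable[m] Y)
    (H : ∀ G, MeasurableSet[m] G → ∫ ω in G, cis (R.X (R.pot ρ) ω) ∂P =
      ∫ ω in G, cis (Y ω) * Complex.exp (-(offVar D φ (R.pot ρ) (A ω) / 2 : ℝ)) ∂P) :
    P[fun ω => cis (h ω ρ) | m] =ᵐ[P] fun ω =>
      cis (R.mean ρ + Y ω) * Complex.exp (-(offVar D φ (R.pot ρ) (A ω) / 2 : ℝ)) := by
  have hc : Continuous fun v : ℝ => Complex.exp (-(v / 2 : ℝ)) := by fun_prop
  have hAm' : Measurable[m] A := measurable_iff_comap_le.2 hAm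
  have hmeas : Measurable[m] fun ω =>
      cis (R.mean ρ + Y ω) * Complex.exp (-(offVar D φ (R.pot ρ) (A ω) / 2 : ℝ)) :=
    (measurable_cis.comp (hY.const_add _)).mul
      (hc.measurable.comp ((measurable_offVar hφ _).comp hAm'))
  have hhρ : Measurable fun ω => h ω ρ := (measurable_distr_apply ρ).comp R.measurable
  symm
  refine ae_eq_condExp_of_forall_setIntegral_eq hm (integrable_cis hhρ.aemeasurable)
    (fun G hG _ => ?_) (fun G hG _ => ?_) hmeas.stronglyMeasurable.aestronglyMeasurable
  · refine Integrable.of_bound (hmeas.mono hm le_rfl).aestronglyMeasurable 1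
      (ae_of_all _ fun ω => ?_)
    rw [norm_mul, norm_cis, one_mul, ← Complex.ofReal_neg, Complex.norm_exp_ofReal,
      Real.exp_le_one_iff]
    have : 0 ≤ offVar D φ (R.pot ρ) (A ω) := sq_nonneg _
    linarith
  · simp only [cis_add, mul_assoc]
    rw [integral_const_mul, ← H G hG, ← integral_const_mul]
    refine integral_congr_ae (ae_restrict_of_ae ?_)
    filter_upwards [R.X_pot ρ] with ω hω
    rw [hω, ← cis_add, add_sub_cancel]

/-- The conditional means `a ω` are considered on the countable space only, so that additivity, the
characteristic function of κ and vanishing on Laplacians hold outside one null set. There `a ω` is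
additive and bounded, hence the restriction of a distribution, which is h₁. -/
theorem condLaw_of_pairCondIndep (R : GaussianRep P h) (hA : Measurable A)
    (hφ : DifferentiableOn ℂ φ D) (hφD : MapsTo φ D (Metric.ball 0 1))
    (H : PairCondIndep φ P h A) : CondLaw φ P h A := by
  obtain ⟨𝒬⟩ := nonempty_denseTestSpace D
  have hφc := hφ.continuousOn
  have hle : germSigma φ h A ≤ mΩ := germSigma_le R.measurable hA
  obtain ⟨M, hM, hMint, hMoff⟩ := R.exists_condMean hA hφ hφD H
  obtain ⟨κ, hκ, hκE, hκint⟩ := exists_condKernel (P := P) hle R.measurable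
  -- Versions measurable for 𝒜 itself, since h₁ has to be 𝒜-measurable without completion.
  choose Y hYmeas hYeq using fun q : 𝒬.Q => hM _ (R.pot_mem q)
  let a (ω : Ω) (q : 𝒬.Q) : ℝ := R.mean q + Y q ω
  have hadd : ∀ᵐ ω ∂P, ∀ q q', a ω (q + q') = a ω q + a ω q' := by
    refine ae_all_iff.2 fun q => ae_all_iff.2 fun q' => ?_
    have h1 : M (R.pot ((q + q' : 𝒬.Q) : TestFn D)) = M (R.pot q) + M (R.pot q') := by
      rw [Submodule.coe_add, map_add, map_add]
    filter_upwards [hYeq q, hYeq q', hYeq (q + q'), Lp.coeFn_add (M (R.pot q)) (M (R.pot q'))]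
      with ω e1 e2 e3 e4
    rw [h1, e4, Pi.add_apply, e1, e2] at e3
    simp only [a]
    rw [← e3, Submodule.coe_add, map_add]
    ring
  have hchar : ∀ᵐ ω ∂P, ∀ q : 𝒬.Q, ∫ T, cis (T q) ∂κ ω = cis (a ω q) *
      Complex.exp (-(‖suppProj D (offSet D φ (A ω)) (R.pot q)‖ ^ 2 / 2 : ℝ)) := by
    refine ae_all_iff.2 fun q => ?_
    have hq : Measurable fun T : Distr D => cis (T (q : TestFn D)) :=
      measurable_cis.comp (measurable_distr_apply _)
    have h1 := hκint (fun T => cis (T (q : TestFn D))) hq.stronglyMeasurable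
      (integrable_cis ((measurable_distr_apply _).comp R.measurable).aemeasurable)
    refine (h1.symm.trans (R.condExp_cis_eq_of_setIntegral hφc hle comap_le_germSigma q
      (hYmeas q).measurable fun G hG => ?_)).mono fun ω hω => hω
    rw [hMint _ (R.pot_mem _) G hG]
    refine integral_congr_ae (ae_restrict_of_ae ?_)
    filter_upwards [hYeq q] with ω e
    rw [e]
  have hharm : ∀ᵐ ω ∂P, ∀ q : 𝒬.Q, tsupport (q : TestFn D) ⊆ offSet D φ (A ω) →
      a ω ⟨lap q, 𝒬.lap_mem q.2⟩ = 0 := by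
    refine ae_all_iff.2 fun q => ?_
    have h1 : M (R.pot (lap (q : TestFn D))) = -M (gradL2 (q : TestFn D)) := by
      rw [← R.pot_neg_lap, map_neg, map_neg, neg_neg]
    filter_upwards [hMoff q, hYeq ⟨lap q, 𝒬.lap_mem q.2⟩, Lp.coeFn_neg (M (gradL2 (q : TestFn D)))]
      with ω e1 e2 e3 hω
    rw [h1, e3, Pi.neg_apply, e1 hω, neg_zero] at e2
    simp only [a]
    rw [← e2, R.mean_lap, add_zero]
  have hbdd : ∀ᵐ ω ∂P, a ω ∈ range 𝒬.eval := by
    filter_upwards [hadd, hchar] with ω e1 e2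
    exact 𝒬.mem_range_eval.2 ⟨e1, R.isBounded_of_integral_cis 𝒬 e1 e2⟩
  -- A measurable left inverse of evaluation, defined on all functionals, so that composing it with
  -- `a` gives an 𝒜-measurable map even on the exceptional null set.
  obtain ⟨g, hg, hgeval⟩ :=
    𝒬.measurableEmbedding_eval.exists_measurable_extend measurable_id fun _ => ⟨0⟩
  have hga : ∀ᵐ ω ∂P, ∀ q : 𝒬.Q, g (a ω) q = a ω q := by
    filter_upwards [hbdd] with ω ⟨T, hT⟩ q
    have h1 : g (a ω) = T := by
      rw [← hT]
      exact congrFun hgeval T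
    rw [h1, ← hT]
    rfl
  have hameas : Measurable[germSigma φ h A] a :=
    (@measurable_pi_iff _ _ _ (germSigma φ h A) _ _).2 fun q => (hYmeas q).measurable.const_add _
  refine ⟨fun ω => g (a ω), hg.comp hameas, ?_, κ, hκ, hκE, ?_⟩
  · filter_upwards [hga, hharm] with ω e1 e2
    refine 𝒬.isHarmonicOn (isOpen_offSet hφc _) (fun z hz => hz.1) fun q hq => ?_
    exact (e1 ⟨lap q, 𝒬.lap_mem q.2⟩).trans (e2 q hq)
  · filter_upwards [hga, hchar] with ω e1 e2
    have := hκ.isProbabilityMeasure ω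
    refine R.isZeroGFFLaw_map_sub 𝒬 fun q => ?_
    rw [e2 q, e1 q]

end GaussianRep

/-! ### From the conditional law to two-step sampling -/

/-- The hypothesis on the kernel identifies the law of (X, Y) on rectangles with the composition
product, hence everywhere. -/
theorem integral_eq_integral_kernel {Ω Ω' S : Type*} {m : MeasurableSpace Ω'}
    {mΩ : MeasurableSpace Ω} {mS : MeasurableSpace S} {P : Measure Ω} [IsProbabilityMeasure P]
    {X : Ω → Ω'} (hX : Measurable X) {Y : Ω → S} (hY : Measurable Y) {κ : Kernel Ω' S}
    [IsMarkovKernel κ]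
    (hκ : ∀ E : Set S, MeasurableSet E →
      (fun ω => (κ (X ω)).real E) =ᵐ[P] P⟦Y ⁻¹' E | m.comap X⟧)
    {f : Ω' × S → ℂ} (hf : StronglyMeasurable f) (hfi : Integrable (fun ω => f (X ω, Y ω)) P) :
    ∫ ω, f (X ω, Y ω) ∂P = ∫ ω, ∫ y, f (X ω, y) ∂κ (X ω) ∂P := by
  have hXY : Measurable fun ω => (X ω, Y ω) := hX.prodMk hY
  have := Measure.isProbabilityMeasure_map (μ := P) hX.aemeasurable
  have := Measure.isProbabilityMeasure_map (μ := P) hXY.aemeasurable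
  have hlaw : P.map (fun ω => (X ω, Y ω)) = P.map X ⊗ₘ κ := by
    refine Measure.ext_prod fun {s t} hs ht => ?_
    have ht' : Measurable fun x => κ x t := κ.measurable_coe ht
    rw [Measure.compProd_apply_prod hs ht, Measure.map_apply hXY (hs.prod ht),
      setLIntegral_map hs ht' hX]
    have h1 : ∫⁻ ω in X ⁻¹' s, κ (X ω) t ∂P ≠ ∞ := by
      refine ((lintegral_mono fun ω => prob_le_one).trans_lt ?_).ne
      rw [lintegral_one]
      exact measure_lt_top _ _
    refine (ENNReal.toReal_eq_toReal_iff' (measure_ne_top P _) h1).1 ?_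
    have h2 := setIntegral_condExp_indicator (P := P) hX.comap_le (hY ht) ⟨s, hs, rfl⟩
    rw [← integral_toReal (show Measurable fun ω => κ (X ω) t from ht'.comp hX).aemeasurable
      (ae_of_all _ fun ω => measure_lt_top _ _)]
    refine Eq.trans ?_ (h2.symm.trans (integral_congr_ae (ae_restrict_of_ae (hκ t ht).symm)))
    rw [inter_comm]
    rfl
  have h1 : Integrable f (P.map X ⊗ₘ κ) := by
    rw [← hlaw]
    exact (integrable_map_measure hf.aestronglyMeasurable hXY.aemeasurable).2 hfi
  rw [← integral_map (φ := fun ω => (X ω, Y ω)) hXY.aemeasurable hf.aestronglyMeasurable, hlaw,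
    Measure.integral_compProd h1, integral_map hX.aemeasurable]
  exact hf.integral_kernel_prod_right'.aestronglyMeasurable

/-- A compact support lies off K exactly when it lies in a far set at some scale, a condition on the
finitely valued near net; harmonicity is tested on the countable space. -/
theorem measurableSet_isHarmonicOn {D : Opens ℂ} {φ : ℂ → ℂ} (hφ : ContinuousOn φ D) :
    MeasurableSet {p : Distr D × ClosedSets | IsHarmonicOn (offSet D φ p.2) p.1} := by
  obtain ⟨𝒬⟩ := nonempty_denseTestSpace D
  have h1 : {p : Distr D × ClosedSets | IsHarmonicOn (offSet D φ p.2) p.1} =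
      ⋂ q : 𝒬.Q, ⋂ n : ℕ, {p | tsupport (q : TestFn D) ⊆ farSet D φ n (nearNet n p.2) →
        p.1 (lap q) = 0} := by
    ext p
    simp only [mem_iInter, mem_ofPred_eq]
    constructor
    · exact fun H q n hq => H q (hq.trans (farSet_nearNet_subset n _))
    · intro H
      refine 𝒬.isHarmonicOn (isOpen_offSet hφ _) (fun z hz => hz.1) fun q hq => ?_
      obtain ⟨n, hn⟩ := eventually_subset_farSet hφ (q : TestFn D).hasCompactSupport hq
      exact H q n hn
  rw [h1]
  refine MeasurableSet.iInter fun q => MeasurableSet.iInter fun n => ?_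
  refine MeasurableSet.imp ?_ ?_
  · exact measurableSet_setOfPred.2 ((measurable_comp_nearNet n
      fun I => tsupport (q : TestFn D) ⊆ farSet D φ n I).comp measurable_snd)
  · exact measurableSet_eq_fun ((measurable_distr_apply _).comp measurable_fst) measurable_const

namespace GaussianRep

variable {D : Opens ℂ} {φ : ℂ → ℂ} {Ω : Type*} {m mΩ : MeasurableSpace Ω} {P : Measure Ω}
  [IsProbabilityMeasure P] {h : Ω → Distr D} {A : Ω → ClosedSets}

/-- As h₁ and G are m-measurable, they can be held fixed while integrating against the conditional
law of h. -/
theorem setIntegral_cis_sub_of_kernel (R : GaussianRep P h) (hm : m ≤ mΩ) {h₁ : Ω → Distr D}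
    (hh₁ : Measurable[m] h₁) {κ : Kernel[m] Ω (Distr D)} [IsMarkovKernel κ]
    (hκE : ∀ E : Set (Distr D), MeasurableSet E →
      (fun ω => (κ ω).real E) =ᵐ[P] P⟦h ⁻¹' E | m⟧)
    (hκ : ∀ᵐ ω ∂P, IsZeroGFFLaw D (offSet D φ (A ω)) ((κ ω).map (fun T => T - h₁ ω)))
    (ρ : TestFn D) {G : Set Ω} (hG : MeasurableSet[m] G) :
    ∫ ω in G, cis ((h ω - h₁ ω) ρ) ∂P =
      ∫ ω in G, Complex.exp (-(offVar D φ (R.pot ρ) (A ω) / 2 : ℝ)) ∂P := by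
  let f (p : Ω × Distr D) : ℂ := G.indicator (fun _ => 1) p.1 * cis ((p.2 - h₁ p.1) ρ)
  have hf : @Measurable (Ω × Distr D) ℂ (m.prod (instMeasurableSpaceDistr D)) _ f := by
    refine Measurable.mul ?_ (measurable_cis.comp ((measurable_distr_apply ρ).comp
      (measurable_distr_sub (@measurable_snd Ω (Distr D) m (instMeasurableSpaceDistr D))
        (hh₁.comp (@measurable_fst Ω (Distr D) m (instMeasurableSpaceDistr D))))))
    exact (Measurable.indicator measurable_const hG).comp (@measurable_fst Ω (Distr D) m (instMeasurableSpaceDistr D))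
  have hd : Measurable fun ω => cis ((h ω - h₁ ω) ρ) := measurable_cis.comp
    ((measurable_distr_apply ρ).comp (measurable_distr_sub R.measurable (hh₁.mono hm le_rfl)))
  have hfi : Integrable (fun ω => f (id ω, h ω)) P := by
    refine Integrable.of_bound (((measurable_const.indicator (hm _ hG)).mul hd)).aestronglyMeasurable
      1 (ae_of_all _ fun ω => ?_)
    rw [norm_mul, norm_cis, mul_one]
    exact (norm_indicator_le_norm_self _ _).trans (by simp)
  have h1 := @integral_eq_integral_kernel Ω Ω (Distr D) m mΩ _ P _ id (measurable_id'' hm) h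
    R.measurable κ _ (by rw [MeasurableSpace.comap_id]; exact hκE) f hf.stronglyMeasurable hfi
  rw [← integral_indicator (hm _ hG), ← integral_indicator (hm _ hG)]
  refine Eq.trans (integral_congr_ae (ae_of_all _ fun ω => ?_)) (h1.trans (integral_congr_ae ?_))
  · by_cases hω : ω ∈ G <;> simp [f, hω]
  · filter_upwards [hκ] with ω hω
    have hsub : Measurable fun T : Distr D => T - h₁ ω :=
      measurable_distr_sub measurable_id measurable_const
    have hρ : Measurable fun T : Distr D => cis (T ρ) :=
      measurable_cis.comp (measurable_distr_apply ρ)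
    have := Measure.isProbabilityMeasure_map (μ := κ ω) hsub.aemeasurable
    have h2 := R.isZeroGFFLaw_iff.1 hω ρ
    rw [integral_map hsub.aemeasurable hρ.aestronglyMeasurable] at h2
    simp only [f, id]
    rw [integral_const_mul, h2]
    by_cases hω : ω ∈ G <;> simp [hω, offVar]

/-- The law ν is that of (h₁, A) and η the conditional law of h - h₁ given (h₁, A). The
characteristic function of h - h₁ given 𝒜 is a function of A, so conditioning on the smaller
σ-algebra of (h₁, A) leaves it unchanged. -/
theorem twoStepSampling_of_condLaw (R : GaussianRep P h) (hA : Measurable A)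
    (hφ : ContinuousOn φ D) (H : CondLaw φ P h A) : TwoStepSampling φ P h A := by
  obtain ⟨h₁, hh₁, hharm, κ, hκm, hκE, hκ⟩ := H
  obtain ⟨𝒬⟩ := nonempty_denseTestSpace D
  have hle : germSigma φ h A ≤ mΩ := germSigma_le R.measurable hA
  have hh₁' : Measurable h₁ := hh₁.mono hle le_rfl
  have hA' : Measurable[germSigma φ h A] A := measurable_iff_comap_le.2 comap_le_germSigma
  have hZ' : Measurable[germSigma φ h A] fun ω => (h₁ ω, A ω) := hh₁.prodMk hA'
  have hZ : Measurable fun ω => (h₁ ω, A ω) := hh₁'.prodMk hA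
  have hY : Measurable fun ω => h ω - h₁ ω := measurable_distr_sub R.measurable hh₁'
  have hc : Continuous fun v : ℝ => Complex.exp (-(v / 2 : ℝ)) := by fun_prop
  refine ⟨P.map fun ω => (h₁ ω, A ω), Measure.isProbabilityMeasure_map hZ.aemeasurable,
    (ae_map_iff hZ.aemeasurable (measurableSet_isHarmonicOn hφ)).2 hharm,
    condDistrib (fun ω => h ω - h₁ ω) (fun ω => (h₁ ω, A ω)) P, inferInstance, ?_, ?_⟩
  · have hchar : ∀ᵐ p ∂P.map fun ω => (h₁ ω, A ω), ∀ q : 𝒬.Q,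
        ∫ T, cis (T q) ∂condDistrib (fun ω => h ω - h₁ ω) (fun ω => (h₁ ω, A ω)) P p =
          Complex.exp (-(offVar D φ (R.pot q) p.2 / 2 : ℝ)) := by
      refine ae_all_iff.2 fun q => ?_
      have hq : StronglyMeasurable fun T : Distr D => cis (T (q : TestFn D)) :=
        (measurable_cis.comp (measurable_distr_apply _)).stronglyMeasurable
      have hE : Measurable fun p : Distr D × ClosedSets =>
          Complex.exp (-(offVar D φ (R.pot q) p.2 / 2 : ℝ)) :=
        hc.measurable.comp ((measurable_offVar hφ _).comp measurable_snd)
      refine (ae_map_iff hZ.aemeasurable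
        (measurableSet_eq_fun hq.integral_kernel.measurable hE)).2 ?_
      have hint := integrable_cis (μ := P)
        ((measurable_distr_apply (q : TestFn D)).comp hY).aemeasurable
      have h1 := condExp_ae_eq_integral_condDistrib hZ hY.aemeasurable hq hint
      refine h1.symm.trans (ae_eq_condExp_of_forall_setIntegral_eq hZ.comap_le hint
        (fun G hG _ => ?_) (fun G hG _ => ?_) ?_).symm
      · refine Integrable.of_bound (hE.comp hZ).aestronglyMeasurable 1 (ae_of_all _ fun ω => ?_)
        rw [← Complex.ofReal_neg, Complex.norm_exp_ofReal, Real.exp_le_one_iff]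
        have : 0 ≤ offVar D φ (R.pot q) (A ω) := sq_nonneg _
        linarith
      · exact (R.setIntegral_cis_sub_of_kernel hle hh₁ hκE hκ q (hZ'.comap_le _ hG)).symm
      · exact (hE.comp (comap_measurable _)).stronglyMeasurable.aestronglyMeasurable
    filter_upwards [hchar] with p hp
    -- The centred case: nothing is subtracted, so the kernel itself has the zero boundary law.
    have h2 := R.isZeroGFFLaw_map_sub (B := offSet D φ p.2)
      (μ := condDistrib (fun ω => h ω - h₁ ω) (fun ω => (h₁ ω, A ω)) P p) 𝒬 (T₀ := 0)
      fun q => by rw [hp q]; exact ((congrArg (· * _) cis_zero).trans (one_mul _)).symm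
    simpa only [sub_zero, Measure.map_id'] using h2
  · rw [compProd_map_condDistrib hY.aemeasurable, Measure.map_map ?_ (hZ.prodMk hY)]
    · congr 1
      funext ω
      simp
    · exact (measurable_distr_add (measurable_fst.comp measurable_fst) measurable_snd).prodMk
        (measurable_snd.comp measurable_fst)

end GaussianRep


end LocalSetGFF

end

/-! ### Assembly of the equivalences -/

theorem mainTheorem5
    (D : TopologicalSpace.Opens ℂ) (hD : IsSimplyConnected (D : Set ℂ))
    (φ : ℂ → ℂ) (hφ : DifferentiableOn ℂ φ D)
    (hφD : Set.BijOn φ (D : Set ℂ) (Metric.ball (0 : ℂ) 1))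
    (u : ℂ → ℝ) (hu : InnerProductSpace.HarmonicOnNhd u (D : Set ℂ))
    {Ω : Type*} [MeasurableSpace Ω] (P : MeasureTheory.Measure Ω)
    [MeasureTheory.IsProbabilityMeasure P]
    (h : Ω → LocalSetGFF.Distr D) (hh : LocalSetGFF.IsGFF D u P h)
    (A : Ω → LocalSetGFF.ClosedSets) (hA : Measurable A) :
    (LocalSetGFF.IsDeterminedInside D φ P A →
      List.TFAE
        [LocalSetGFF.EventCondIndep φ P h A,
         LocalSetGFF.PairCondIndep φ P h A,
         LocalSetGFF.CondLaw φ P h A,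
         LocalSetGFF.TwoStepSampling φ P h A]) ∧
    List.TFAE
      [LocalSetGFF.PairCondIndep φ P h A,
       LocalSetGFF.CondLaw φ P h A,
       LocalSetGFF.TwoStepSampling φ P h A] ∧
    (LocalSetGFF.PairCondIndep φ P h A → LocalSetGFF.EventCondIndep φ P h A) ∧
    (LocalSetGFF.EventCondIndep φ P h A ↔ LocalSetGFF.EventCondProb φ P h A) := by
  open LocalSetGFF in
  obtain ⟨R⟩ := nonempty_gaussianRep hu hh
  have hφc := hφ.continuousOn
  have h23 : PairCondIndep φ P h A → CondLaw φ P h A :=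
    R.condLaw_of_pairCondIndep hA hφ hφD.mapsTo
  have h34 : CondLaw φ P h A → TwoStepSampling φ P h A := R.twoStepSampling_of_condLaw hA hφc
  have h42 : TwoStepSampling φ P h A → PairCondIndep φ P h A :=
    R.pairCondIndep_of_twoStepSampling hA hφc
  have h21 : PairCondIndep φ P h A → EventCondIndep φ P h A :=
    R.eventCondIndep_of_pairCondIndep hA hφc
  refine ⟨fun hdet => ?_, ?_, h21, ?_⟩
  · have h12 := R.pairCondIndep_of_eventCondIndep hA hφc hdet
    tfae_have 1 → 2 := h12
    tfae_have 2 → 1 := h21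
    tfae_have 2 → 3 := h23
    tfae_have 3 → 4 := h34
    tfae_have 4 → 2 := h42
    tfae_finish
  · tfae_have 1 → 2 := h23
    tfae_have 2 → 3 := h34
    tfae_have 3 → 1 := h42
    tfae_finish
  · rw [R.eventCondIndep_iff hA hφc, R.eventCondProb_iff hA hφc]
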